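/- Let $n\ge 2$ and $0\le m\le n-1$. A collector draws coupons independently and uniformly, with replacement, from $n$ distinct coupons. Let $W_{n,m}$ be the number of draws needed to have, for the first time, $n-m$ distinct coupons. Put $\widetilde W_{n,m}=W_{n,m}-(n-m)$, $\sigma_n^2=\operatorname{Var}W_{n,m}$, $c=\lfloor \operatorname{Var}\widetilde W_{n,m}-\mathbb E\,\widetilde W_{n,m}\rfloor$, let $\mu$ be the law of $\widetilde W_{n,m}+c$, and for $j\ge1$ put $$a_{n,j}=\sum_{k=m+1}^{n}\Big(\frac{n-k}{k}\Big)^j .$$ For an integer $R\ge3$ let $$h_R(w)=-\big(a_{n,2}-\lfloor a_{n,2}\rfloor\big)w+\big(a_{n,2}-\lfloor a_{n,2}\rfloor\big)\frac{w^2}{2}+\sum_{r=3}^{R}\big(a_{n,r}+(-1)^{r+1}\lfloor a_{n,2}\rfloor\big)\frac{w^r}{r},\qquad H_{R,L}(w)=\sum_{l=0}^{L}\frac{h_R(w)^l}{l!},$$ and let $\nu_{R,L}$ be the finite signed measure on the nonnegative integers with Fourier--Stieltjes transform $$\sum_{j\ge0}e^{itj}\nu_{R,L}\{j\}=\exp\{\sigma_n^2(e^{it}-1)\}\,H_{R,L}(e^{it}-1),\qquad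 t\in\mathbb R .$$ Equivalently, if $\sigma_n^2>0$ and $\widetilde a^{(r)}$ is the coefficient of $w^r$ in $H_{R,L}(w)$, $$\nu_{R,L}\{j\}=e^{-\sigma_n^2}\frac{\sigma_n^{2j}}{j!}\sum_{r\ge0}(-1)^r\widetilde a^{(r)}C_r(j,\sigma_n^2),\qquad C_r(j,\lambda)=\sum_{k=0}^r(-1)^k\binom rk\binom jk k!\,\lambda^{-k};$$ if $\sigma_n^2=0$, then $H_{R,L}=1$ and $\nu_{R,L}$ is the unit mass at $0$. Finally let $d_{\mathrm{TV}}(\mu,\nu)=\sup_{B\subseteq\mathbb Z}|\mu(B)-\nu(B)|$. For every integer $R\ge3$ the following holds. (i) There are thresholds $m_R,n_R$ and a constant $C_R>0$, depending only on $R$, such that for all $n\ge n_R$ and $m_R\le m\le n-1$ with $a_{n,2}>1$, the measure $\nu_R=\nu_{R,R}$ satisfies $$d_{\mathrm{TV}}(\mu,\nu_R)\le C_R\,\sigma_n\log\sigma_n\Big(\frac1{\sqrt m}\Big)^{R}\quad\text{if } m\le\frac n2-1,$$ $$d_{\mathrm{TV}}(\mu,\nu_R)\le C_R\,\frac{(\sqrt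 n)^{R-3}}{(n-m)^{R-2}}\quad\text{if } m\ge\frac n2 .$$ (ii) There are a threshold $n_R$ and a constant $C_R>0$, depending only on $R$, such that for all $n\ge n_R$ and $0\le m\le n-1$ with $a_{n,2}<1$, the measure $\nu_R=\nu_{R,3R-2}$ satisfies $$d_{\mathrm{TV}}(\mu,\nu_R)\le C_R\,\frac{n-m}{(\sqrt n)^{R+1}} .$$ -/

import Mathlib

open MeasureTheory ProbabilityTheory Polynomial

namespace CouponCollector

noncomputable section

/-- Sampling with replacement from `n` coupons: `X i` is the coupon obtained at draw `i + 1`; the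
draws are independent, and each of them is uniform on the `n` coupons. -/
structure IsSampling {Ω : Type*} [MeasurableSpace Ω] (P : Measure Ω) {n : ℕ}
    (X : ℕ → Ω → Fin n) : Prop where
  measurable : ∀ i, Measurable (X i)
  indep : iIndepFun X P
  uniform : ∀ i (a : Fin n), P.real {ω | X i ω = a} = 1 / (n : ℝ)

/-- The waiting time `W_{n,m}`: the number of draws needed until `n - m` distinct coupons are
collected for the first time, that is, until only `m` coupons are missing. -/
def waitingTime {Ω : Type*} {n : ℕ} (X : ℕ → Ω → Fin n) (m : ℕ) (ω : Ω) : ℕ :=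
  sInf {N : ℕ | ((Finset.range N).image fun i => X i ω).card + m = n}

/-- The shifted waiting time `W_{n,m} - (n - m)`. -/
def shiftedTime {Ω : Type*} {n : ℕ} (X : ℕ → Ω → Fin n) (m : ℕ) (ω : Ω) : ℤ :=
  (waitingTime X m ω : ℤ) - ((n : ℤ) - (m : ℤ))

/-- The variance `σ_n²` of the waiting time. -/
def timeVar {Ω : Type*} [MeasurableSpace Ω] (P : Measure Ω) {n : ℕ} (X : ℕ → Ω → Fin n)
    (m : ℕ) : ℝ :=
  Var[fun ω => (waitingTime X m ω : ℝ); P]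

/-- The integer `c`, the integer part of variance minus mean of the shifted waiting time. -/
def shift {Ω : Type*} [MeasurableSpace Ω] (P : Measure Ω) {n : ℕ} (X : ℕ → Ω → Fin n)
    (m : ℕ) : ℤ :=
  ⌊Var[fun ω => (shiftedTime X m ω : ℝ); P] - ∫ ω, (shiftedTime X m ω : ℝ) ∂P⌋

/-- The law on `ℤ` of the shifted waiting time plus `c`, as a signed measure. -/
def law {Ω : Type*} [MeasurableSpace Ω] (P : Measure Ω) [IsProbabilityMeasure P] {n : ℕ}
    (X : ℕ → Ω → Fin n) (m : ℕ) : SignedMeasure ℤ :=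
  (P.map fun ω => shiftedTime X m ω + shift P X m).toSignedMeasure

/-- `a_{n,j} = ∑_{k=m+1}^n ((n-k)/k)^j`. -/
def aSum (n m j : ℕ) : ℝ :=
  ∑ k ∈ Finset.Icc (m + 1) n, (((n : ℝ) - (k : ℝ)) / (k : ℝ)) ^ j

/-- The polynomial `h_R(w) = -{a_{n,2}} w + {a_{n,2}} w²/2
+ ∑_{r=3}^R (a_{n,r} + (-1)^{r+1} ⌊a_{n,2}⌋) w^r/r`, with `{x} = x - ⌊x⌋`. -/
def hPoly (n m R : ℕ) : ℝ[X] :=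
  -C (aSum n m 2 - ⌊aSum n m 2⌋) * X + C ((aSum n m 2 - ⌊aSum n m 2⌋) / 2) * X ^ 2
    + ∑ r ∈ Finset.Icc 3 R, C ((aSum n m r + (-1) ^ (r + 1) * ⌊aSum n m 2⌋) / (r : ℝ)) * X ^ r

/-- The polynomial `∑_{l=0}^L h_R(w)^l / l!`. -/
def HPoly (n m R L : ℕ) : ℝ[X] :=
  ∑ l ∈ Finset.range (L + 1), C (1 / (l.factorial : ℝ)) * hPoly n m R ^ l

/-- The Charlier polynomial `C_r(j, lam)`. -/
def charlier (r j : ℕ) (lam : ℝ) : ℝ :=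
  ∑ k ∈ Finset.range (r + 1),
    (-1) ^ k * (r.choose k : ℝ) * (j.choose k : ℝ) * (k.factorial : ℝ) / lam ^ k

/-- The point mass at `j` of the Poisson--Charlier signed measure with parameter `lam` and
coefficients `H.coeff r`. (For `lam = 0` it is used only with `H = 1`, and gives the point mass
at `0`.) -/
def pcMass (lam : ℝ) (H : ℝ[X]) (j : ℕ) : ℝ :=
  Real.exp (-lam) * lam ^ j / (j.factorial : ℝ) *
    ∑ r ∈ Finset.range (H.natDegree + 1), (-1) ^ r * H.coeff r * charlier r j lam

/-- The Poisson--Charlier signed measure on `ℤ`, concentrated on the nonnegative integers. -/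
def pcMeasure (lam : ℝ) (H : ℝ[X]) : SignedMeasure ℤ :=
  (Measure.count : Measure ℤ).withDensityᵥ fun k => if 0 ≤ k then pcMass lam H k.toNat else 0

/-- Total variation distance of two finite signed measures on `ℤ`. -/
def dTV (μ ν : SignedMeasure ℤ) : ℝ :=
  ⨆ B : Set ℤ, |μ B - ν B|

/-- The Poisson probabilities times the Charlier polynomial `C_r` have generating function
`(1 - z)^r e^{lam (z - 1)}`. -/
theorem hasSum_charlier {lam : ℝ} (hl : 0 < lam) (r : ℕ) (z : ℂ) :
    HasSum (fun j : ℕ => ((Real.exp (-lam) * lam ^ j / (j.factorial : ℝ) * charlier r j lam : ℝ) : ℂ)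
      * z ^ j) ((1 - z) ^ r * Complex.exp (lam * (z - 1))) := by
  have key : ∀ k : ℕ, HasSum (fun j : ℕ => ((Real.exp (-lam) * lam ^ j / (j.factorial : ℝ) *
      ((j.choose k : ℝ) * (k.factorial : ℝ) / lam ^ k) : ℝ) : ℂ) * z ^ j)
      (z ^ k * Complex.exp (lam * (z - 1))) := by
    intro k
    have h0 : HasSum (fun j : ℕ => ((lam : ℂ) * z) ^ j / (j.factorial : ℂ))
        (Complex.exp (lam * z)) := by
      rw [Complex.exp_eq_exp_ℂ]
      exact NormedSpace.expSeries_div_hasSum_exp _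
    have h1 := h0.mul_left (z ^ k * Complex.exp (-lam))
    rw [mul_assoc, ← Complex.exp_add] at h1
    rw [show (lam : ℂ) * (z - 1) = -lam + lam * z by ring]
    rw [← hasSum_nat_add_iff' k, Finset.sum_eq_zero, sub_zero]
    · convert h1 using 1
      · rfl
      ext i
      have hc : (((i + k).choose k : ℕ) : ℂ) * (k.factorial : ℂ) * (i.factorial : ℂ)
          = ((i + k).factorial : ℂ) := by
        have := Nat.add_choose_mul_factorial_mul_factorial i k
        rw [← this]
        push_cast
        ring
      have hl' : (lam : ℂ) ≠ 0 := by exact_mod_cast hl.ne'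
      have hi : (i.factorial : ℂ) ≠ 0 := by exact_mod_cast i.factorial_ne_zero
      have hk : (k.factorial : ℂ) ≠ 0 := by exact_mod_cast k.factorial_ne_zero
      have hik : (((i + k).choose k : ℕ) : ℂ) ≠ 0 := by
        exact_mod_cast (Nat.choose_pos (Nat.le_add_left k i)).ne'
      push_cast
      rw [div_mul_div_comm, mul_pow, pow_add, pow_add, ← hc]
      field_simp
    · intro i hi
      rw [Nat.choose_eq_zero_of_lt (Finset.mem_range.1 hi)]
      simp
  have h2 := hasSum_sum (s := Finset.range (r + 1)) fun k _ =>
    (key k).mul_left (((-1) ^ k * (r.choose k : ℝ) : ℝ) : ℂ)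
  convert h2 using 1
  · rfl
  · ext j
    rw [charlier]
    push_cast
    rw [Finset.mul_sum, Finset.sum_mul]
    refine Finset.sum_congr rfl fun k _ => ?_
    ring
  · rw [sub_eq_add_neg, add_comm, add_pow, Finset.sum_mul]
    refine Finset.sum_congr rfl fun k _ => ?_
    rw [neg_pow]
    push_cast
    ring

/-- The Poisson--Charlier measure is the signed measure on the nonnegative integers whose
Fourier--Stieltjes transform is `exp (lam (e^{it} - 1)) H(e^{it} - 1)`. -/
theorem hasSum_pcMass {lam : ℝ} (hl : 0 < lam) (H : ℝ[X]) (t : ℝ) :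
    HasSum (fun j : ℕ => (pcMass lam H j : ℂ) * Complex.exp (t * Complex.I) ^ j)
      (Complex.exp (lam * (Complex.exp (t * Complex.I) - 1)) *
        aeval (Complex.exp (t * Complex.I) - 1) H) := by
  have h2 := hasSum_sum (s := Finset.range (H.natDegree + 1)) fun r _ =>
    (hasSum_charlier hl r (Complex.exp (t * Complex.I))).mul_left
      (((-1) ^ r * H.coeff r : ℝ) : ℂ)
  convert h2 using 1
  · rfl
  · ext j
    rw [pcMass]
    push_cast
    rw [Finset.mul_sum, Finset.sum_mul]
    refine Finset.sum_congr rfl fun k _ => ?_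
    ring
  · rw [aeval_eq_sum_range, Finset.mul_sum]
    refine Finset.sum_congr rfl fun k _ => ?_
    rw [← neg_sub (Complex.exp (t * Complex.I)) 1, neg_pow (Complex.exp (t * Complex.I) - 1),
      Complex.real_smul]
    have : ((-1 : ℂ) ^ k) * (-1) ^ k = 1 := by rw [← mul_pow]; simp
    push_cast
    linear_combination (-(Complex.exp (lam * (Complex.exp (t * Complex.I) - 1)) * H.coeff k
      * (Complex.exp (t * Complex.I) - 1) ^ k)) * this

end

end CouponCollector

namespace CouponCollector
noncomputable section

/-! While `k` coupons are missing, the number of wasted draws is geometric with mean `x_k = odds n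
k`, so the shifted waiting time has generating function `∏ (1 - x_k w)⁻¹` in `w = z - 1`, mean `a₁`
and variance `σ² = a₁ + a₂`. Hence `c = ⌊a₂⌋`, and the shift contributes the factor `(1 + w) ^ c`.
In the Taylor series of the logarithm of the product, the linear coefficient is `a₁ + c`, which is
`σ²` minus the fractional part of `a₂`, the quadratic one is half that fractional part, and the
others are those of `hPoly`. So the transform is `exp (σ² w + h(w) + remainder)`; truncating the
logarithm at degree `R` and the exponential of `h` at degree `L` gives the transform of the
Poisson-Charlier measure (`logTaylor_combination`, `gf_eq_exp`).

The two transforms are compared uniformly on the unit circle (`Regime.norm_transform_sub_le`). For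
small `w` the Gaussian factor `|exp (σ² w)| = exp (-σ² |w|² / 2)` absorbs both `exp |h|` and all
polynomial factors in `σ |w|`. For large `w` both transforms are exponentially small. The result is
`O(β ^ (R + 1))`, where `β` is a small parameter, a power of `n` or of `m`. Fourier inversion turns
this into a pointwise bound, and Markov's inequality cuts off the tails (`Regime.sum_sub_le`).

The passage from pointwise to `ℓ¹` loses a power of `β⁻¹`. This is repaired by using the comparison
only for a much larger order `R'`, where the loss is harmless, and by comparing the Poisson-Charlier
measures of orders `R'` and `R` directly. For the latter no Fourier analysis is needed: by
orthogonality of the Charlier polynomials, the total variation norm of such a measure is at most a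
constant times the weighted coefficient norm `wnorm (1 / σ)` of its polynomial
(`tsum_abs_pcMass_le`). This leaves `‖h‖ ^ (L + 1) + ∑_{R < r ≤ R'} (a_r + c) σ ^ (-r)` up to an
arbitrary power of `β` (`Regime.tsum_abs_sub_pcMass_le`).

What remains is elementary estimation of `a_r`, `c` and `σ` in three ranges: `m ≤ n / 2`; `m ≥ n /
2` with `a₂ > 1`; and `a₂ < 1`, which forces `n - m = O(n ^ (2/3))`. In the first range `n` may be
too large compared with `m` for the general bound; then the claimed bound is at least a constant and
the trivial estimate suffices. The logarithm in that range is not needed: the estimate is proved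
without it. -/

/-! ### Charlier polynomials in `L²` of the Poisson law -/

/-- The Poisson probabilities. -/
def poissonWeight (lam : ℝ) (j : ℕ) : ℝ := Real.exp (-lam) * lam ^ j / (j.factorial : ℝ)

lemma poissonWeight_nonneg {lam : ℝ} (hl : 0 ≤ lam) (j : ℕ) : 0 ≤ poissonWeight lam j := by
  unfold poissonWeight; positivity

lemma poissonWeight_succ {lam : ℝ} (hl : 0 < lam) (j : ℕ) :
    poissonWeight lam (j + 1) * (((j : ℝ) + 1) / lam) = poissonWeight lam j := by
  unfold poissonWeight
  rw [Nat.factorial_succ, pow_succ]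
  have : (j.factorial : ℝ) ≠ 0 := by positivity
  push_cast
  field_simp

lemma charlier_zero_left (j : ℕ) (lam : ℝ) : charlier 0 j lam = 1 := by
  simp [charlier]

lemma charlier_zero_right (r : ℕ) (lam : ℝ) : charlier r 0 lam = 1 := by
  rw [charlier, Finset.sum_range_succ']
  simp

/-- Pascal's rule in the argument: the forward difference lowers the degree. Together with
`charlier_succ`, its adjoint for the Poisson weight, it yields the norms by induction. -/
lemma charlier_diff (r j : ℕ) (lam : ℝ) :
    charlier (r + 1) (j + 1) lam - charlier (r + 1) j lam
      = -(((r : ℝ) + 1) / lam) * charlier r j lam := by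
  rw [charlier, charlier, charlier, Finset.sum_range_succ', Finset.sum_range_succ' _ (r + 1)]
  simp only [Nat.choose_zero_right, Nat.factorial_zero, pow_zero]
  rw [add_sub_add_right_eq_sub, ← Finset.sum_sub_distrib, Finset.mul_sum]
  refine Finset.sum_congr rfl fun k _ => ?_
  have h1 : ((r : ℝ) + 1) * (r.choose k : ℝ) = ((r + 1).choose (k + 1) : ℝ) * ((k : ℝ) + 1) := by
    exact_mod_cast Nat.add_one_mul_choose_eq r k
  have h2 : ((j + 1).choose (k + 1) : ℝ) = (j.choose k : ℝ) + (j.choose (k + 1) : ℝ) := by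
    exact_mod_cast Nat.choose_succ_succ j k
  rw [h2, Nat.factorial_succ]
  push_cast
  rw [pow_succ lam k, pow_succ (-1 : ℝ) k]
  simp only [div_eq_mul_inv, mul_inv]
  linear_combination ((-1 : ℝ) ^ k * (j.choose k : ℝ) * (k.factorial : ℝ) * (lam ^ k)⁻¹ * lam⁻¹) * h1

/-- Pascal's rule in the degree: up to the Poisson weight, the degree is raised by a backward
difference. -/
lemma charlier_succ (r j : ℕ) (lam : ℝ) :
    charlier (r + 1) (j + 1) lam
      = charlier r (j + 1) lam - (((j : ℝ) + 1) / lam) * charlier r j lam := by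
  have h0 : charlier r (j + 1) lam = ∑ k ∈ Finset.range (r + 1 + 1),
      (-1) ^ k * (r.choose k : ℝ) * ((j + 1).choose k : ℝ) * (k.factorial : ℝ) / lam ^ k := by
    rw [Finset.sum_range_succ _ (r + 1), charlier]
    simp
  rw [h0, charlier, charlier, Finset.sum_range_succ', Finset.sum_range_succ' _ (r + 1)]
  simp only [Nat.choose_zero_right, Nat.factorial_zero, pow_zero]
  rw [add_sub_right_comm, Finset.mul_sum, ← Finset.sum_sub_distrib]
  congr 1
  refine Finset.sum_congr rfl fun k _ => ?_
  have h1 : ((j : ℝ) + 1) * (j.choose k : ℝ) = ((j + 1).choose (k + 1) : ℝ) * ((k : ℝ) + 1) := by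
    exact_mod_cast Nat.add_one_mul_choose_eq j k
  have h2 : ((r + 1).choose (k + 1) : ℝ) = (r.choose k : ℝ) + (r.choose (k + 1) : ℝ) := by
    exact_mod_cast Nat.choose_succ_succ r k
  rw [h2, Nat.factorial_succ]
  push_cast
  rw [pow_succ lam k, pow_succ (-1 : ℝ) k]
  simp only [div_eq_mul_inv, mul_inv]
  linear_combination ((-1 : ℝ) ^ k * (r.choose k : ℝ) * (k.factorial : ℝ) * (lam ^ k)⁻¹ * lam⁻¹) * h1

/-- Polynomial growth, used only for summability; the constant depends on `lam`, so it plays no role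
in the estimates. -/
lemma exists_abs_charlier_le (r : ℕ) (lam : ℝ) :
    ∃ K : ℝ, 0 ≤ K ∧ ∀ j, |charlier r j lam| ≤ K * ((j : ℝ) + 1) ^ r := by
  refine ⟨∑ k ∈ Finset.range (r + 1), (r.choose k : ℝ) * |(lam ^ k)⁻¹|, by positivity, fun j => ?_⟩
  rw [charlier, Finset.sum_mul]
  refine (Finset.abs_sum_le_sum_abs _ _).trans (Finset.sum_le_sum fun k hk => ?_)
  have hk' : k ≤ r := Nat.lt_succ_iff.1 (Finset.mem_range.1 hk)
  have h1 : (j.choose k : ℝ) * (k.factorial : ℝ) ≤ ((j : ℝ) + 1) ^ r := by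
    have : j.choose k * k.factorial ≤ (j + 1) ^ r := by
      rw [mul_comm, ← Nat.descFactorial_eq_factorial_mul_choose]
      exact (Nat.descFactorial_le_pow j k).trans
        ((Nat.pow_le_pow_left (Nat.le_succ j) k).trans (Nat.pow_le_pow_right (Nat.succ_pos j) hk'))
    exact_mod_cast this
  rw [div_eq_mul_inv, abs_mul, abs_mul, abs_mul, abs_mul, abs_pow, abs_neg, abs_one, one_pow, one_mul,
    Nat.abs_cast, Nat.abs_cast, Nat.abs_cast]
  calc (r.choose k : ℝ) * (j.choose k : ℝ) * (k.factorial : ℝ) * |(lam ^ k)⁻¹|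
      = (r.choose k : ℝ) * |(lam ^ k)⁻¹| * ((j.choose k : ℝ) * (k.factorial : ℝ)) := by ring
    _ ≤ _ := by gcongr

lemma summable_poissonWeight_mul_pow (lam : ℝ) (k : ℕ) :
    Summable fun j : ℕ => |poissonWeight lam j| * ((j : ℝ) + 1) ^ k := by
  have h := (Real.summable_pow_div_factorial (Real.exp 1 * |lam|)).mul_left
    (Real.exp (-lam) * (k.factorial * Real.exp 1))
  refine Summable.of_nonneg_of_le (fun j => by positivity) (fun j => ?_) h
  have h1 : ((j : ℝ) + 1) ^ k ≤ k.factorial * Real.exp (j + 1) := by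
    have := Real.pow_div_factorial_le_exp ((j : ℝ) + 1) (by positivity) k
    rwa [div_le_iff₀ (by positivity), mul_comm] at this
  have h2 : Real.exp ((j : ℝ) + 1) = Real.exp 1 ^ j * Real.exp 1 := by
    rw [Real.exp_add, ← Real.exp_nat_mul, mul_one]
  have h3 : |poissonWeight lam j| = Real.exp (-lam) * |lam| ^ j / (j.factorial : ℝ) := by
    rw [poissonWeight, abs_div, abs_mul, Real.abs_exp, abs_pow, Nat.abs_cast]
  rw [h3]
  calc _ ≤ Real.exp (-lam) * |lam| ^ j / (j.factorial : ℝ) *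
        (k.factorial * (Real.exp 1 ^ j * Real.exp 1)) := by rw [← h2]; gcongr
    _ = _ := by rw [mul_pow]; ring

lemma summable_poissonWeight_charlier_mul (lam : ℝ) (r s e : ℕ) :
    Summable fun j : ℕ => poissonWeight lam j * charlier r (j + e) lam * charlier s j lam := by
  obtain ⟨K, hK, h1⟩ := exists_abs_charlier_le r lam
  obtain ⟨K', hK', h2⟩ := exists_abs_charlier_le s lam
  refine Summable.of_norm_bounded
    ((summable_poissonWeight_mul_pow lam (r + s)).mul_left (K * ((e : ℝ) + 1) ^ r * K')) fun j => ?_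
  rw [norm_mul, norm_mul, Real.norm_eq_abs, Real.norm_eq_abs, Real.norm_eq_abs]
  have h3 : |charlier r (j + e) lam| ≤ K * (((e : ℝ) + 1) * ((j : ℝ) + 1)) ^ r := by
    refine (h1 _).trans ?_
    gcongr
    push_cast
    nlinarith [mul_nonneg (Nat.cast_nonneg (α := ℝ) e) (Nat.cast_nonneg (α := ℝ) j)]
  calc _ ≤ |poissonWeight lam j| * (K * (((e : ℝ) + 1) * ((j : ℝ) + 1)) ^ r) *
        (K' * ((j : ℝ) + 1) ^ s) := by gcongr; exact h2 j
    _ = _ := by rw [mul_pow, pow_add]; ring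

lemma hasSum_poissonWeight (lam : ℝ) : HasSum (poissonWeight lam) 1 := by
  have h := (NormedSpace.expSeries_div_hasSum_exp lam).mul_left (Real.exp (-lam))
  rw [← Real.exp_eq_exp_ℝ, ← Real.exp_add, neg_add_cancel, Real.exp_zero] at h
  refine h.congr_fun fun j => ?_
  simp [poissonWeight, mul_div_assoc]

/-- The Charlier polynomials have norm `(r! / lam ^ r) ^ (1/2)` with respect to the Poisson law. -/
lemma hasSum_sq_charlier {lam : ℝ} (hl : 0 < lam) (r : ℕ) :
    HasSum (fun j : ℕ => poissonWeight lam j * charlier r j lam ^ 2)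
      ((r.factorial : ℝ) / lam ^ r) := by
  induction r with
  | zero => simpa [charlier_zero_left] using hasSum_poissonWeight lam
  | succ r ih =>
    have hs : Summable fun j : ℕ => poissonWeight lam j * charlier (r + 1) j lam ^ 2 := by
      simpa [sq, mul_assoc] using summable_poissonWeight_charlier_mul lam (r + 1) (r + 1) 0
    have ha : Summable fun j : ℕ => poissonWeight lam j * charlier (r + 1) j lam * charlier r j lam :=
      summable_poissonWeight_charlier_mul lam (r + 1) r 0
    have hb : Summable fun j : ℕ =>
        poissonWeight lam j * charlier (r + 1) (j + 1) lam * charlier r j lam :=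
      summable_poissonWeight_charlier_mul lam (r + 1) r 1
    have key : ∑' j : ℕ, poissonWeight lam j * charlier (r + 1) j lam ^ 2
        = (((r : ℝ) + 1) / lam) * ((r.factorial : ℝ) / lam ^ r) := by
      rw [hs.tsum_eq_zero_add]
      -- Summation by parts: one of the two factors is expanded by `charlier_succ`, and its
      -- coefficient `(j + 1) / lam` moves the Poisson weight from `j + 1` back to `j`.
      have e1 : ∀ j : ℕ, poissonWeight lam (j + 1) * charlier (r + 1) (j + 1) lam ^ 2
          = poissonWeight lam (j + 1) * charlier (r + 1) (j + 1) lam * charlier r (j + 1) lam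
            - poissonWeight lam j * charlier (r + 1) (j + 1) lam * charlier r j lam := by
        intro j
        rw [← poissonWeight_succ hl j, sq]
        nth_rewrite 2 [charlier_succ]
        ring
      simp_rw [e1]
      rw [Summable.tsum_sub ((summable_nat_add_iff 1).2 ha) hb]
      have e2 := ha.tsum_eq_zero_add
      simp only [charlier_zero_right] at e2 ⊢
      rw [← ih.tsum_eq, ← tsum_mul_left]
      -- The lowering relation produces the same two series, so the norms of degrees `r + 1` and `r`
      -- have ratio `(r + 1) / lam`.
      have e3 : ∀ j : ℕ, ((r : ℝ) + 1) / lam * (poissonWeight lam j * charlier r j lam ^ 2)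
          = poissonWeight lam j * charlier (r + 1) j lam * charlier r j lam
            - poissonWeight lam j * charlier (r + 1) (j + 1) lam * charlier r j lam := by
        intro j
        linear_combination (poissonWeight lam j * charlier r j lam) * charlier_diff r j lam
      simp_rw [e3]
      rw [Summable.tsum_sub ha hb]
      linarith
    have := hs.hasSum
    rw [key] at this
    convert this using 1
    rw [Nat.factorial_succ, pow_succ]
    push_cast
    field_simp

/-- The `L²` norm of the Charlier polynomial `C_r`. -/
def charlierNorm (lam : ℝ) (r : ℕ) : ℝ := √((r.factorial : ℝ) / lam ^ r)

lemma charlierNorm_pos {lam : ℝ} (hl : 0 < lam) (r : ℕ) : 0 < charlierNorm lam r := by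
  unfold charlierNorm; positivity

lemma sq_charlierNorm {lam : ℝ} (hl : 0 < lam) (r : ℕ) :
    charlierNorm lam r ^ 2 = (r.factorial : ℝ) / lam ^ r :=
  Real.sq_sqrt (by positivity)

/-- The weighted arithmetic-geometric mean inequality replaces Cauchy-Schwarz for series: with `t`
equal to the `L²` norm of the Charlier polynomial, the termwise bounds sum to the right constant and
also give summability. -/
lemma abs_mul_le_half {t : ℝ} (ht : 0 < t) (a b : ℝ) : a * |b| ≤ (t * a ^ 2 + b ^ 2 / t) / 2 := by
  have h : 0 ≤ (t * a - |b|) ^ 2 / t := by positivity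
  have e : (t * a - |b|) ^ 2 / t = t * a ^ 2 - 2 * (a * |b|) + b ^ 2 / t := by
    rw [← sq_abs b]; field_simp; ring
  linarith

lemma tsum_abs_charlier_le {lam : ℝ} (hl : 0 < lam) (r : ℕ) :
    (Summable fun j : ℕ => poissonWeight lam j * |charlier r j lam|) ∧
      ∑' j : ℕ, poissonWeight lam j * |charlier r j lam| ≤ charlierNorm lam r := by
  set t := charlierNorm lam r with ht
  have htp : 0 < t := charlierNorm_pos hl r
  have h := ((hasSum_poissonWeight lam).mul_left (t / 2)).add
    ((hasSum_sq_charlier hl r).mul_left (1 / (2 * t)))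
  have hle : ∀ j : ℕ, poissonWeight lam j * |charlier r j lam| ≤
      t / 2 * poissonWeight lam j + 1 / (2 * t) * (poissonWeight lam j * charlier r j lam ^ 2) := by
    intro j
    have := mul_le_mul_of_nonneg_left (abs_mul_le_half htp 1 (charlier r j lam))
      (poissonWeight_nonneg hl.le j)
    rw [one_mul] at this
    refine this.trans (le_of_eq ?_)
    field_simp
  have hs : Summable fun j : ℕ => poissonWeight lam j * |charlier r j lam| :=
    Summable.of_nonneg_of_le
      (fun j => mul_nonneg (poissonWeight_nonneg hl.le j) (abs_nonneg _)) hle h.summable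
  refine ⟨hs, (hs.tsum_le_tsum hle h.summable).trans (le_of_eq ?_)⟩
  rw [h.tsum_eq, ← sq_charlierNorm hl r, ← ht]
  field_simp
  ring

/-- The argument is itself a Charlier combination, `j = lam * (1 - C₁(j))`, so its second moment is
controlled by the norms of degrees `0` and `1`. -/
lemma tsum_mul_abs_charlier_le {lam : ℝ} (hl : 0 < lam) (r : ℕ) :
    (Summable fun j : ℕ => (j : ℝ) * (poissonWeight lam j * |charlier r j lam|)) ∧
      ∑' j : ℕ, (j : ℝ) * (poissonWeight lam j * |charlier r j lam|)
        ≤ charlierNorm lam r * (1 + lam) ^ 2 := by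
  set t := charlierNorm lam r with ht
  have htp : 0 < t := charlierNorm_pos hl r
  have h := (((hasSum_poissonWeight lam).mul_left (t * lam ^ 2)).add
    ((hasSum_sq_charlier hl 1).mul_left (t * lam ^ 2))).add
    ((hasSum_sq_charlier hl r).mul_left (1 / (2 * t)))
  have hle : ∀ j : ℕ, (j : ℝ) * (poissonWeight lam j * |charlier r j lam|) ≤
      t * lam ^ 2 * poissonWeight lam j
        + t * lam ^ 2 * (poissonWeight lam j * charlier 1 j lam ^ 2)
        + 1 / (2 * t) * (poissonWeight lam j * charlier r j lam ^ 2) := by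
    intro j
    have h1 := abs_mul_le_half htp (j : ℝ) (charlier r j lam)
    have h2 : (j : ℝ) = lam * (1 - charlier 1 j lam) := by
      simp [charlier, Finset.sum_range_succ]
      field_simp
    have h3 : (j : ℝ) ^ 2 ≤ 2 * lam ^ 2 * (1 + charlier 1 j lam ^ 2) := by
      rw [h2]
      nlinarith [mul_nonneg (sq_nonneg lam) (sq_nonneg (1 + charlier 1 j lam))]
    have h4 : (j : ℝ) * |charlier r j lam| ≤ t * lam ^ 2 * (1 + charlier 1 j lam ^ 2)
        + 1 / (2 * t) * charlier r j lam ^ 2 := by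
      refine h1.trans ?_
      have : t * (j : ℝ) ^ 2 ≤ t * (2 * lam ^ 2 * (1 + charlier 1 j lam ^ 2)) := by gcongr
      have e : 1 / (2 * t) * charlier r j lam ^ 2 = charlier r j lam ^ 2 / t / 2 := by
        field_simp
      rw [e]
      linarith
    have := mul_le_mul_of_nonneg_left h4 (poissonWeight_nonneg hl.le j)
    linarith
  have hs : Summable fun j : ℕ => (j : ℝ) * (poissonWeight lam j * |charlier r j lam|) :=
    Summable.of_nonneg_of_le (fun j => mul_nonneg (Nat.cast_nonneg j)
      (mul_nonneg (poissonWeight_nonneg hl.le j) (abs_nonneg _))) hle h.summable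
  refine ⟨hs, (hs.tsum_le_tsum hle h.summable).trans ?_⟩
  rw [h.tsum_eq, ← sq_charlierNorm hl r, ← ht, Nat.factorial_one]
  have : t * lam ^ 2 * 1 + t * lam ^ 2 * (((1 : ℕ) : ℝ) / lam ^ 1) + 1 / (2 * t) * t ^ 2
      = t * (lam ^ 2 + lam + 1 / 2) := by
    field_simp
    push_cast
    ring
  rw [this]
  gcongr
  nlinarith

/-! ### The weighted coefficient norm and the truncated exponentials -/

/-- The weighted `ℓ¹` norm `∑ |P_i| ρ^i` of a polynomial. -/
def wnorm (ρ : ℝ) (P : ℝ[X]) : ℝ := P.sum fun i a => |a| * ρ ^ i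

lemma wnorm_eq_sum_range {ρ : ℝ} {P : ℝ[X]} {N : ℕ} (h : P.natDegree < N) :
    wnorm ρ P = ∑ i ∈ Finset.range N, |P.coeff i| * ρ ^ i :=
  P.sum_over_range' (fun i => by simp) N h

lemma wnorm_nonneg {ρ : ℝ} (hρ : 0 ≤ ρ) (P : ℝ[X]) : 0 ≤ wnorm ρ P :=
  Finset.sum_nonneg fun i _ => by positivity

lemma wnorm_zero (ρ : ℝ) : wnorm ρ 0 = 0 := by simp [wnorm]

lemma wnorm_monomial (ρ : ℝ) (i : ℕ) (a : ℝ) : wnorm ρ (monomial i a) = |a| * ρ ^ i := by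
  rw [wnorm, sum_monomial_index _ _ (by simp)]

lemma wnorm_C_mul_X_pow (ρ : ℝ) (i : ℕ) (a : ℝ) : wnorm ρ (C a * X ^ i) = |a| * ρ ^ i := by
  rw [C_mul_X_pow_eq_monomial, wnorm_monomial]

lemma wnorm_neg (ρ : ℝ) (P : ℝ[X]) : wnorm ρ (-P) = wnorm ρ P := by
  rw [wnorm_eq_sum_range (N := P.natDegree + 1) (by simp),
    wnorm_eq_sum_range (N := P.natDegree + 1) (by simp)]
  simp

lemma wnorm_add_le {ρ : ℝ} (hρ : 0 ≤ ρ) (P Q : ℝ[X]) : wnorm ρ (P + Q) ≤ wnorm ρ P + wnorm ρ Q := by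
  set N := max P.natDegree Q.natDegree + 1
  have h3 : (P + Q).natDegree < N := Nat.lt_succ_of_le (natDegree_add_le P Q)
  rw [wnorm_eq_sum_range h3, wnorm_eq_sum_range (N := N) (P := P) (by omega),
    wnorm_eq_sum_range (N := N) (P := Q) (by omega), ← Finset.sum_add_distrib]
  refine Finset.sum_le_sum fun i _ => ?_
  rw [coeff_add, ← add_mul]
  gcongr
  exact abs_add_le _ _

lemma wnorm_sum_le {ρ : ℝ} (hρ : 0 ≤ ρ) {ι : Type*} (s : Finset ι) (f : ι → ℝ[X]) :
    wnorm ρ (∑ i ∈ s, f i) ≤ ∑ i ∈ s, wnorm ρ (f i) := by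
  classical
  induction s using Finset.induction_on with
  | empty => simp [wnorm_zero]
  | insert a s ha ih =>
    rw [Finset.sum_insert ha, Finset.sum_insert ha]
    exact (wnorm_add_le hρ _ _).trans (by gcongr)

/-- Submultiplicativity is what reduces every estimate of `HPoly` to one of `hPoly`. The same norm
serves on the circle, with `ρ = ‖w‖`, and for total variation, with `ρ = 1 / σ`. -/
lemma wnorm_mul_le {ρ : ℝ} (hρ : 0 ≤ ρ) (P Q : ℝ[X]) : wnorm ρ (P * Q) ≤ wnorm ρ P * wnorm ρ Q := by
  rw [mul_eq_sum_sum]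
  refine (wnorm_sum_le hρ _ _).trans ?_
  rw [wnorm, wnorm, Polynomial.sum, Finset.sum_mul]
  refine Finset.sum_le_sum fun i _ => ?_
  rw [Polynomial.sum, Polynomial.sum]
  refine (wnorm_sum_le hρ _ _).trans ?_
  rw [Finset.mul_sum]
  refine Finset.sum_le_sum fun j _ => ?_
  rw [wnorm_monomial, abs_mul, pow_add]
  exact le_of_eq (by ring)

lemma wnorm_one (ρ : ℝ) : wnorm ρ 1 = 1 := by
  have := wnorm_C_mul_X_pow ρ 0 1
  simpa using this

lemma wnorm_pow_le {ρ : ℝ} (hρ : 0 ≤ ρ) (P : ℝ[X]) (l : ℕ) : wnorm ρ (P ^ l) ≤ wnorm ρ P ^ l := by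
  induction l with
  | zero => simp [wnorm_one]
  | succ l ih =>
    rw [pow_succ, pow_succ]
    exact (wnorm_mul_le hρ _ _).trans (mul_le_mul_of_nonneg_right ih (wnorm_nonneg hρ _))

lemma wnorm_C_mul (ρ a : ℝ) (P : ℝ[X]) : wnorm ρ (C a * P) = |a| * wnorm ρ P := by
  have h : (C a * P).natDegree < P.natDegree + 1 := Nat.lt_succ_of_le (natDegree_C_mul_le a P)
  rw [wnorm_eq_sum_range h, wnorm_eq_sum_range (Nat.lt_succ_self _), Finset.mul_sum]
  simp [abs_mul, mul_assoc]

lemma wnorm_pow_sub_pow_le {ρ B : ℝ} (hρ : 0 ≤ ρ) {P Q : ℝ[X]} (hP : wnorm ρ P ≤ B)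
    (hQ : wnorm ρ Q ≤ B) (l : ℕ) :
    wnorm ρ (P ^ l - Q ^ l) ≤ l * B ^ (l - 1) * wnorm ρ (P - Q) := by
  have hB : 0 ≤ B := (wnorm_nonneg hρ P).trans hP
  rw [← (Commute.all P Q).geom_sum₂_mul]
  refine (wnorm_mul_le hρ _ _).trans (mul_le_mul_of_nonneg_right ?_ (wnorm_nonneg hρ _))
  refine (wnorm_sum_le hρ _ _).trans ?_
  rw [← nsmul_eq_mul]
  refine (Finset.sum_le_card_nsmul _ _ (B ^ (l - 1)) fun i hi => ?_).trans (by simp)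
  have hi' := Finset.mem_range.1 hi
  refine (wnorm_mul_le hρ _ _).trans ?_
  have e : B ^ (l - 1) = B ^ i * B ^ (l - 1 - i) := by
    rw [← pow_add]; congr 1; omega
  rw [e]
  exact mul_le_mul ((wnorm_pow_le hρ P i).trans (pow_le_pow_left₀ (wnorm_nonneg hρ _) hP _))
    ((wnorm_pow_le hρ Q _).trans (pow_le_pow_left₀ (wnorm_nonneg hρ _) hQ _))
    (wnorm_nonneg hρ _) (by positivity)

lemma norm_aeval_le_wnorm (P : ℝ[X]) (w : ℂ) : ‖aeval w P‖ ≤ wnorm ‖w‖ P := by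
  rw [aeval_eq_sum_range, wnorm_eq_sum_range (Nat.lt_succ_self _)]
  refine (norm_sum_le _ _).trans (Finset.sum_le_sum fun i _ => ?_)
  rw [norm_smul, norm_pow, Real.norm_eq_abs]

lemma natDegree_hPoly_le (n m : ℕ) {R : ℕ} (hR : 3 ≤ R) : (hPoly n m R).natDegree ≤ R := by
  unfold hPoly
  refine natDegree_add_le_of_degree_le (natDegree_add_le_of_degree_le ?_ ?_)
    (natDegree_sum_le_of_forall_le _ _ fun r hr => ?_)
  · rw [← C_neg]
    exact ((natDegree_C_mul_le _ _).trans natDegree_X_le).trans (by omega)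
  · exact (natDegree_C_mul_X_pow_le _ _).trans (by omega)
  · exact (natDegree_C_mul_X_pow_le _ _).trans (Finset.mem_Icc.1 hr).2

lemma natDegree_HPoly_le (n m : ℕ) {R : ℕ} (hR : 3 ≤ R) (L : ℕ) :
    (HPoly n m R L).natDegree ≤ L * R := by
  unfold HPoly
  refine natDegree_sum_le_of_forall_le _ _ fun l hl => (natDegree_C_mul_le _ _).trans ?_
  refine natDegree_pow_le.trans ?_
  have := Finset.mem_range.1 hl
  exact Nat.mul_le_mul (by omega) (natDegree_hPoly_le n m hR)

lemma wnorm_HPoly_le (n m R L : ℕ) {ρ : ℝ} (hρ : 0 ≤ ρ) :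
    wnorm ρ (HPoly n m R L) ≤ ∑ l ∈ Finset.range (L + 1), wnorm ρ (hPoly n m R) ^ l := by
  refine (wnorm_sum_le hρ _ _).trans (Finset.sum_le_sum fun l _ => ?_)
  rw [wnorm_C_mul, abs_of_nonneg (by positivity)]
  have h1 : 1 / (l.factorial : ℝ) ≤ 1 := by
    rw [div_le_one (by positivity)]
    exact_mod_cast Nat.one_le_iff_ne_zero.2 l.factorial_ne_zero
  calc _ ≤ 1 * wnorm ρ (hPoly n m R ^ l) := by gcongr; exact wnorm_nonneg hρ _
    _ ≤ _ := by rw [one_mul]; exact wnorm_pow_le hρ _ _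

/-- The difference of two truncations, in terms of the omitted terms of the exponent and of the
omitted powers. -/
lemma wnorm_HPoly_sub_le (n m : ℕ) {R R' L L' : ℕ} (hL : L ≤ L') {ρ B : ℝ} (hρ : 0 ≤ ρ) (hB : 1 ≤ B)
    (h1 : wnorm ρ (hPoly n m R) ≤ B) (h2 : wnorm ρ (hPoly n m R') ≤ B) :
    wnorm ρ (HPoly n m R' L' - HPoly n m R L) ≤
      (L' + 1) ^ 2 * B ^ L' * (wnorm ρ (hPoly n m R' - hPoly n m R)
        + wnorm ρ (hPoly n m R) ^ (L + 1)) := by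
  have hB0 : 0 ≤ B := zero_le_one.trans hB
  set D := wnorm ρ (hPoly n m R' - hPoly n m R) with hD
  set T := wnorm ρ (hPoly n m R) with hT
  have hD0 : 0 ≤ D := wnorm_nonneg hρ _
  have hT0 : 0 ≤ T := wnorm_nonneg hρ _
  -- Powers up to `L` occur in both sums and leave a difference of powers. A power beyond `L` is
  -- split into such a difference and an omitted power of `hPoly n m R`.
  have e : HPoly n m R' L' - HPoly n m R L =
      ∑ l ∈ Finset.range (L' + 1), (C (1 / (l.factorial : ℝ)) *
        (hPoly n m R' ^ l - hPoly n m R ^ l) + if l ≤ L then 0 else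
          C (1 / (l.factorial : ℝ)) * hPoly n m R ^ l) := by
    have : HPoly n m R L = ∑ l ∈ Finset.range (L' + 1),
        if l ≤ L then C (1 / (l.factorial : ℝ)) * hPoly n m R ^ l else 0 := by
      rw [← Finset.sum_filter, HPoly]
      refine Finset.sum_congr ?_ fun _ _ => rfl
      ext l
      simp only [Finset.mem_range, Finset.mem_filter]
      omega
    rw [this, HPoly, ← Finset.sum_sub_distrib]
    refine Finset.sum_congr rfl fun l _ => ?_
    split_ifs <;> ring
  rw [e]
  refine (wnorm_sum_le hρ _ _).trans ?_
  have hterm : ∀ l ∈ Finset.range (L' + 1), wnorm ρ (C (1 / (l.factorial : ℝ)) *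
        (hPoly n m R' ^ l - hPoly n m R ^ l) + if l ≤ L then 0 else
          C (1 / (l.factorial : ℝ)) * hPoly n m R ^ l) ≤ (L' + 1) * B ^ L' * (D + T ^ (L + 1)) := by
    intro l hl
    have hl' : l ≤ L' := Nat.lt_succ_iff.1 (Finset.mem_range.1 hl)
    have hf : |1 / (l.factorial : ℝ)| ≤ 1 := by
      rw [abs_of_nonneg (by positivity), div_le_one (by positivity)]
      exact_mod_cast Nat.one_le_iff_ne_zero.2 l.factorial_ne_zero
    refine (wnorm_add_le hρ _ _).trans ?_
    have a1 : wnorm ρ (C (1 / (l.factorial : ℝ)) * (hPoly n m R' ^ l - hPoly n m R ^ l))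
        ≤ (L' + 1) * B ^ L' * D := by
      rw [wnorm_C_mul]
      calc _ ≤ 1 * (l * B ^ (l - 1) * D) := by
            gcongr
            · exact wnorm_nonneg hρ _
            · exact wnorm_pow_sub_pow_le hρ h2 h1 l
        _ ≤ _ := by
            rw [one_mul]
            refine mul_le_mul_of_nonneg_right (mul_le_mul ?_ (pow_le_pow_right₀ hB (by omega))
              (by positivity) (by positivity)) hD0
            have : (l : ℝ) ≤ L' := by exact_mod_cast hl'
            linarith
    have a2 : wnorm ρ (if l ≤ L then 0 else C (1 / (l.factorial : ℝ)) * hPoly n m R ^ l)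
        ≤ (L' + 1) * B ^ L' * T ^ (L + 1) := by
      split_ifs with h
      · rw [wnorm_zero]; positivity
      · have hq : T ^ (l - (L + 1)) ≤ (L' + 1) * B ^ L' := by
          have hBL : 0 ≤ B ^ L' := by positivity
          have hq1 : T ^ (l - (L + 1)) ≤ B ^ L' := (pow_le_pow_left₀ hT0 h1 _).trans
            (pow_le_pow_right₀ hB (show l - (L + 1) ≤ L' by omega))
          exact hq1.trans
            (le_mul_of_one_le_left hBL (by linarith [Nat.cast_nonneg (α := ℝ) L']))
        have hp : T ^ l = T ^ (l - (L + 1)) * T ^ (L + 1) := by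
          rw [← pow_add]; congr 1; omega
        rw [wnorm_C_mul]
        refine (mul_le_mul hf (wnorm_pow_le hρ _ _) (wnorm_nonneg hρ _) zero_le_one).trans ?_
        rw [one_mul, ← hT, hp]
        exact mul_le_mul_of_nonneg_right hq (by positivity)
    rw [mul_add]
    exact add_le_add a1 a2
  refine (Finset.sum_le_card_nsmul _ _ _ hterm).trans (le_of_eq ?_)
  rw [Finset.card_range, nsmul_eq_mul]
  push_cast
  ring

/-! ### Total variation and first moment of Poisson-Charlier measures -/

lemma pcMass_eq_sum_range (lam : ℝ) {H : ℝ[X]} {N : ℕ} (h : H.natDegree < N) (j : ℕ) :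
    pcMass lam H j = ∑ r ∈ Finset.range N,
      poissonWeight lam j * ((-1) ^ r * H.coeff r * charlier r j lam) := by
  rw [pcMass, ← Finset.mul_sum, poissonWeight]
  congr 1
  refine Finset.sum_subset (fun r hr => ?_) fun r _ hr => ?_
  · simp only [Finset.mem_range] at hr ⊢; omega
  · rw [coeff_eq_zero_of_natDegree_lt (by simp only [Finset.mem_range] at hr; omega)]
    simp

lemma pcMass_sub (lam : ℝ) (H G : ℝ[X]) (j : ℕ) :
    pcMass lam (H - G) j = pcMass lam H j - pcMass lam G j := by
  set N := max H.natDegree G.natDegree + 1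
  have h3 : (H - G).natDegree < N := Nat.lt_succ_of_le (natDegree_sub_le H G)
  rw [pcMass_eq_sum_range lam h3, pcMass_eq_sum_range (N := N) (H := H) lam (by omega),
    pcMass_eq_sum_range (N := N) (H := G) lam (by omega), ← Finset.sum_sub_distrib]
  refine Finset.sum_congr rfl fun r _ => ?_
  rw [coeff_sub]
  ring

/-- For bounded degree the factorial is a constant, so `C_r` has size `lam ^ (-r / 2)`; hence the
weight `1 / √lam` in `wnorm`. -/
lemma charlierNorm_le {lam : ℝ} (hl : 0 < lam) {r D : ℕ} (h : r ≤ D) :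
    charlierNorm lam r ≤ √(D.factorial : ℝ) * (1 / √lam) ^ r := by
  have e : lam ^ r = (√lam ^ r) ^ 2 := by
    rw [← pow_mul, mul_comm, pow_mul, Real.sq_sqrt hl.le]
  rw [charlierNorm, Real.sqrt_div (by positivity), e, Real.sqrt_sq (by positivity), div_pow, one_pow,
    div_eq_mul_one_div]
  gcongr

lemma abs_pcMass_le {lam : ℝ} (hl : 0 < lam) {H : ℝ[X]} {D : ℕ} (h : H.natDegree ≤ D) (j : ℕ) :
    |pcMass lam H j| ≤ ∑ r ∈ Finset.range (D + 1),
      |H.coeff r| * (poissonWeight lam j * |charlier r j lam|) := by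
  rw [pcMass_eq_sum_range lam (Nat.lt_succ_of_le h)]
  refine (Finset.abs_sum_le_sum_abs _ _).trans (Finset.sum_le_sum fun r _ => le_of_eq ?_)
  rw [abs_mul, abs_mul, abs_mul, abs_pow, abs_neg, abs_one, one_pow,
    abs_of_nonneg (poissonWeight_nonneg hl.le j)]
  ring

lemma sum_coeff_charlierNorm_le {lam : ℝ} (hl : 0 < lam) {H : ℝ[X]} {D : ℕ} (h : H.natDegree ≤ D) :
    ∑ r ∈ Finset.range (D + 1), |H.coeff r| * charlierNorm lam r
      ≤ √(D.factorial : ℝ) * wnorm (1 / √lam) H := by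
  rw [wnorm_eq_sum_range (Nat.lt_succ_of_le h), Finset.mul_sum]
  refine Finset.sum_le_sum fun r hr => ?_
  have := charlierNorm_le hl (Nat.lt_succ_iff.1 (Finset.mem_range.1 hr))
  calc _ ≤ |H.coeff r| * (√(D.factorial : ℝ) * (1 / √lam) ^ r) := by gcongr
    _ = _ := by ring

/-- The total variation norm of a Poisson-Charlier measure. -/
lemma tsum_abs_pcMass_le {lam : ℝ} (hl : 0 < lam) {H : ℝ[X]} {D : ℕ} (h : H.natDegree ≤ D) :
    (Summable fun j => |pcMass lam H j|) ∧
      ∑' j, |pcMass lam H j| ≤ √(D.factorial : ℝ) * wnorm (1 / √lam) H := by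
  have hs := hasSum_sum (s := Finset.range (D + 1)) fun r _ =>
    (tsum_abs_charlier_le hl r).1.hasSum.mul_left |H.coeff r|
  have hsum : Summable fun j => |pcMass lam H j| :=
    Summable.of_nonneg_of_le (fun j => abs_nonneg _) (abs_pcMass_le hl h) hs.summable
  refine ⟨hsum, (hsum.tsum_le_tsum (abs_pcMass_le hl h) hs.summable).trans ?_⟩
  rw [hs.tsum_eq]
  refine le_trans (Finset.sum_le_sum fun r _ => ?_) (sum_coeff_charlierNorm_le hl h)
  exact mul_le_mul_of_nonneg_left (tsum_abs_charlier_le hl r).2 (abs_nonneg _)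

/-- The first absolute moment of a Poisson-Charlier measure. -/
lemma tsum_mul_abs_pcMass_le {lam : ℝ} (hl : 0 < lam) {H : ℝ[X]} {D : ℕ} (h : H.natDegree ≤ D) :
    (Summable fun j : ℕ => (j : ℝ) * |pcMass lam H j|) ∧
      ∑' j : ℕ, (j : ℝ) * |pcMass lam H j|
        ≤ √(D.factorial : ℝ) * wnorm (1 / √lam) H * (1 + lam) ^ 2 := by
  have hs := hasSum_sum (s := Finset.range (D + 1)) fun r _ =>
    (tsum_mul_abs_charlier_le hl r).1.hasSum.mul_left |H.coeff r|
  have hle : ∀ j : ℕ, (j : ℝ) * |pcMass lam H j| ≤ ∑ r ∈ Finset.range (D + 1),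
      |H.coeff r| * ((j : ℝ) * (poissonWeight lam j * |charlier r j lam|)) := by
    intro j
    refine (mul_le_mul_of_nonneg_left (abs_pcMass_le hl h j) (Nat.cast_nonneg j)).trans
      (le_of_eq ?_)
    rw [Finset.mul_sum]
    exact Finset.sum_congr rfl fun r _ => by ring
  have hsum : Summable fun j : ℕ => (j : ℝ) * |pcMass lam H j| :=
    Summable.of_nonneg_of_le (fun j => by positivity) hle hs.summable
  refine ⟨hsum, (hsum.tsum_le_tsum hle hs.summable).trans ?_⟩
  rw [hs.tsum_eq]
  refine le_trans ?_
    (mul_le_mul_of_nonneg_right (sum_coeff_charlierNorm_le hl h) (by positivity))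
  rw [Finset.sum_mul]
  refine Finset.sum_le_sum fun r _ => ?_
  rw [mul_assoc]
  exact mul_le_mul_of_nonneg_left (tsum_mul_abs_charlier_le hl r).2 (abs_nonneg _)

/-! ### The logarithm of the generating function -/

/-- The mean number `(n - k) / k` of unsuccessful draws while `k` coupons are missing. -/
def odds (n k : ℕ) : ℝ := ((n : ℝ) - (k : ℝ)) / (k : ℝ)

lemma aSum_eq (n m j : ℕ) : aSum n m j = ∑ k ∈ Finset.Icc (m + 1) n, odds n k ^ j := rfl

lemma odds_nonneg {n m k : ℕ} (hk : k ∈ Finset.Icc (m + 1) n) : 0 ≤ odds n k := by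
  have : (k : ℝ) ≤ n := by exact_mod_cast (Finset.mem_Icc.1 hk).2
  exact div_nonneg (by linarith) (Nat.cast_nonneg k)

lemma aSum_nonneg (n m j : ℕ) : 0 ≤ aSum n m j :=
  Finset.sum_nonneg fun _ hk => pow_nonneg (odds_nonneg hk) j

/-- The sum of the variances `x + x ^ 2` of the geometric variables with means `x = odds n k`. -/
def varSum (n m : ℕ) : ℝ := aSum n m 1 + aSum n m 2

lemma aSum_two_le_varSum (n m : ℕ) : aSum n m 2 ≤ varSum n m := by
  have := aSum_nonneg n m 1
  unfold varSum; linarith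

lemma varSum_nonneg (n m : ℕ) : 0 ≤ varSum n m :=
  (aSum_nonneg n m 2).trans (aSum_two_le_varSum n m)

/-- The generating function, in `w = z - 1`, of a sum of independent geometric variables. -/
def geomGF (n m : ℕ) (w : ℂ) : ℂ := ∏ k ∈ Finset.Icc (m + 1) n, (1 - odds n k * w)⁻¹

lemma floor_aSum_nonneg (n m j : ℕ) : (0 : ℝ) ≤ ⌊aSum n m j⌋ := by
  exact_mod_cast Int.floor_nonneg.2 (aSum_nonneg n m j)

lemma sum_range_eq_add_Icc {M : Type*} [AddCommMonoid M] (g : ℕ → M) {R : ℕ} (hR : 3 ≤ R) :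
    ∑ j ∈ Finset.range (R + 1), g j = g 0 + g 1 + g 2 + ∑ j ∈ Finset.Icc 3 R, g j := by
  rw [Finset.range_eq_Ico, ← Finset.sum_Ico_consecutive g (Nat.zero_le 3) (by omega : 3 ≤ R + 1)]
  congr 1
  · simp [Finset.sum_range_succ]

lemma aeval_hPoly (n m R : ℕ) (w : ℂ) : aeval w (hPoly n m R) =
    -(aSum n m 2 - ⌊aSum n m 2⌋) * w + (aSum n m 2 - ⌊aSum n m 2⌋) / 2 * w ^ 2
      + ∑ r ∈ Finset.Icc 3 R, (aSum n m r + (-1) ^ (r + 1) * ⌊aSum n m 2⌋) / r * w ^ r := by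
  simp only [hPoly, map_add, map_sum, map_mul, map_neg, aeval_C, aeval_X, map_pow,
    Complex.coe_algebraMap]
  push_cast
  ring_nf

/-- This identity explains the shape of `hPoly`: `hPoly` is what the logarithm of the shifted law
exceeds `σ² w` by. The shift by `⌊a₂⌋` leaves only the fractional part of `a₂` in degrees one and
two. -/
lemma logTaylor_combination (n m : ℕ) {R : ℕ} (hR : 3 ≤ R) (w : ℂ) :
    (⌊aSum n m 2⌋ : ℂ) * Complex.logTaylor (R + 1) w
      - ∑ k ∈ Finset.Icc (m + 1) n, Complex.logTaylor (R + 1) (-(odds n k * w))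
      = varSum n m * w + aeval w (hPoly n m R) := by
  have h1 : ∑ k ∈ Finset.Icc (m + 1) n, Complex.logTaylor (R + 1) (-(odds n k * w))
      = ∑ j ∈ Finset.range (R + 1), -((aSum n m j : ℂ) * w ^ j / j) := by
    simp only [Complex.logTaylor]
    rw [Finset.sum_comm]
    refine Finset.sum_congr rfl fun j _ => ?_
    rw [aSum_eq]
    push_cast
    rw [Finset.sum_mul, Finset.sum_div, ← Finset.sum_neg_distrib]
    refine Finset.sum_congr rfl fun k _ => ?_
    rw [neg_pow (_ * _), mul_pow, pow_succ]
    have : ((-1 : ℂ) ^ j) * (-1) ^ j = 1 := by rw [← mul_pow]; simp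
    linear_combination (-(odds n k : ℂ) ^ j * w ^ j / j) * this
  -- The term of index `0` is a division by zero, hence `0`.
  rw [h1, Complex.logTaylor, Finset.mul_sum, ← Finset.sum_sub_distrib, sum_range_eq_add_Icc _ hR,
    aeval_hPoly, varSum]
  have h2 : ∀ r ∈ Finset.Icc 3 R, (⌊aSum n m 2⌋ : ℂ) * ((-1) ^ (r + 1) * w ^ r / r)
      - -((aSum n m r : ℂ) * w ^ r / r)
      = (aSum n m r + (-1) ^ (r + 1) * ⌊aSum n m 2⌋) / r * w ^ r := fun r _ => by ring
  rw [Finset.sum_congr rfl h2]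
  push_cast
  ring

lemma norm_log_sub_logTaylor_le {z : ℂ} (hz : ‖z‖ ≤ 1 / 8) (R : ℕ) :
    ‖Complex.log (1 + z) - Complex.logTaylor (R + 1) z‖ ≤ 2 * ‖z‖ ^ (R + 1) := by
  refine (Complex.norm_log_sub_logTaylor_le R (by linarith)).trans ?_
  have h1 : (1 - ‖z‖)⁻¹ ≤ 2 := by
    rw [inv_le_comm₀ (by linarith) (by norm_num)]; linarith
  rw [div_le_iff₀ (by positivity)]
  have h2 : (0 : ℝ) ≤ ‖z‖ ^ (R + 1) := by positivity
  calc ‖z‖ ^ (R + 1) * (1 - ‖z‖)⁻¹ ≤ ‖z‖ ^ (R + 1) * 2 := by gcongr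
    _ = 2 * ‖z‖ ^ (R + 1) * 1 := by ring
    _ ≤ _ := by
      gcongr
      linarith [Nat.cast_nonneg (α := ℝ) R]

lemma one_add_ne_zero_of_norm_le {z : ℂ} (hz : ‖z‖ ≤ 1 / 8) : 1 + z ≠ 0 := by
  intro h
  have : z = -1 := by linear_combination h
  rw [this] at hz
  norm_num at hz

/-- The logarithm of each factor is expanded, and `ρ` collects the Taylor remainders. When `⌊a₂⌋ =
0` the factor `(1 + w) ^ ⌊a₂⌋` is trivial and `log (1 + w)` is not needed, so `w` itself need not be
small. -/
lemma gf_eq_exp (n m : ℕ) {R : ℕ} (hR : 3 ≤ R) {w : ℂ}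
    (hx : ∀ k ∈ Finset.Icc (m + 1) n, odds n k * ‖w‖ ≤ 1 / 8)
    (hc : ⌊aSum n m 2⌋ = 0 ∨ ‖w‖ ≤ 1 / 8) :
    ∃ ρ : ℂ, (1 + w) ^ ⌊aSum n m 2⌋.toNat * geomGF n m w
        = Complex.exp (varSum n m * w + aeval w (hPoly n m R) + ρ) ∧
      ‖ρ‖ ≤ 2 * (aSum n m (R + 1) + ⌊aSum n m 2⌋) * ‖w‖ ^ (R + 1) := by
  have hfl : (0 : ℤ) ≤ ⌊aSum n m 2⌋ := Int.floor_nonneg.2 (aSum_nonneg n m 2)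
  have hcast : ((⌊aSum n m 2⌋.toNat : ℕ) : ℂ) = (⌊aSum n m 2⌋ : ℂ) := by
    rw [← Int.cast_natCast, Int.toNat_of_nonneg hfl]
  have hz : ∀ k ∈ Finset.Icc (m + 1) n, ‖-(odds n k * w : ℂ)‖ ≤ 1 / 8 := by
    intro k hk
    rw [norm_neg, norm_mul, Complex.norm_real, Real.norm_eq_abs, abs_of_nonneg (odds_nonneg hk)]
    exact hx k hk
  refine ⟨(⌊aSum n m 2⌋ : ℂ) * (Complex.log (1 + w) - Complex.logTaylor (R + 1) w)
    - ∑ k ∈ Finset.Icc (m + 1) n, (Complex.log (1 + -(odds n k * w))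
      - Complex.logTaylor (R + 1) (-(odds n k * w))), ?_, ?_⟩
  · rw [← logTaylor_combination n m hR, Finset.sum_sub_distrib]
    have e1 : (1 + w) ^ ⌊aSum n m 2⌋.toNat
        = Complex.exp ((⌊aSum n m 2⌋ : ℂ) * Complex.log (1 + w)) := by
      rcases hc with hc | hc
      · simp [hc]
      · rw [← hcast, Complex.exp_nat_mul, Complex.exp_log (one_add_ne_zero_of_norm_le hc)]
    have e2 : geomGF n m w = Complex.exp (-∑ k ∈ Finset.Icc (m + 1) n,
        Complex.log (1 + -(odds n k * w))) := by
      rw [← Finset.sum_neg_distrib, Complex.exp_sum]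
      refine Finset.prod_congr rfl fun k hk => ?_
      rw [Complex.exp_neg, Complex.exp_log (one_add_ne_zero_of_norm_le (hz k hk)), sub_eq_add_neg]
    rw [e1, e2, ← Complex.exp_add]
    congr 1
    ring
  · refine (norm_sub_le _ _).trans ?_
    rw [mul_add, add_mul, add_comm]
    refine add_le_add ?_ ?_
    · refine (norm_sum_le _ _).trans ?_
      rw [aSum_eq, Finset.mul_sum, Finset.sum_mul]
      refine Finset.sum_le_sum fun k hk => ?_
      refine (norm_log_sub_logTaylor_le (hz k hk) R).trans (le_of_eq ?_)
      rw [norm_neg, norm_mul, Complex.norm_real, Real.norm_eq_abs, abs_of_nonneg (odds_nonneg hk),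
        mul_pow, mul_assoc]
    · rw [norm_mul, Complex.norm_intCast, abs_of_nonneg (floor_aSum_nonneg n m 2)]
      rcases hc with hc | hc
      · simp [hc]
      · calc _ ≤ (⌊aSum n m 2⌋ : ℝ) * (2 * ‖w‖ ^ (R + 1)) := by
              gcongr
              exact norm_log_sub_logTaylor_le hc R
          _ = _ := by ring

lemma fract_nonneg' (n m : ℕ) : 0 ≤ aSum n m 2 - ⌊aSum n m 2⌋ := by
  linarith [Int.floor_le (aSum n m 2)]

lemma fract_le_one' (n m : ℕ) : aSum n m 2 - ⌊aSum n m 2⌋ ≤ 1 := by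
  linarith [Int.lt_floor_add_one (aSum n m 2)]

lemma wnorm_hPoly_term_le (n m : ℕ) {ρ : ℝ} (hρ : 0 ≤ ρ) {r : ℕ} (hr : 3 ≤ r) :
    wnorm ρ (C ((aSum n m r + (-1) ^ (r + 1) * ⌊aSum n m 2⌋) / (r : ℝ)) * X ^ r)
      ≤ (aSum n m r + ⌊aSum n m 2⌋) / 3 * ρ ^ r := by
  rw [wnorm_C_mul_X_pow, abs_div, Nat.abs_cast]
  have h3 : (3 : ℝ) ≤ r := by exact_mod_cast hr
  have := floor_aSum_nonneg n m 2
  gcongr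
  · exact add_nonneg (aSum_nonneg n m r) this
  · refine (abs_add_le _ _).trans ?_
    rw [abs_of_nonneg (aSum_nonneg n m r), abs_mul, abs_pow, abs_neg, abs_one, one_pow, one_mul,
      abs_of_nonneg this]

lemma wnorm_hPoly_le (n m R : ℕ) {ρ : ℝ} (hρ : 0 ≤ ρ) :
    wnorm ρ (hPoly n m R) ≤ (aSum n m 2 - ⌊aSum n m 2⌋) * ρ
      + (aSum n m 2 - ⌊aSum n m 2⌋) / 2 * ρ ^ 2
      + ∑ r ∈ Finset.Icc 3 R, (aSum n m r + ⌊aSum n m 2⌋) / 3 * ρ ^ r := by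
  have h0 := fract_nonneg' n m
  unfold hPoly
  refine (wnorm_add_le hρ _ _).trans (add_le_add ((wnorm_add_le hρ _ _).trans (add_le_add ?_ ?_)) ?_)
  · rw [neg_mul, wnorm_neg]
    have := wnorm_C_mul_X_pow ρ 1 (aSum n m 2 - ⌊aSum n m 2⌋)
    rw [pow_one, pow_one, abs_of_nonneg h0] at this
    exact this.le
  · rw [wnorm_C_mul_X_pow, abs_of_nonneg (by positivity)]
  · exact (wnorm_sum_le hρ _ _).trans
      (Finset.sum_le_sum fun r hr => wnorm_hPoly_term_le n m hρ (Finset.mem_Icc.1 hr).1)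

lemma wnorm_hPoly_sub_le (n m : ℕ) {R R' : ℕ} (hRR : R ≤ R') (hR : 3 ≤ R) {ρ : ℝ} (hρ : 0 ≤ ρ) :
    wnorm ρ (hPoly n m R' - hPoly n m R) ≤
      ∑ r ∈ Finset.Icc (R + 1) R', (aSum n m r + ⌊aSum n m 2⌋) * ρ ^ r := by
  have hd : Finset.Icc 3 R' = Finset.Icc 3 R ∪ Finset.Icc (R + 1) R' := by
    ext i; simp only [Finset.mem_union, Finset.mem_Icc]; omega
  have hdis : Disjoint (Finset.Icc 3 R) (Finset.Icc (R + 1) R') := by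
    rw [Finset.disjoint_left]
    intro i hi hi'
    simp only [Finset.mem_Icc] at hi hi'
    omega
  have e : hPoly n m R' - hPoly n m R = ∑ r ∈ Finset.Icc (R + 1) R',
      C ((aSum n m r + (-1) ^ (r + 1) * ⌊aSum n m 2⌋) / (r : ℝ)) * X ^ r := by
    rw [hPoly, hPoly, hd, Finset.sum_union hdis]
    ring
  rw [e]
  refine (wnorm_sum_le hρ _ _).trans (Finset.sum_le_sum fun r hr => ?_)
  have hr' := (Finset.mem_Icc.1 hr).1
  refine (wnorm_hPoly_term_le n m hρ (by omega)).trans ?_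
  have := add_nonneg (aSum_nonneg n m r) (floor_aSum_nonneg n m 2)
  gcongr
  linarith

/-! ### Uniform comparison of the transforms on the unit circle -/

/-- The quantitative hypotheses under which the expansion in powers of `β` is valid. -/
structure Regime (C₀ κ β : ℝ) (n m : ℕ) : Prop where
  beta_pos : 0 < β
  beta_le_one : β ≤ 1
  var_pos : 0 < varSum n m
  -- The three bounds say that `h`, as a polynomial in `σ w`, has coefficient of degree `r` at most
  -- `(C₀ β) ^ r`. The fractional part is the coefficient in degrees one and two, hence two bounds
  -- for it.
  fract_le : aSum n m 2 - ⌊aSum n m 2⌋ ≤ C₀ * β * √(varSum n m)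
  fract_le_sq : aSum n m 2 - ⌊aSum n m 2⌋ ≤ (C₀ * β * √(varSum n m)) ^ 2
  coeff_le : ∀ r, 3 ≤ r → aSum n m r + ⌊aSum n m 2⌋ ≤ (C₀ * β * √(varSum n m)) ^ r
  -- Either the logarithms converge on the whole circle, where `‖w‖ ≤ 2`, or `σ² / X²` is at least
  -- `κ / β²`, which makes both transforms negligible for `‖w‖ ≥ 1 / (8 X)`.
  spread : (⌊aSum n m 2⌋ = 0 ∧ ∀ k ∈ Finset.Icc (m + 1) n, odds n k ≤ 1 / 16) ∨
    ∃ X : ℝ, 1 ≤ X ∧ (∀ k ∈ Finset.Icc (m + 1) n, odds n k ≤ X) ∧ κ * X ^ 2 ≤ β ^ 2 * varSum n m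

/-- In the variable `u = σ ρ` the term of degree `r` is at most `(C₀ β u) ^ r`. One factor `β` is
kept and the rest is bounded by a polynomial in `1 + u`, to be absorbed by the Gaussian factor. -/
lemma Regime.wnorm_hPoly_le {C₀ κ β : ℝ} {n m : ℕ} (h : Regime C₀ κ β n m) (hC : 1 ≤ C₀) {R : ℕ}
    (hR : 3 ≤ R) {ρ : ℝ} (hρ : 0 ≤ ρ) :
    wnorm ρ (hPoly n m R) ≤ β * (R * (C₀ * (1 + √(varSum n m) * ρ)) ^ R) := by
  set u := √(varSum n m) * ρ with hu
  have hu0 : 0 ≤ u := by positivity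
  have hb := h.beta_pos
  have hterm : ∀ r, 1 ≤ r → r ≤ R → (C₀ * β * √(varSum n m)) ^ r * ρ ^ r
      ≤ β * (C₀ * (1 + u)) ^ R := by
    intro r hr hrR
    have e : (C₀ * β * √(varSum n m)) ^ r * ρ ^ r = β ^ r * (C₀ * u) ^ r := by
      rw [← mul_pow, ← mul_pow, hu]; ring
    rw [e]
    refine mul_le_mul (pow_le_of_le_one hb.le h.beta_le_one (by omega)) ?_ (by positivity) hb.le
    calc (C₀ * u) ^ r ≤ (C₀ * (1 + u)) ^ r := by gcongr; linarith
      _ ≤ _ := pow_le_pow_right₀ (one_le_mul_of_one_le_of_one_le hC (by linarith)) hrR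
  refine (CouponCollector.wnorm_hPoly_le n m R hρ).trans ?_
  have h1 : (aSum n m 2 - ⌊aSum n m 2⌋) * ρ ≤ β * (C₀ * (1 + u)) ^ R := by
    have := hterm 1 le_rfl (by omega)
    rw [pow_one, pow_one] at this
    exact (mul_le_mul_of_nonneg_right h.fract_le hρ).trans this
  have h2 : (aSum n m 2 - ⌊aSum n m 2⌋) / 2 * ρ ^ 2 ≤ β * (C₀ * (1 + u)) ^ R := by
    refine le_trans ?_ (hterm 2 (by omega) (by omega))
    refine mul_le_mul_of_nonneg_right ?_ (by positivity)
    linarith [h.fract_le_sq, fract_nonneg' n m]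
  have h3 : ∑ r ∈ Finset.Icc 3 R, (aSum n m r + ⌊aSum n m 2⌋) / 3 * ρ ^ r
      ≤ ((R : ℝ) - 2) * (β * (C₀ * (1 + u)) ^ R) := by
    refine (Finset.sum_le_card_nsmul _ _ (β * (C₀ * (1 + u)) ^ R) fun r hr => ?_).trans ?_
    · obtain ⟨hr3, hrR⟩ := Finset.mem_Icc.1 hr
      refine le_trans ?_ (hterm r (by omega) hrR)
      refine mul_le_mul_of_nonneg_right ?_ (by positivity)
      have := add_nonneg (aSum_nonneg n m r) (floor_aSum_nonneg n m 2)
      linarith [h.coeff_le r hr3]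
    · rw [Nat.card_Icc, nsmul_eq_mul, Nat.cast_sub (by omega)]
      push_cast
      exact le_of_eq (by ring)
  calc _ ≤ β * (C₀ * (1 + u)) ^ R + β * (C₀ * (1 + u)) ^ R
        + ((R : ℝ) - 2) * (β * (C₀ * (1 + u)) ^ R) := add_le_add (add_le_add h1 h2) h3
    _ = _ := by ring

/-- The bound for the exponent that the Gaussian factor absorbs. -/
lemma wnorm_hPoly_le_quarter {n m R : ℕ} {ρ : ℝ} (hρ : 0 ≤ ρ) (hρ2 : ρ ≤ 2)
    (hx : ∀ k ∈ Finset.Icc (m + 1) n, odds n k * ρ ≤ 1 / 8)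
    (hc : ⌊aSum n m 2⌋ = 0 ∨ ρ ≤ 1 / 8) (hR : 3 ≤ R) :
    wnorm ρ (hPoly n m R) + 2 * (aSum n m (R + 1) + ⌊aSum n m 2⌋) * ρ ^ (R + 1)
      ≤ 4 + varSum n m * ρ ^ 2 / 4 := by
  -- Every degree beyond the second costs a factor `1 / 8`, so the coefficients are summed as a
  -- geometric series starting from the variance term.
  have hterm : ∀ i : ℕ, (aSum n m (i + 2) + ⌊aSum n m 2⌋) * ρ ^ (i + 2)
      ≤ (2 * varSum n m * ρ ^ 2) * (1 / 8) ^ i := by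
    intro i
    have h1 : aSum n m (i + 2) * ρ ^ (i + 2) ≤ varSum n m * ρ ^ 2 * (1 / 8) ^ i := by
      calc aSum n m (i + 2) * ρ ^ (i + 2)
          = ∑ k ∈ Finset.Icc (m + 1) n, odds n k ^ 2 * ρ ^ 2 * (odds n k * ρ) ^ i := by
            rw [aSum_eq, Finset.sum_mul]
            exact Finset.sum_congr rfl fun k _ => by ring
        _ ≤ ∑ k ∈ Finset.Icc (m + 1) n, odds n k ^ 2 * ρ ^ 2 * (1 / 8) ^ i := by
            refine Finset.sum_le_sum fun k hk => ?_
            have := odds_nonneg hk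
            have := hx k hk
            gcongr
        _ = aSum n m 2 * ρ ^ 2 * (1 / 8) ^ i := by
            rw [aSum_eq, Finset.sum_mul, Finset.sum_mul]
        _ ≤ _ := by gcongr; exact aSum_two_le_varSum n m
    have h2 : (⌊aSum n m 2⌋ : ℝ) * ρ ^ (i + 2) ≤ varSum n m * ρ ^ 2 * (1 / 8) ^ i := by
      rcases hc with hc | hc
      · rw [hc, Int.cast_zero, zero_mul]
        have := varSum_nonneg n m
        positivity
      · have h3 : (⌊aSum n m 2⌋ : ℝ) ≤ varSum n m :=
          (Int.floor_le _).trans (aSum_two_le_varSum n m)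
        have := floor_aSum_nonneg n m 2
        calc (⌊aSum n m 2⌋ : ℝ) * ρ ^ (i + 2) = ⌊aSum n m 2⌋ * ρ ^ 2 * ρ ^ i := by ring
          _ ≤ _ := by
            have := varSum_nonneg n m
            gcongr
    linarith
  have hv := varSum_nonneg n m
  have h0 := fract_nonneg' n m
  have h1 := fract_le_one' n m
  set V := varSum n m * ρ ^ 2 with hV
  have hV0 : 0 ≤ V := by positivity
  have hsum : ∑ r ∈ Finset.Icc 3 R, (aSum n m r + ⌊aSum n m 2⌋) / 3 * ρ ^ r ≤ 2 / 21 * V := by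
    have e : ∑ r ∈ Finset.Icc 3 R, (aSum n m r + ⌊aSum n m 2⌋) / 3 * ρ ^ r
        = ∑ i ∈ Finset.range (R - 2), (aSum n m (i + 1 + 2) + ⌊aSum n m 2⌋) / 3 * ρ ^ (i + 1 + 2) := by
      have : Finset.Icc 3 R = Finset.Ico 3 (R + 1) := by rfl
      rw [this, Finset.sum_Ico_eq_sum_range]
      refine Finset.sum_congr rfl fun i _ => ?_
      rw [show i + 1 + 2 = 3 + i by ring]
    rw [e]
    have hg : ∑ i ∈ Finset.range (R - 2), ((1 : ℝ) / 8) ^ i ≤ 8 / 7 := by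
      have := (hasSum_geometric_of_lt_one (r := (1 : ℝ) / 8) (by norm_num) (by norm_num))
      have h8 := sum_le_hasSum (Finset.range (R - 2)) (fun i _ => by positivity) this
      norm_num at h8 ⊢
      exact h8
    calc _ ≤ ∑ i ∈ Finset.range (R - 2), V / 12 * (1 / 8) ^ i := by
          refine Finset.sum_le_sum fun i _ => ?_
          have := hterm (i + 1)
          rw [pow_succ ((1 : ℝ) / 8)] at this
          nlinarith
      _ = V / 12 * ∑ i ∈ Finset.range (R - 2), ((1 : ℝ) / 8) ^ i := by rw [Finset.mul_sum]
      _ ≤ V / 12 * (8 / 7) := by gcongr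
      _ = _ := by ring
  have hlast : 2 * (aSum n m (R + 1) + ⌊aSum n m 2⌋) * ρ ^ (R + 1) ≤ V / 16 := by
    have := hterm (R - 1)
    rw [show R - 1 + 2 = R + 1 by omega] at this
    have h8 : ((1 : ℝ) / 8) ^ (R - 1) ≤ (1 / 8) ^ 2 :=
      pow_le_pow_of_le_one (by norm_num) (by norm_num) (by omega)
    have := this.trans (mul_le_mul_of_nonneg_left h8 (by positivity))
    rw [mul_assoc 2 (varSum n m), ← hV] at this
    nlinarith
  have := CouponCollector.wnorm_hPoly_le n m R hρ
  -- These two terms give the constant `4`; the others give `2 / 21 + 1 / 16 ≤ 1 / 4` times the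
  -- variance term.
  have a1 : (aSum n m 2 - ⌊aSum n m 2⌋) * ρ ≤ 1 * 2 := by gcongr
  have a2 : (aSum n m 2 - ⌊aSum n m 2⌋) / 2 * ρ ^ 2 ≤ 1 / 2 * 2 ^ 2 := by gcongr
  linarith

lemma exists_pow_le_mul_exp_sq (j : ℕ) :
    ∃ K : ℝ, 0 < K ∧ ∀ u : ℝ, 0 ≤ u → (1 + u) ^ j ≤ K * Real.exp (u ^ 2 / 8) := by
  refine ⟨j.factorial * Real.exp 3, by positivity, fun u hu => ?_⟩
  have h := Real.pow_div_factorial_le_exp (1 + u) (by positivity) j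
  rw [div_le_iff₀ (by positivity)] at h
  calc (1 + u) ^ j ≤ Real.exp (1 + u) * j.factorial := h
    _ ≤ Real.exp (3 + u ^ 2 / 8) * j.factorial := by
        refine mul_le_mul_of_nonneg_right (Real.exp_le_exp.2 ?_) (by positivity)
        nlinarith [sq_nonneg (u - 4)]
    _ = _ := by rw [Real.exp_add]; ring

lemma exists_exp_neg_le_mul_pow {δ : ℝ} (hδ : 0 < δ) (j : ℕ) :
    ∃ K : ℝ, 0 < K ∧ ∀ β : ℝ, 0 < β → β ≤ 1 → Real.exp (-(δ / β ^ 2)) ≤ K * β ^ j := by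
  refine ⟨j.factorial / δ ^ j, by positivity, fun β hβ hβ1 => ?_⟩
  have h := Real.pow_div_factorial_le_exp (δ / β ^ 2) (by positivity) j
  rw [Real.exp_neg, inv_le_comm₀ (by positivity) (by positivity)]
  refine le_trans ?_ h
  have e1 : (j.factorial / δ ^ j * β ^ j)⁻¹ = δ ^ j / (j.factorial * β ^ j) := by
    field_simp
  have e2 : (δ / β ^ 2) ^ j / j.factorial = δ ^ j / (j.factorial * β ^ (2 * j)) := by
    rw [div_pow, ← pow_mul, div_div, mul_comm]
  rw [e1, e2]
  refine div_le_div_of_nonneg_left (by positivity) (by positivity) ?_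
  exact mul_le_mul_of_nonneg_left
    (pow_le_pow_of_le_one hβ.le hβ1 (show j ≤ 2 * j by omega)) (by positivity)

lemma norm_le_two_of_norm_one_add {w : ℂ} (hw : ‖1 + w‖ = 1) : ‖w‖ ≤ 2 := by
  calc ‖w‖ = ‖(1 + w) - 1‖ := by ring_nf
    _ ≤ ‖1 + w‖ + ‖(1 : ℂ)‖ := norm_sub_le _ _
    _ = 2 := by rw [hw, norm_one]; norm_num

/-- On the circle `|1 + w| = 1` the real part is quadratic in `|w|`; this is the source of the
Gaussian decay of `exp (σ² w)`. -/
lemma re_of_norm_one_add {w : ℂ} (hw : ‖1 + w‖ = 1) : w.re = -(‖w‖ ^ 2 / 2) := by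
  have h1 : ‖1 + w‖ ^ 2 = 1 := by rw [hw]; norm_num
  rw [Complex.sq_norm, Complex.normSq_apply] at h1 ⊢
  simp only [Complex.add_re, Complex.one_re, Complex.add_im, Complex.one_im] at h1
  nlinarith

lemma norm_exp_real_mul {w : ℂ} (hw : ‖1 + w‖ = 1) (lam : ℝ) :
    ‖Complex.exp (lam * w)‖ = Real.exp (-(lam * ‖w‖ ^ 2 / 2)) := by
  rw [Complex.norm_exp, Complex.re_ofReal_mul, re_of_norm_one_add hw]
  congr 1
  ring

/-- The coefficient `x + x ^ 2` is the variance of the geometric law with mean `x`, so the decay of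
the product is governed by `varSum`. -/
lemma sq_norm_one_sub_mul {w : ℂ} (hw : ‖1 + w‖ = 1) (x : ℝ) :
    ‖1 - x * w‖ ^ 2 = 1 + (x + x ^ 2) * ‖w‖ ^ 2 := by
  have h1 := re_of_norm_one_add hw
  have h2 : ‖w‖ ^ 2 = w.re ^ 2 + w.im ^ 2 := by
    rw [Complex.sq_norm, Complex.normSq_apply]; ring
  rw [Complex.sq_norm, Complex.normSq_apply]
  simp only [Complex.sub_re, Complex.one_re, Complex.sub_im, Complex.one_im, Complex.re_ofReal_mul,
    Complex.im_ofReal_mul]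
  rw [h2] at h1 ⊢
  linear_combination (-2 * x) * h1

lemma aeval_HPoly (n m R L : ℕ) (w : ℂ) : aeval w (HPoly n m R L) =
    ∑ l ∈ Finset.range (L + 1), aeval w (hPoly n m R) ^ l / (l.factorial : ℂ) := by
  simp only [HPoly, map_sum, map_mul, map_pow, aeval_C, Complex.coe_algebraMap]
  refine Finset.sum_congr rfl fun l _ => ?_
  push_cast
  ring

lemma norm_exp_add_sub_sum_le (h ρ : ℂ) (L : ℕ) :
    ‖Complex.exp (h + ρ) - ∑ l ∈ Finset.range (L + 1), h ^ l / (l.factorial : ℂ)‖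
      ≤ Real.exp (‖h‖ + ‖ρ‖) * (‖ρ‖ + ‖h‖ ^ (L + 1)) := by
  have h1 := Complex.norm_exp_sub_sum_le_norm_mul_exp h (L + 1)
  have h2 : ‖Complex.exp ρ - 1‖ ≤ ‖ρ‖ * Real.exp ‖ρ‖ := by
    simpa using Complex.norm_exp_sub_sum_le_norm_mul_exp ρ 1
  have h3 : ‖Complex.exp h‖ ≤ Real.exp ‖h‖ := Complex.norm_exp_le_exp_norm h
  have e : Complex.exp (h + ρ) - ∑ l ∈ Finset.range (L + 1), h ^ l / (l.factorial : ℂ)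
      = Complex.exp h * (Complex.exp ρ - 1)
        + (Complex.exp h - ∑ l ∈ Finset.range (L + 1), h ^ l / (l.factorial : ℂ)) := by
    rw [Complex.exp_add]; ring
  rw [e]
  refine (norm_add_le _ _).trans ?_
  rw [norm_mul]
  have h4 : Real.exp ‖h‖ ≤ Real.exp (‖h‖ + ‖ρ‖) := by gcongr; linarith [norm_nonneg ρ]
  calc _ ≤ Real.exp ‖h‖ * (‖ρ‖ * Real.exp ‖ρ‖) + ‖h‖ ^ (L + 1) * Real.exp ‖h‖ := by gcongr
    _ ≤ Real.exp (‖h‖ + ‖ρ‖) * ‖ρ‖ + ‖h‖ ^ (L + 1) * Real.exp (‖h‖ + ‖ρ‖) := by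
        rw [Real.exp_add]
        refine add_le_add (le_of_eq (by ring)) ?_
        rw [← Real.exp_add]
        gcongr
    _ = _ := by ring

/-- With `y = (x + x ^ 2) / (64 X ^ 2) ≤ 1`, each factor satisfies `|1 - x w| ^ 2 ≥ 1 + y ≥ exp (y /
2)`. Multiplying over `k` gives the exponent `varSum / (4 · 64 · X ^ 2)`. -/
lemma norm_geomGF_le {n m : ℕ} {w : ℂ} (hw : ‖1 + w‖ = 1) {X : ℝ} (hX : 1 ≤ X)
    (hx : ∀ k ∈ Finset.Icc (m + 1) n, odds n k ≤ X) (hwX : 1 / (8 * X) ≤ ‖w‖) :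
    ‖geomGF n m w‖ ≤ Real.exp (-(varSum n m / (256 * X ^ 2))) := by
  have hX0 : 0 < X := by linarith
  have hterm : ∀ k ∈ Finset.Icc (m + 1) n, ‖(1 - odds n k * w)⁻¹‖ ≤
      Real.exp (-((odds n k + odds n k ^ 2) / (256 * X ^ 2))) := by
    intro k hk
    have h0 := odds_nonneg hk
    have h1 := hx k hk
    set y := (odds n k + odds n k ^ 2) / (64 * X ^ 2) with hy
    have hy0 : 0 ≤ y := by positivity
    have hy1 : y ≤ 1 := by
      rw [hy, div_le_one (by positivity)]
      nlinarith
    have h2 : 1 + y ≤ ‖1 - odds n k * w‖ ^ 2 := by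
      rw [sq_norm_one_sub_mul hw]
      have : (1 / (8 * X)) ^ 2 ≤ ‖w‖ ^ 2 := by gcongr
      have h3 : (odds n k + odds n k ^ 2) * (1 / (8 * X)) ^ 2 ≤
        (odds n k + odds n k ^ 2) * ‖w‖ ^ 2 := by gcongr
      have h4 : (odds n k + odds n k ^ 2) * (1 / (8 * X)) ^ 2 = y := by
        rw [hy]; field_simp; norm_num
      linarith
    have h5 : Real.exp (y / 2) ≤ 1 + y := by
      have h6 := Real.add_one_le_exp (-(y / 2))
      have h7 : Real.exp (y / 2) * Real.exp (-(y / 2)) = 1 := by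
        rw [← Real.exp_add]; simp
      have h8 := Real.exp_pos (y / 2)
      have h9 : Real.exp (y / 2) * (1 - y / 2) ≤ 1 := by nlinarith
      by_contra hcon
      push Not at hcon
      nlinarith
    have h6 : Real.exp (y / 4) ≤ ‖1 - odds n k * w‖ := by
      refine le_of_sq_le_sq ?_ (norm_nonneg _)
      rw [← Real.exp_nat_mul]
      refine le_trans (le_of_eq ?_) (h5.trans h2)
      congr 1
      push_cast
      ring
    rw [norm_inv, Real.exp_neg]
    refine inv_anti₀ (Real.exp_pos _) (le_trans (le_of_eq ?_) h6)
    congr 1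
    rw [hy]
    field_simp
    ring
  rw [geomGF, norm_prod]
  refine (Finset.prod_le_prod (fun _ _ => norm_nonneg _) hterm).trans (le_of_eq ?_)
  rw [← Real.exp_sum]
  congr 1
  rw [Finset.sum_neg_distrib, ← Finset.sum_div, Finset.sum_add_distrib, varSum, aSum_eq, aSum_eq]
  simp only [pow_one]

/-- With `u = σ |w|`, the remainder and the omitted power of `h` are both `β ^ (R + 1)` times a
polynomial in `u`. The Gaussian `exp (-u ^ 2 / 2)` pays for `exp (4 + u ^ 2 / 4)` from the exponent
and for `exp (u ^ 2 / 8)` from the polynomial. -/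
lemma Regime.near_le {C₀ κ : ℝ} (hC : 1 ≤ C₀) {R : ℕ} (hR : 3 ≤ R) :
    ∃ K : ℝ, 0 < K ∧ ∀ (β : ℝ) (n m : ℕ), Regime C₀ κ β n m → ∀ w : ℂ, ‖1 + w‖ = 1 →
      (∀ k ∈ Finset.Icc (m + 1) n, odds n k * ‖w‖ ≤ 1 / 8) →
      (⌊aSum n m 2⌋ = 0 ∨ ‖w‖ ≤ 1 / 8) →
      ‖(1 + w) ^ ⌊aSum n m 2⌋.toNat * geomGF n m w
        - Complex.exp (varSum n m * w) * aeval w (HPoly n m R R)‖ ≤ K * β ^ (R + 1) := by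
  obtain ⟨K, hK, hKle⟩ := exists_pow_le_mul_exp_sq (R * (R + 1))
  refine ⟨Real.exp 4 * ((2 + (R : ℝ) ^ (R + 1)) * C₀ ^ (R * (R + 1)) * K), by positivity, ?_⟩
  intro β n m h w hw hx hc
  obtain ⟨ρ, hρ, hρle⟩ := gf_eq_exp n m hR hx hc
  have hb := h.beta_pos
  set u := √(varSum n m) * ‖w‖ with hu
  have hu0 : 0 ≤ u := by positivity
  have hu2 : varSum n m * ‖w‖ ^ 2 = u ^ 2 := by
    rw [hu, mul_pow, Real.sq_sqrt (varSum_nonneg n m)]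
  have hh : ‖aeval w (hPoly n m R)‖ ≤ wnorm ‖w‖ (hPoly n m R) := norm_aeval_le_wnorm _ w
  have hq := wnorm_hPoly_le_quarter (norm_nonneg w) (norm_le_two_of_norm_one_add hw) hx hc hR
  have hβ := h.wnorm_hPoly_le hC hR (norm_nonneg w)
  rw [hu2] at hq
  rw [← hu] at hβ
  have hY : 1 ≤ C₀ * (1 + u) := one_le_mul_of_one_le_of_one_le hC (by linarith)
  have hρ2 : ‖ρ‖ ≤ β ^ (R + 1) * (2 * (C₀ * (1 + u)) ^ (R * (R + 1))) := by
    refine hρle.trans ?_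
    calc 2 * (aSum n m (R + 1) + ⌊aSum n m 2⌋) * ‖w‖ ^ (R + 1)
        ≤ 2 * (C₀ * β * √(varSum n m)) ^ (R + 1) * ‖w‖ ^ (R + 1) := by
          gcongr
          exact h.coeff_le _ (by omega)
      _ = β ^ (R + 1) * (2 * (C₀ * u) ^ (R + 1)) := by
          rw [hu, mul_assoc, ← mul_pow, mul_left_comm, ← mul_pow]
          ring_nf
      _ ≤ _ := by
          gcongr
          calc (C₀ * u) ^ (R + 1) ≤ (C₀ * (1 + u)) ^ (R + 1) := by gcongr; linarith
            _ ≤ _ := pow_le_pow_right₀ hY (by nlinarith)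
  have hh2 : ‖aeval w (hPoly n m R)‖ ^ (R + 1)
      ≤ β ^ (R + 1) * ((R : ℝ) ^ (R + 1) * (C₀ * (1 + u)) ^ (R * (R + 1))) := by
    calc _ ≤ (β * (R * (C₀ * (1 + u)) ^ R)) ^ (R + 1) := by
          gcongr
          exact hh.trans hβ
      _ = _ := by rw [mul_pow, mul_pow, ← pow_mul]
  rw [hρ, add_assoc, Complex.exp_add, ← mul_sub, norm_mul, norm_exp_real_mul hw, hu2, aeval_HPoly]
  have hsum : ‖ρ‖ + ‖aeval w (hPoly n m R)‖ ^ (R + 1) ≤ β ^ (R + 1) *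
      ((2 + (R : ℝ) ^ (R + 1)) * C₀ ^ (R * (R + 1)) * (K * Real.exp (u ^ 2 / 8))) := by
    calc _ ≤ β ^ (R + 1) * ((2 + (R : ℝ) ^ (R + 1)) * (C₀ * (1 + u)) ^ (R * (R + 1))) := by
          rw [add_mul, mul_add]
          exact add_le_add hρ2 hh2
      _ ≤ _ := by
          rw [mul_pow C₀, ← mul_assoc (2 + _)]
          gcongr
          exact hKle u hu0
  have hexp : Real.exp (‖aeval w (hPoly n m R)‖ + ‖ρ‖) ≤ Real.exp (4 + u ^ 2 / 4) := by
    refine Real.exp_le_exp.2 ?_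
    linarith
  calc _ ≤ Real.exp (-(u ^ 2 / 2)) * (Real.exp (4 + u ^ 2 / 4) * (β ^ (R + 1) *
      ((2 + (R : ℝ) ^ (R + 1)) * C₀ ^ (R * (R + 1)) * (K * Real.exp (u ^ 2 / 8))))) := by
        gcongr
        exact (norm_exp_add_sub_sum_le _ _ R).trans (mul_le_mul hexp hsum (by positivity)
          (by positivity))
    _ = Real.exp 4 * ((2 + (R : ℝ) ^ (R + 1)) * C₀ ^ (R * (R + 1)) * K) * β ^ (R + 1) *
        (Real.exp (-(u ^ 2 / 2)) * Real.exp (u ^ 2 / 4) * Real.exp (u ^ 2 / 8)) := by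
        rw [Real.exp_add]; ring
    _ ≤ Real.exp 4 * ((2 + (R : ℝ) ^ (R + 1)) * C₀ ^ (R * (R + 1)) * K) * β ^ (R + 1) * 1 := by
        gcongr
        rw [← Real.exp_add, ← Real.exp_add, Real.exp_le_one_iff]
        nlinarith [sq_nonneg u]
    _ = _ := mul_one _

/-- No cancellation is used here: both transforms are at most a constant times `exp (-σ² / (256 X ^
2))`, and `κ X ^ 2 ≤ β ^ 2 σ²` makes this smaller than any power of `β`. -/
lemma Regime.far_le {C₀ κ : ℝ} (hC : 1 ≤ C₀) (hκ : 0 < κ) {R : ℕ} (hR : 3 ≤ R) :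
    ∃ K : ℝ, 0 < K ∧ ∀ (β : ℝ) (n m : ℕ), Regime C₀ κ β n m → ∀ w : ℂ, ‖1 + w‖ = 1 →
      ∀ X : ℝ, 1 ≤ X → (∀ k ∈ Finset.Icc (m + 1) n, odds n k ≤ X) →
      κ * X ^ 2 ≤ β ^ 2 * varSum n m → 1 / (8 * X) ≤ ‖w‖ →
      ‖(1 + w) ^ ⌊aSum n m 2⌋.toNat * geomGF n m w
        - Complex.exp (varSum n m * w) * aeval w (HPoly n m R R)‖ ≤ K * β ^ (R + 1) := by
  obtain ⟨K, hK, hKle⟩ := exists_pow_le_mul_exp_sq (R * R)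
  obtain ⟨K', hK', hKle'⟩ := exists_exp_neg_le_mul_pow (δ := κ / 256) (by positivity) (R + 1)
  refine ⟨(1 + (R + 1) * (R ^ R * C₀ ^ (R * R) * K)) * K', by positivity, ?_⟩
  intro β n m h w hw X hX hx hκX hwX
  have hX0 : 0 < X := by linarith
  have hb := h.beta_pos
  have hv := h.var_pos
  set u := √(varSum n m) * ‖w‖ with hu
  have hu0 : 0 ≤ u := by positivity
  have hu2 : varSum n m * ‖w‖ ^ 2 = u ^ 2 := by
    rw [hu, mul_pow, Real.sq_sqrt (varSum_nonneg n m)]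
  have hβ := h.wnorm_hPoly_le hC hR (norm_nonneg w)
  rw [← hu] at hβ
  have hY : 1 ≤ C₀ * (1 + u) := one_le_mul_of_one_le_of_one_le hC (by linarith)
  have hR1 : (1 : ℝ) ≤ R := by exact_mod_cast (by omega : 1 ≤ R)
  have hdec : Real.exp (-(varSum n m / (256 * X ^ 2))) ≤ K' * β ^ (R + 1) := by
    refine le_trans ?_ (hKle' β hb h.beta_le_one)
    refine Real.exp_le_exp.2 (neg_le_neg ?_)
    rw [div_div, div_le_div_iff₀ (by positivity) (by positivity)]
    nlinarith
  have hH : ‖aeval w (HPoly n m R R)‖ ≤ (R + 1) * (R ^ R * C₀ ^ (R * R) * K) *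
      Real.exp (u ^ 2 / 8) := by
    have h1 : ∀ l ∈ Finset.range (R + 1), wnorm ‖w‖ (hPoly n m R) ^ l
        ≤ R ^ R * C₀ ^ (R * R) * K * Real.exp (u ^ 2 / 8) := by
      intro l hl
      have hl' : l ≤ R := Nat.lt_succ_iff.1 (Finset.mem_range.1 hl)
      have hQ : 1 ≤ (R : ℝ) * (C₀ * (1 + u)) ^ R :=
        one_le_mul_of_one_le_of_one_le hR1 (one_le_pow₀ hY)
      have h2 : wnorm ‖w‖ (hPoly n m R) ≤ R * (C₀ * (1 + u)) ^ R :=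
        hβ.trans (mul_le_of_le_one_left (by positivity) h.beta_le_one)
      calc _ ≤ ((R : ℝ) * (C₀ * (1 + u)) ^ R) ^ l := by
            gcongr
            exact wnorm_nonneg (norm_nonneg w) _
        _ ≤ ((R : ℝ) * (C₀ * (1 + u)) ^ R) ^ R := pow_le_pow_right₀ hQ hl'
        _ = R ^ R * C₀ ^ (R * R) * (1 + u) ^ (R * R) := by
            rw [mul_pow, ← pow_mul, mul_pow, mul_assoc]
        _ ≤ R ^ R * C₀ ^ (R * R) * (K * Real.exp (u ^ 2 / 8)) := by
            gcongr
            exact hKle u hu0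
        _ = _ := by ring
    refine (norm_aeval_le_wnorm _ w).trans ((wnorm_HPoly_le n m R R (norm_nonneg w)).trans ?_)
    refine (Finset.sum_le_card_nsmul _ _ _ h1).trans (le_of_eq ?_)
    rw [Finset.card_range, nsmul_eq_mul]
    push_cast
    ring
  have h2 : ‖Complex.exp (varSum n m * w) * aeval w (HPoly n m R R)‖
      ≤ (R + 1) * (R ^ R * C₀ ^ (R * R) * K) * (K' * β ^ (R + 1)) := by
    rw [norm_mul, norm_exp_real_mul hw, hu2]
    calc _ ≤ Real.exp (-(u ^ 2 / 2)) * ((R + 1) * (R ^ R * C₀ ^ (R * R) * K) *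
      Real.exp (u ^ 2 / 8)) := by gcongr
      _ = (R + 1) * (R ^ R * C₀ ^ (R * R) * K) *
        (Real.exp (-(u ^ 2 / 2)) * Real.exp (u ^ 2 / 8)) := by ring
      _ ≤ _ := by
        refine mul_le_mul_of_nonneg_left (le_trans ?_ hdec) (by positivity)
        rw [← Real.exp_add]
        refine Real.exp_le_exp.2 ?_
        have h3 : (1 / (8 * X)) ^ 2 ≤ ‖w‖ ^ 2 := by gcongr
        have h4 : varSum n m * (1 / (8 * X)) ^ 2 ≤ u ^ 2 := by
          rw [← hu2]; gcongr
        have h5 : varSum n m / (256 * X ^ 2) = varSum n m * (1 / (8 * X)) ^ 2 / 4 := by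
          field_simp; norm_num
        rw [h5]
        nlinarith [sq_nonneg u]
  have h1 : ‖(1 + w) ^ ⌊aSum n m 2⌋.toNat * geomGF n m w‖ ≤ K' * β ^ (R + 1) := by
    rw [norm_mul, norm_pow, hw, one_pow, one_mul]
    exact (norm_geomGF_le hw hX hx hwX).trans hdec
  refine (norm_sub_le _ _).trans ((add_le_add h1 h2).trans (le_of_eq (by ring)))

/-- The uniform estimate for the difference of the two transforms. -/
theorem Regime.norm_transform_sub_le {C₀ κ : ℝ} (hC : 1 ≤ C₀) (hκ : 0 < κ) {R : ℕ} (hR : 3 ≤ R) :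
    ∃ K : ℝ, 0 < K ∧ ∀ (β : ℝ) (n m : ℕ), Regime C₀ κ β n m → ∀ w : ℂ, ‖1 + w‖ = 1 →
      ‖(1 + w) ^ ⌊aSum n m 2⌋.toNat * geomGF n m w
        - Complex.exp (varSum n m * w) * aeval w (HPoly n m R R)‖ ≤ K * β ^ (R + 1) := by
  obtain ⟨K, hK, hn⟩ := Regime.near_le (κ := κ) hC hR
  obtain ⟨K', hK', hf⟩ := Regime.far_le hC hκ hR
  refine ⟨K + K', by positivity, fun β n m h w hw => ?_⟩
  have hb := h.beta_pos
  have hKK : K * β ^ (R + 1) ≤ (K + K') * β ^ (R + 1) := by gcongr; linarith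
  have hKK' : K' * β ^ (R + 1) ≤ (K + K') * β ^ (R + 1) := by gcongr; linarith
  have hw2 := norm_le_two_of_norm_one_add hw
  rcases h.spread with ⟨hc, hx⟩ | ⟨X, hX, hx, hκX⟩
  · refine (hn β n m h w hw (fun k hk => ?_) (Or.inl hc)).trans hKK
    have := hx k hk
    have := odds_nonneg hk
    calc odds n k * ‖w‖ ≤ 1 / 16 * 2 := by gcongr
      _ = _ := by norm_num
  · have hX0 : 0 < X := by linarith
    rcases le_total (1 / (8 * X)) ‖w‖ with hwX | hwX
    · exact (hf β n m h w hw X hX hx hκX hwX).trans hKK'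
    · refine (hn β n m h w hw (fun k hk => ?_) (Or.inr ?_)).trans hKK
      · have := hx k hk
        calc odds n k * ‖w‖ ≤ X * (1 / (8 * X)) := by gcongr
          _ = _ := by field_simp
      · refine hwX.trans ?_
        rw [div_le_div_iff₀ (by positivity) (by norm_num)]
        linarith

/-! ### Fourier inversion and the `ℓ¹` distance -/

lemma integral_exp_int_mul (a : ℤ) : ∫ t in (0 : ℝ)..(2 * Real.pi),
    Complex.exp (a * t * Complex.I) = if a = 0 then (2 * Real.pi : ℂ) else 0 := by
  split_ifs with h
  · simp [h]
  · have hc : (a : ℂ) * Complex.I ≠ 0 := by simp [h, Complex.I_ne_zero]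
    have e : ∀ t : ℝ, Complex.exp (a * t * Complex.I) = Complex.exp ((a * Complex.I) * t) :=
      fun t => by congr 1; ring
    simp_rw [e]
    rw [integral_exp_mul_complex hc]
    have : (a : ℂ) * Complex.I * ((2 * Real.pi : ℝ) : ℂ) = a * (2 * Real.pi * Complex.I) := by
      push_cast; ring
    rw [this, Complex.exp_int_mul_two_pi_mul_I]
    simp

/-- A coefficient of an absolutely convergent Fourier series is bounded by the supremum of the
series. -/
lemma abs_coeff_le_of_norm_transform_le {f : ℕ → ℝ} (hf : Summable fun j => |f j|) {S : ℝ}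
    (hS : ∀ t : ℝ, ‖∑' j, (f j : ℂ) * Complex.exp (t * Complex.I) ^ j‖ ≤ S) (j : ℕ) :
    |f j| ≤ S := by
  have hnorm : ∀ (i : ℕ) (t : ℝ),
      ‖(f i : ℂ) * Complex.exp (t * Complex.I) ^ i * Complex.exp (-(j * t * Complex.I))‖ = |f i| := by
    intro i t
    rw [norm_mul, norm_mul, norm_pow, Complex.norm_exp_ofReal_mul_I, one_pow, mul_one,
      Complex.norm_real, Real.norm_eq_abs]
    have : -((j : ℂ) * t * Complex.I) = ((-(j * t) : ℝ) : ℂ) * Complex.I := by push_cast; ring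
    rw [this, Complex.norm_exp_ofReal_mul_I, mul_one]
  have hnorm' : ∀ (i : ℕ) (t : ℝ), ‖(f i : ℂ) * Complex.exp (t * Complex.I) ^ i‖ = |f i| := by
    intro i t
    rw [norm_mul, norm_pow, Complex.norm_exp_ofReal_mul_I, one_pow, mul_one,
      Complex.norm_real, Real.norm_eq_abs]
  have hsum : ∀ t : ℝ, Summable fun i => (f i : ℂ) * Complex.exp (t * Complex.I) ^ i := by
    intro t
    refine Summable.of_norm ?_
    simpa only [hnorm'] using hf
  have key := intervalIntegral.hasSum_integral_of_dominated_convergence (μ := volume)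
    (a := 0) (b := 2 * Real.pi)
    (F := fun (i : ℕ) (t : ℝ) =>
      (f i : ℂ) * Complex.exp (t * Complex.I) ^ i * Complex.exp (-(j * t * Complex.I)))
    (f := fun t => (∑' i, (f i : ℂ) * Complex.exp (t * Complex.I) ^ i)
      * Complex.exp (-(j * t * Complex.I)))
    (fun i _ => |f i|)
    (fun i => (by fun_prop : Continuous _).aestronglyMeasurable)
    (fun i => Filter.Eventually.of_forall fun t _ => (hnorm i t).le)
    (Filter.Eventually.of_forall fun t _ => hf)
    intervalIntegrable_const
    (Filter.Eventually.of_forall fun t _ => (hsum t).hasSum.mul_right _)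
  have e : ∀ i : ℕ, ∫ t in (0 : ℝ)..(2 * Real.pi),
      (f i : ℂ) * Complex.exp (t * Complex.I) ^ i * Complex.exp (-(j * t * Complex.I))
      = if i = j then (f j : ℂ) * (2 * Real.pi) else 0 := by
    intro i
    have e1 : ∀ t : ℝ, (f i : ℂ) * Complex.exp (t * Complex.I) ^ i *
        Complex.exp (-(j * t * Complex.I))
        = (f i : ℂ) * Complex.exp (((i - j : ℤ) : ℂ) * t * Complex.I) := by
      intro t
      rw [mul_assoc, ← Complex.exp_nat_mul, ← Complex.exp_add]
      congr 2
      push_cast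
      ring
    simp_rw [e1]
    rw [intervalIntegral.integral_const_mul, integral_exp_int_mul]
    by_cases hij : i = j
    · simp [hij]
    · have : (i - j : ℤ) ≠ 0 := by omega
      simp [hij, this]
  simp_rw [e] at key
  have h1 := key.unique (hasSum_ite_eq j _)
  have h2 : ‖∫ t in (0 : ℝ)..(2 * Real.pi), (∑' i, (f i : ℂ) * Complex.exp (t * Complex.I) ^ i)
      * Complex.exp (-(j * t * Complex.I))‖ ≤ S * |2 * Real.pi - 0| := by
    refine intervalIntegral.norm_integral_le_of_norm_le_const fun t _ => ?_
    rw [norm_mul]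
    have : -((j : ℂ) * t * Complex.I) = ((-(j * t) : ℝ) : ℂ) * Complex.I := by push_cast; ring
    rw [this, Complex.norm_exp_ofReal_mul_I, mul_one]
    exact hS t
  rw [h1, norm_mul, Complex.norm_real, Real.norm_eq_abs, sub_zero,
    abs_of_pos Real.two_pi_pos] at h2
  have h3 : ‖(2 * Real.pi : ℂ)‖ = 2 * Real.pi := by
    rw [← Complex.ofReal_ofNat, ← Complex.ofReal_mul, Complex.norm_real, Real.norm_eq_abs,
      abs_of_pos Real.two_pi_pos]
  rw [h3] at h2
  exact le_of_mul_le_mul_right h2 Real.two_pi_pos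

/-- A sequence that has the properties of the law of the shifted waiting time plus its integer
shift. -/
structure IsCollectorLaw (n m : ℕ) (q : ℕ → ℝ) : Prop where
  nonneg : ∀ j, 0 ≤ q j
  hasSum_one : HasSum q 1
  hasSum_mean : HasSum (fun j : ℕ => (j : ℝ) * q j) (aSum n m 1 + ⌊aSum n m 2⌋)
  hasSum_transform : ∀ t : ℝ, HasSum (fun j : ℕ => (q j : ℂ) * Complex.exp (t * Complex.I) ^ j)
    (Complex.exp (t * Complex.I) ^ ⌊aSum n m 2⌋.toNat
      * geomGF n m (Complex.exp (t * Complex.I) - 1))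

/-- Below `N` the pointwise Fourier bound is summed `N` times; from `N` on, Markov's inequality is
applied to both sequences. The cutoff `N` is left free. -/
lemma Regime.sum_sub_le {C₀ κ : ℝ} (hC : 1 ≤ C₀) (hκ : 0 < κ) {R : ℕ} (hR : 3 ≤ R) :
    ∃ K : ℝ, 0 < K ∧ ∀ (β : ℝ) (n m : ℕ), Regime C₀ κ β n m → ∀ q : ℕ → ℝ, IsCollectorLaw n m q →
      ∀ N : ℕ, 0 < N → ∑' j, |q j - pcMass (varSum n m) (HPoly n m R R) j|
        ≤ K * (N * β ^ (R + 1) + (1 + varSum n m) ^ 2 / N) := by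
  obtain ⟨K, hK, hle⟩ := Regime.norm_transform_sub_le hC hκ hR
  set B : ℝ := R * (C₀ * 2) ^ R with hB
  have hR1 : (1 : ℝ) ≤ R := by exact_mod_cast (by omega : 1 ≤ R)
  have hB1 : 1 ≤ B := one_le_mul_of_one_le_of_one_le hR1 (one_le_pow₀ (by linarith))
  set A : ℝ := √((R * R).factorial : ℝ) * ((R + 1) * B ^ R) with hA
  have hA0 : 0 ≤ A := by positivity
  refine ⟨K + 1 + A, by positivity, fun β n m h q hq N hN => ?_⟩
  have hv := h.var_pos
  have hb := h.beta_pos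
  set lam := varSum n m with hlam
  set H := HPoly n m R R with hH
  have hdeg : H.natDegree ≤ R * R := natDegree_HPoly_le n m hR R
  obtain ⟨hs1, -⟩ := tsum_abs_pcMass_le hv hdeg
  obtain ⟨hs2, hm2⟩ := tsum_mul_abs_pcMass_le hv hdeg
  have hq1 : Summable fun j => |q j| := by
    simpa only [abs_of_nonneg (hq.nonneg _)] using hq.hasSum_one.summable
  have hd : Summable fun j => |q j - pcMass lam H j| :=
    Summable.of_nonneg_of_le (fun _ => abs_nonneg _) (fun _ => abs_sub _ _) (hq1.add hs1)
  have hcoef : ∀ j, |q j - pcMass lam H j| ≤ K * β ^ (R + 1) := by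
    refine abs_coeff_le_of_norm_transform_le hd fun t => ?_
    have h1 := (hq.hasSum_transform t).sub (hasSum_pcMass hv H t)
    have h2 := hle β n m h (Complex.exp (t * Complex.I) - 1) (by
      rw [add_sub_cancel, Complex.norm_exp_ofReal_mul_I])
    rw [add_sub_cancel] at h2
    rw [← h1.tsum_eq] at h2
    refine le_trans (le_of_eq ?_) h2
    congr 1
    refine tsum_congr fun j => ?_
    push_cast
    ring
  have hN0 : (0 : ℝ) < N := by exact_mod_cast hN
  have hind : HasSum (fun j : ℕ => if j < N then K * β ^ (R + 1) else 0) (N * (K * β ^ (R + 1))) := by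
    have h1 := hasSum_sum_of_ne_finset_zero (L := SummationFilter.unconditional ℕ) (s := Finset.range N)
      (f := fun j : ℕ => if j < N then K * β ^ (R + 1) else 0) (by
        intro j hj
        simp only [Finset.mem_range] at hj
        simp [hj])
    have h2 : ∑ j ∈ Finset.range N, (if j < N then K * β ^ (R + 1) else 0)
        = N * (K * β ^ (R + 1)) := by
      rw [Finset.sum_congr rfl fun j hj => if_pos (Finset.mem_range.1 hj)]
      simp
    rwa [h2] at h1
  have htot := (hind.add (hq.hasSum_mean.mul_left (1 / (N : ℝ)))).add
    (hs2.hasSum.mul_left (1 / (N : ℝ)))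
  have hpt : ∀ j : ℕ, |q j - pcMass lam H j| ≤ (if j < N then K * β ^ (R + 1) else 0)
      + 1 / (N : ℝ) * ((j : ℝ) * q j) + 1 / (N : ℝ) * ((j : ℝ) * |pcMass lam H j|) := by
    intro j
    have hqj := hq.nonneg j
    split_ifs with hj
    · have h1 := hcoef j
      have h2 : 0 ≤ 1 / (N : ℝ) * ((j : ℝ) * q j) := by positivity
      have h3 : 0 ≤ 1 / (N : ℝ) * ((j : ℝ) * |pcMass lam H j|) := by positivity
      linarith
    · have h1 : 1 ≤ 1 / (N : ℝ) * j := by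
        rw [div_mul_eq_mul_div, one_mul, le_div_iff₀ hN0, one_mul]
        exact_mod_cast not_lt.1 hj
      have h2 := abs_sub (q j) (pcMass lam H j)
      rw [abs_of_nonneg hqj] at h2
      have h3 := mul_le_mul_of_nonneg_right h1 (add_nonneg hqj (abs_nonneg (pcMass lam H j)))
      linarith
  refine (hd.tsum_le_tsum hpt htot.summable).trans ?_
  rw [htot.tsum_eq]
  have hwn : wnorm (1 / √lam) H ≤ (R + 1) * B ^ R := by
    have hρ : 0 ≤ 1 / √lam := by positivity
    have h1 : wnorm (1 / √lam) (hPoly n m R) ≤ B := by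
      refine (h.wnorm_hPoly_le hC hR hρ).trans ?_
      have : √lam * (1 / √lam) = 1 := by
        have : 0 < √lam := Real.sqrt_pos.2 hv
        field_simp
      rw [← hlam, this, show (1 : ℝ) + 1 = 2 by norm_num, ← hB]
      exact mul_le_of_le_one_left (by positivity) h.beta_le_one
    refine (wnorm_HPoly_le n m R R hρ).trans ?_
    refine (Finset.sum_le_card_nsmul _ _ (B ^ R) fun l hl => ?_).trans (le_of_eq ?_)
    · exact (pow_le_pow_left₀ (wnorm_nonneg hρ _) h1 _).trans
        (pow_le_pow_right₀ hB1 (Nat.lt_succ_iff.1 (Finset.mem_range.1 hl)))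
    · rw [Finset.card_range, nsmul_eq_mul]
      push_cast
      ring
  have hM2 : ∑' j : ℕ, (j : ℝ) * |pcMass lam H j| ≤ A * (1 + lam) ^ 2 := by
    refine hm2.trans ?_
    rw [hA]
    gcongr
  have hM1 : aSum n m 1 + ⌊aSum n m 2⌋ ≤ (1 + lam) ^ 2 := by
    have := Int.floor_le (aSum n m 2)
    have h2 : aSum n m 1 + aSum n m 2 = lam := rfl
    nlinarith
  have hNb : 0 ≤ N * β ^ (R + 1) := by positivity
  have hNl : 0 ≤ (1 + lam) ^ 2 / N := by positivity
  calc _ ≤ N * (K * β ^ (R + 1)) + 1 / (N : ℝ) * (1 + lam) ^ 2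
        + 1 / (N : ℝ) * (A * (1 + lam) ^ 2) := by gcongr
    _ = K * (N * β ^ (R + 1)) + (1 + A) * ((1 + lam) ^ 2 / N) := by ring
    _ ≤ (K + 1 + A) * (N * β ^ (R + 1)) + (K + 1 + A) * ((1 + lam) ^ 2 / N) := by
        gcongr <;> linarith
    _ = _ := by ring

/-- The expansion of the law of the waiting time: the distance to a Poisson-Charlier measure is
bounded by the omitted terms, up to an arbitrary power of `β`. -/
theorem Regime.tsum_abs_sub_pcMass_le {C₀ κ : ℝ} (hC : 1 ≤ C₀) (hκ : 0 < κ) {R : ℕ} (hR : 3 ≤ R)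
    (L T S : ℕ) :
    ∃ (R' : ℕ) (K : ℝ), 0 < K ∧ ∀ (β : ℝ) (n m : ℕ), Regime C₀ κ β n m →
      (1 + varSum n m) ^ 2 * β ^ T ≤ 1 → ∀ q : ℕ → ℝ, IsCollectorLaw n m q →
      (Summable fun j => |q j - pcMass (varSum n m) (HPoly n m R L) j|) ∧
      ∑' j, |q j - pcMass (varSum n m) (HPoly n m R L) j|
        ≤ K * (β ^ S + wnorm (1 / √(varSum n m)) (hPoly n m R) ^ (L + 1)
          + ∑ r ∈ Finset.Icc (R + 1) R', (aSum n m r + ⌊aSum n m 2⌋)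
            * (1 / √(varSum n m)) ^ r) := by
  -- The auxiliary order dominates `R` and `L`, so that the truncations can be compared, and leaves
  -- `β ^ S` after the loss of the factor `N`, of size `β ^ (-(T + S))`.
  set R' := R + L + T + 2 * S with hR'
  have hR'3 : 3 ≤ R' := by omega
  obtain ⟨K, hK, hle⟩ := Regime.sum_sub_le hC hκ hR'3
  set B : ℝ := R' * (C₀ * 2) ^ R' with hB
  have hR1 : (1 : ℝ) ≤ R' := by exact_mod_cast (by omega : 1 ≤ R')
  have hB1 : 1 ≤ B := one_le_mul_of_one_le_of_one_le hR1 (one_le_pow₀ (by linarith))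
  set D := max (R' * R') (L * R) with hD
  set A : ℝ := √(D.factorial : ℝ) * ((R' + 1) ^ 2 * B ^ R') with hA
  refine ⟨R', K * 3 + A, by positivity, fun β n m h hT q hq => ?_⟩
  have hv := h.var_pos
  have hb := h.beta_pos
  set lam := varSum n m with hlam
  have hρ : 0 ≤ 1 / √lam := by positivity
  have hwn : ∀ r, 3 ≤ r → r ≤ R' → wnorm (1 / √lam) (hPoly n m r) ≤ B := by
    intro r hr hrR
    refine (h.wnorm_hPoly_le hC hr hρ).trans ?_
    have : √lam * (1 / √lam) = 1 := by
      have : 0 < √lam := Real.sqrt_pos.2 hv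
      field_simp
    rw [← hlam, this, show (1 : ℝ) + 1 = 2 by norm_num]
    refine (mul_le_of_le_one_left (by positivity) h.beta_le_one).trans ?_
    have hrR' : (r : ℝ) ≤ R' := by exact_mod_cast hrR
    rw [hB]
    exact mul_le_mul hrR' (pow_le_pow_right₀ (by linarith) hrR) (by positivity) (by positivity)
  have hdeg' : (HPoly n m R' R').natDegree ≤ D :=
    (natDegree_HPoly_le n m hR'3 R').trans (le_max_left _ _)
  have hdeg : (HPoly n m R L).natDegree ≤ D :=
    (natDegree_HPoly_le n m hR L).trans (le_max_right _ _)
  have hdegs : (HPoly n m R' R' - HPoly n m R L).natDegree ≤ D :=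
    natDegree_sub_le_of_le hdeg' hdeg |>.trans (by simp)
  obtain ⟨hs, hdist⟩ := tsum_abs_pcMass_le hv hdegs
  have hq1 : Summable fun j => |q j| := by
    simpa only [abs_of_nonneg (hq.nonneg _)] using hq.hasSum_one.summable
  have hsd : ∀ H : ℝ[X], Summable fun j => |q j - pcMass lam H j| := fun H =>
    Summable.of_nonneg_of_le (fun _ => abs_nonneg _) (fun _ => abs_sub _ _)
      (hq1.add (tsum_abs_pcMass_le hv le_rfl).1)
  refine ⟨hsd _, ?_⟩
  -- Since `(1 + σ²) ^ 2 ≤ β ^ (-T)`, this cutoff makes the Markov tail at most `β ^ S`.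
  set N := ⌈(β ^ (T + S))⁻¹⌉₊ with hN
  have hinv : 1 ≤ (β ^ (T + S))⁻¹ :=
    (one_le_inv₀ (by positivity)).2 (pow_le_one₀ hb.le h.beta_le_one)
  have hN1 : (β ^ (T + S))⁻¹ ≤ N := Nat.le_ceil _
  have hN2 : (N : ℝ) ≤ 2 * (β ^ (T + S))⁻¹ := by
    have := Nat.ceil_lt_add_one (a := (β ^ (T + S))⁻¹) (by positivity)
    linarith
  have hNpos : 0 < N := by
    have : (0 : ℝ) < N := by linarith
    exact_mod_cast this
  have h1 := hle β n m h q hq N hNpos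
  have h2 : (N : ℝ) * β ^ (R' + 1) ≤ 2 * β ^ S := by
    calc (N : ℝ) * β ^ (R' + 1) ≤ 2 * (β ^ (T + S))⁻¹ * β ^ (R' + 1) := by gcongr
      _ = 2 * ((β ^ (T + S))⁻¹ * β ^ (T + S)) * β ^ (R' + 1 - (T + S)) := by
          rw [show β ^ (R' + 1) = β ^ (T + S) * β ^ (R' + 1 - (T + S)) by
            rw [← pow_add]; congr 1; omega]
          ring
      _ = 2 * β ^ (R' + 1 - (T + S)) := by
          rw [inv_mul_cancel₀ (by positivity), mul_one]
      _ ≤ 2 * β ^ S := by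
          refine mul_le_mul_of_nonneg_left ?_ (by norm_num)
          exact pow_le_pow_of_le_one hb.le h.beta_le_one (by omega)
  have h3 : (1 + lam) ^ 2 / N ≤ β ^ S := by
    have hN0 : (0 : ℝ) < N := by exact_mod_cast hNpos
    rw [div_le_iff₀ hN0]
    have h4 : (1 + lam) ^ 2 ≤ (β ^ T)⁻¹ := by
      rw [← one_div, le_div_iff₀ (by positivity)]; exact hT
    refine h4.trans ?_
    calc (β ^ T)⁻¹ = β ^ S * (β ^ (T + S))⁻¹ := by
          rw [pow_add]; field_simp
      _ ≤ β ^ S * N := by gcongr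
  have h4 : ∑' j, |q j - pcMass lam (HPoly n m R' R') j| ≤ K * 3 * β ^ S := by
    refine h1.trans ?_
    calc _ ≤ K * (2 * β ^ S + β ^ S) := by gcongr
      _ = _ := by ring
  set E := wnorm (1 / √lam) (hPoly n m R) ^ (L + 1)
    + ∑ r ∈ Finset.Icc (R + 1) R', (aSum n m r + ⌊aSum n m 2⌋) * (1 / √lam) ^ r with hE
  have h5 : ∑' j, |pcMass lam (HPoly n m R' R' - HPoly n m R L) j| ≤ A * E := by
    refine hdist.trans ?_
    rw [hA, mul_assoc]
    refine mul_le_mul_of_nonneg_left ?_ (by positivity)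
    refine (wnorm_HPoly_sub_le n m (by omega : L ≤ R') hρ hB1 (hwn R hR (by omega))
      (hwn R' hR'3 le_rfl)).trans ?_
    rw [hE, add_comm (wnorm _ _ ^ _)]
    gcongr
    exact wnorm_hPoly_sub_le n m (by omega) hR hρ
  have hE0 : 0 ≤ E := by
    refine add_nonneg (pow_nonneg (wnorm_nonneg hρ _) _) (Finset.sum_nonneg fun r _ => ?_)
    have := add_nonneg (aSum_nonneg n m r) (floor_aSum_nonneg n m 2)
    positivity
  have hpt : ∀ j, |q j - pcMass lam (HPoly n m R L) j| ≤ |q j - pcMass lam (HPoly n m R' R') j|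
      + |pcMass lam (HPoly n m R' R' - HPoly n m R L) j| := by
    intro j
    rw [pcMass_sub]
    refine le_trans (le_of_eq ?_) (abs_add_le _ _)
    congr 1
    ring
  refine ((hsd _).tsum_le_tsum hpt ((hsd _).add hs)).trans ?_
  rw [(hsd _).tsum_add hs, add_assoc]
  have hβS : 0 ≤ β ^ S := by positivity
  have hA0 : 0 ≤ A := by positivity
  calc _ ≤ K * 3 * β ^ S + A * E := add_le_add h4 h5
    _ ≤ (K * 3 + A) * β ^ S + (K * 3 + A) * E := by
        gcongr <;> linarith
    _ = _ := by ring

/-! ### Convolution with geometric laws -/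

/-- One step of convolution with a geometric law of failure probability `r`. -/
structure GeomStep (r : ℝ) (f g : ℕ → ℝ) : Prop where
  zero : g 0 = (1 - r) * f 0
  succ : ∀ j, g (j + 1) = r * g j + (1 - r) * f (j + 1)

lemma GeomStep.nonneg {r : ℝ} {f g : ℕ → ℝ} (h : GeomStep r f g) (hr : 0 ≤ r) (hr1 : r ≤ 1)
    (hf : ∀ j, 0 ≤ f j) (j : ℕ) : 0 ≤ g j := by
  have h1 : 0 ≤ 1 - r := by linarith
  induction j with
  | zero => rw [h.zero]; exact mul_nonneg h1 (hf 0)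
  | succ j ih => rw [h.succ]; exact add_nonneg (mul_nonneg hr ih) (mul_nonneg h1 (hf _))

/-- By the recursion, the partial sums `S` of `g` satisfy `S ≤ r z S + (1 - r) F` with `F` the full
sum for `f`, and `r z < 1` bounds them. -/
lemma GeomStep.summable {r z : ℝ} {f g : ℕ → ℝ} (h : GeomStep r f g) (hr : 0 ≤ r) (hr1 : r ≤ 1)
    (hf : ∀ j, 0 ≤ f j) (hz : 0 ≤ z) (hrz : r * z < 1) (hs : Summable fun j => f j * z ^ j) :
    Summable fun j => g j * z ^ j := by
  have hg := h.nonneg hr hr1 hf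
  have h1 : 0 ≤ 1 - r := by linarith
  have hle : ∀ N, ∑ j ∈ Finset.range N, g j * z ^ j
      ≤ ((1 - r) * ∑' j, f j * z ^ j) / (1 - r * z) := by
    intro N
    have hstep : ∑ j ∈ Finset.range N, g j * z ^ j ≤ r * z * ∑ j ∈ Finset.range N, g j * z ^ j
        + (1 - r) * ∑ j ∈ Finset.range N, f j * z ^ j := by
      cases N with
      | zero => simp
      | succ N =>
        have e : ∑ j ∈ Finset.range (N + 1), g j * z ^ j
            = r * z * ∑ j ∈ Finset.range N, g j * z ^ j
              + (1 - r) * ∑ j ∈ Finset.range (N + 1), f j * z ^ j := by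
          rw [Finset.sum_range_succ', Finset.sum_range_succ' (fun j => f j * z ^ j), mul_add,
            Finset.mul_sum, Finset.mul_sum, ← add_assoc, ← Finset.sum_add_distrib, h.zero]
          congr 1
          · refine Finset.sum_congr rfl fun j _ => ?_
            rw [h.succ]; ring
          · ring
        have h2 : ∑ j ∈ Finset.range N, g j * z ^ j ≤ ∑ j ∈ Finset.range (N + 1), g j * z ^ j := by
          rw [Finset.sum_range_succ]
          have := mul_nonneg (hg N) (pow_nonneg hz N)
          linarith
        rw [e]
        have h3 := mul_le_mul_of_nonneg_left h2 (mul_nonneg hr hz)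
        rw [← e]
        linarith
    have h4 : ∑ j ∈ Finset.range N, f j * z ^ j ≤ ∑' j, f j * z ^ j :=
      hs.sum_le_tsum _ fun j _ => mul_nonneg (hf j) (pow_nonneg hz j)
    rw [le_div_iff₀ (by linarith)]
    have h5 := mul_le_mul_of_nonneg_left h4 h1
    linarith
  exact summable_of_sum_range_le (fun j => mul_nonneg (hg j) (pow_nonneg hz j)) hle

/-- The data of a probability law on the nonnegative integers with exponential tails, mean `M`,
variance `V` and generating function `G` on the unit circle. -/
structure LawData (z₀ M V : ℝ) (G : ℂ → ℂ) (f : ℕ → ℝ) : Prop where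
  nonneg : ∀ j, 0 ≤ f j
  summable : Summable fun j => f j * z₀ ^ j
  hasSum_one : HasSum f 1
  hasSum_mean : HasSum (fun j : ℕ => (j : ℝ) * f j) M
  hasSum_sq : HasSum (fun j : ℕ => (j : ℝ) ^ 2 * f j) (V + M ^ 2)
  hasSum_gf : ∀ z : ℂ, ‖z‖ = 1 → HasSum (fun j : ℕ => (f j : ℂ) * z ^ j) (G z)

lemma summable_pow_mul_of_summable {f : ℕ → ℝ} (hf : ∀ j, 0 ≤ f j) {z : ℝ} (hz : 1 < z)
    (hs : Summable fun j => f j * z ^ j) (e : ℕ) : Summable fun j : ℕ => (j : ℝ) ^ e * f j := by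
  have h := (isLittleO_pow_const_const_pow_of_one_lt (R := ℝ) e hz).bound one_pos
  refine Summable.of_norm_bounded_eventually_nat hs ?_
  filter_upwards [h] with j hj
  rw [norm_mul, Real.norm_of_nonneg (hf j), mul_comm]
  refine mul_le_mul_of_nonneg_left ?_ (hf j)
  rw [one_mul, Real.norm_of_nonneg (pow_nonneg (by linarith) j)] at hj
  exact hj

/-- The recursion is summed against `1`, `j`, `j ^ 2` and `z ^ j`. Each time a linear equation for
the unknown sum results, with the nonzero coefficient `1 - r` or `1 - r z`. The exponential weight
`z₀` guarantees beforehand that these series converge. -/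
lemma LawData.step {z₀ M V r : ℝ} {G : ℂ → ℂ} {f g : ℕ → ℝ} (h : LawData z₀ M V G f)
    (hz : 1 < z₀) (hr : 0 ≤ r) (hrz : r * z₀ < 1) (hg : GeomStep r f g) :
    LawData z₀ (M + r / (1 - r)) (V + (r / (1 - r) + (r / (1 - r)) ^ 2))
      (fun z => (1 - r) / (1 - r * z) * G z) g := by
  have hr1 : r < 1 := by nlinarith
  have hp : 1 - r ≠ 0 := by linarith
  have hgn := hg.nonneg hr hr1.le h.nonneg
  have hgs := hg.summable hr hr1.le h.nonneg (by linarith) hrz h.summable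
  have hs := summable_pow_mul_of_summable hgn hz hgs
  have hs0 : Summable g := by simpa using hs 0
  have hs1 : Summable fun j : ℕ => (j : ℝ) * g j := by simpa using hs 1
  have hs2 := hs 2
  have hf0 := h.hasSum_one
  have hf1 := h.hasSum_mean
  have hf2 := h.hasSum_sq
  have e0 : ∑' j, g j = 1 := by
    have h1 := hs0.tsum_eq_zero_add
    have h2 := (hs0.hasSum.mul_left r).add (((hasSum_nat_add_iff' 1).2 hf0).mul_left (1 - r))
    simp_rw [hg.succ] at h1
    rw [h2.tsum_eq, hg.zero] at h1
    simp only [Finset.sum_range_one] at h1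
    refine mul_left_cancel₀ hp ?_
    linear_combination h1
  have e1 : ∑' j : ℕ, (j : ℝ) * g j = M + r / (1 - r) := by
    have h1 := hs1.tsum_eq_zero_add
    have h2 := ((hs1.hasSum.add hs0.hasSum).mul_left r).add
      (((hasSum_nat_add_iff' 1).2 hf1).mul_left (1 - r))
    have h3 : (fun j : ℕ => ((j + 1 : ℕ) : ℝ) * g (j + 1)) = fun j : ℕ => r * ((j : ℝ) * g j + g j)
        + (1 - r) * (((j + 1 : ℕ) : ℝ) * f (j + 1)) := by
      ext j
      rw [hg.succ]
      push_cast
      ring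
    rw [h3, h2.tsum_eq, e0] at h1
    simp only [Finset.sum_range_one, Nat.cast_zero, zero_mul, sub_zero, zero_add] at h1
    refine mul_left_cancel₀ hp ?_
    linear_combination h1 - mul_div_cancel₀ r hp
  have e2 : ∑' j : ℕ, (j : ℝ) ^ 2 * g j
      = V + (r / (1 - r) + (r / (1 - r)) ^ 2) + (M + r / (1 - r)) ^ 2 := by
    have h1 := hs2.tsum_eq_zero_add
    have h2 := (((hs2.hasSum.add (hs1.hasSum.mul_left 2)).add hs0.hasSum).mul_left r).add
      (((hasSum_nat_add_iff' 1).2 hf2).mul_left (1 - r))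
    have h3 : (fun j : ℕ => ((j + 1 : ℕ) : ℝ) ^ 2 * g (j + 1)) = fun j : ℕ =>
        r * ((j : ℝ) ^ 2 * g j + 2 * ((j : ℝ) * g j) + g j)
        + (1 - r) * (((j + 1 : ℕ) : ℝ) ^ 2 * f (j + 1)) := by
      ext j
      rw [hg.succ]
      push_cast
      ring
    rw [h3, h2.tsum_eq, e0, e1] at h1
    simp only [Finset.sum_range_one, Nat.cast_zero, zero_mul, sub_zero, zero_add, ne_eq,
      OfNat.ofNat_ne_zero, not_false_eq_true, zero_pow] at h1
    refine mul_left_cancel₀ hp ?_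
    field_simp
    field_simp at h1
    linear_combination h1
  refine ⟨hgn, hgs, e0 ▸ hs0.hasSum, e1 ▸ hs1.hasSum, e2 ▸ hs2.hasSum, fun z hz1 => ?_⟩
  have hsz : Summable fun j : ℕ => (g j : ℂ) * z ^ j := by
    refine Summable.of_norm ?_
    simpa [norm_mul, norm_pow, hz1, abs_of_nonneg (hgn _)] using hs0
  have hfz := h.hasSum_gf z hz1
  have h1 := hsz.tsum_eq_zero_add
  have h2 := (hsz.hasSum.mul_left (r * z)).add
    (((hasSum_nat_add_iff' 1).2 hfz).mul_left (1 - r : ℂ))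
  have h3 : (fun j : ℕ => (g (j + 1) : ℂ) * z ^ (j + 1)) = fun j : ℕ =>
      r * z * ((g j : ℂ) * z ^ j) + (1 - r) * ((f (j + 1) : ℂ) * z ^ (j + 1)) := by
    ext j
    rw [hg.succ]
    push_cast
    ring
  rw [h3, h2.tsum_eq, hg.zero] at h1
  simp only [Finset.sum_range_one, pow_zero, mul_one] at h1
  have hne : (1 - r * z : ℂ) ≠ 0 := by
    intro h0
    have h4 : (r * z : ℂ) = 1 := by linear_combination -h0
    have h5 := congrArg norm h4
    rw [norm_mul, hz1, Complex.norm_real, Real.norm_of_nonneg hr, norm_one] at h5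
    linarith
  have e : ∑' j : ℕ, (g j : ℂ) * z ^ j = (1 - r) / (1 - r * z) * G z := by
    rw [div_mul_eq_mul_div, eq_div_iff hne]
    push_cast at h1
    linear_combination h1
  exact e ▸ hsz.hasSum

/-! ### The number of distinct coupons as a Markov chain -/

section Sampling

variable {Ω : Type*} {n : ℕ}

/-- The set of coupons obtained in the first `N` draws. -/
def collected (X : ℕ → Ω → Fin n) (N : ℕ) (ω : Ω) : Finset (Fin n) :=
  (Finset.range N).image fun i => X i ω

lemma collected_succ (X : ℕ → Ω → Fin n) (N : ℕ) (ω : Ω) :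
    collected X (N + 1) ω = insert (X N ω) (collected X N ω) := by
  rw [collected, Finset.range_add_one, Finset.image_insert, collected]

/-- The set of coupons as a function of the vector of the first draws. -/
lemma collected_eq_attach (X : ℕ → Ω → Fin n) (N : ℕ) (ω : Ω) :
    collected X N ω = Finset.univ.image
      fun i : Finset.range N => X i ω := by
  ext a
  simp [collected]

lemma collected_zero (X : ℕ → Ω → Fin n) (ω : Ω) : collected X 0 ω = ∅ := by
  simp [collected]

lemma card_collected_le (X : ℕ → Ω → Fin n) (N : ℕ) (ω : Ω) : (collected X N ω).card ≤ N :=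
  Finset.card_image_le.trans (by simp)

variable [MeasurableSpace Ω] {P : Measure Ω} {X : ℕ → Ω → Fin n}

lemma IsSampling.measurableSet_collected (h : IsSampling P X) (N : ℕ) (q : Finset (Fin n) → Prop) :
    MeasurableSet {ω | q (collected X N ω)} := by
  have hm : Measurable fun ω (i : Finset.range N) => X i ω :=
    measurable_pi_lambda _ fun i => h.measurable i
  have e : {ω | q (collected X N ω)} = (fun ω (i : Finset.range N) => X i ω) ⁻¹'
      {x | q (Finset.univ.image x)} := by
    ext ω
    simp only [Set.mem_ofPred_eq, Set.mem_preimage, collected_eq_attach]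
  rw [e]
  exact hm (Set.toFinite _).measurableSet

lemma IsSampling.measurableSet_draw (h : IsSampling P X) (N : ℕ) (a : Fin n) :
    MeasurableSet {ω | X N ω = a} := h.measurable N (measurableSet_singleton a)

/-- The collected set is a function of the first `N` draws, which are independent of the next one.
-/
lemma IsSampling.measureReal_inter (h : IsSampling P X) (N : ℕ) (S : Finset (Fin n)) (a : Fin n) :
    P.real ({ω | collected X N ω = S} ∩ {ω | X N ω = a})
      = P.real {ω | collected X N ω = S} * (1 / n) := by
  have hd : Disjoint (Finset.range N) {N} := by simp
  have hi := iIndepFun.indepFun_finset (Finset.range N) {N} hd h.indep h.measurable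
  have h1 := hi.measure_inter_preimage_eq_mul {x | Finset.univ.image x = S}
    {x | x ⟨N, Finset.mem_singleton_self N⟩ = a} (Set.toFinite _).measurableSet
    (Set.toFinite _).measurableSet
  have e1 : (fun ω (i : Finset.range N) => X i ω) ⁻¹' {x | Finset.univ.image x = S}
      = {ω | collected X N ω = S} := by
    ext ω
    simp only [Set.mem_ofPred_eq, Set.mem_preimage, collected_eq_attach]
  have e2 : (fun ω (i : ({N} : Finset ℕ)) => X i ω) ⁻¹'
      {x | x ⟨N, Finset.mem_singleton_self N⟩ = a} = {ω | X N ω = a} := rfl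
  rw [e1, e2] at h1
  rw [Measure.real, h1, ENNReal.toReal_mul]
  congr 1
  exact h.uniform N a

lemma IsSampling.measureReal_pair (h : IsSampling P X) [IsProbabilityMeasure P] (N : ℕ)
    (q : Finset (Fin n) → Fin n → Prop) [∀ S a, Decidable (q S a)] :
    P.real {ω | q (collected X N ω) (X N ω)}
      = ∑ S : Finset (Fin n), P.real {ω | collected X N ω = S} *
          ((Finset.univ.filter fun a => q S a).card / n) := by
  have e : {ω | q (collected X N ω) (X N ω)} =
      ⋃ p ∈ (Finset.univ.filter fun p : Finset (Fin n) × Fin n => q p.1 p.2),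
        ({ω | collected X N ω = p.1} ∩ {ω | X N ω = p.2}) := by
    ext ω
    simp only [Set.mem_ofPred_eq, Finset.mem_filter, Finset.mem_univ, true_and, Set.mem_iUnion,
      Set.mem_inter_iff, exists_prop, Prod.exists]
    constructor
    · intro hq; exact ⟨_, _, hq, rfl, rfl⟩
    · rintro ⟨_, _, hq, rfl, rfl⟩; exact hq
  rw [e, measureReal_biUnion_finset]
  · rw [Finset.sum_congr rfl fun p _ => h.measureReal_inter N p.1 p.2, Finset.sum_filter,
      Fintype.sum_prod_type]
    refine Finset.sum_congr rfl fun S _ => ?_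
    dsimp only
    rw [← Finset.sum_filter, Finset.sum_const, nsmul_eq_mul]
    ring
  · rintro ⟨S, a⟩ - ⟨S', a'⟩ - hne
    rw [Function.onFun, Set.disjoint_left]
    rintro ω ⟨h1, h2⟩ ⟨h3, h4⟩
    simp only [Set.mem_ofPred_eq] at h1 h2 h3 h4
    exact hne (by rw [← h1, ← h2, h3, h4])
  · exact fun p _ => (h.measurableSet_collected N (· = p.1)).inter (h.measurableSet_draw N p.2)

/-- The probability of having `i` distinct coupons after `N` draws. -/
def countProb (P : Measure Ω) (X : ℕ → Ω → Fin n) (N i : ℕ) : ℝ :=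
  P.real {ω | (collected X N ω).card = i}

lemma IsSampling.countProb_eq_sum (h : IsSampling P X) [IsProbabilityMeasure P] (hn : 0 < n)
    (N i : ℕ) : countProb P X N i
      = ∑ S : Finset (Fin n), if S.card = i then P.real {ω | collected X N ω = S} else 0 := by
  have h1 := h.measureReal_pair N (fun S _ => S.card = i)
  rw [countProb, h1]
  refine Finset.sum_congr rfl fun S _ => ?_
  have hn' : (n : ℝ) ≠ 0 := by positivity
  split_ifs with hS <;> simp [hS, hn']

lemma IsSampling.measureReal_old (h : IsSampling P X) [IsProbabilityMeasure P] (hn : 0 < n)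
    (N i : ℕ) : P.real {ω | (collected X N ω).card = i ∧ X N ω ∈ collected X N ω}
      = i / n * countProb P X N i := by
  rw [h.measureReal_pair N (fun S a => S.card = i ∧ a ∈ S), h.countProb_eq_sum hn, Finset.mul_sum]
  refine Finset.sum_congr rfl fun S _ => ?_
  split_ifs with hS
  · have : (Finset.univ.filter fun a => S.card = i ∧ a ∈ S) = S := by
      ext a; simp [hS]
    rw [this, hS]
    ring
  · simp [hS]

lemma IsSampling.measureReal_new (h : IsSampling P X) [IsProbabilityMeasure P] (hn : 0 < n)
    (N i : ℕ) : P.real {ω | (collected X N ω).card = i ∧ X N ω ∉ collected X N ω}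
      = (n - i) / n * countProb P X N i := by
  rw [h.measureReal_pair N (fun S a => S.card = i ∧ a ∉ S), h.countProb_eq_sum hn, Finset.mul_sum]
  refine Finset.sum_congr rfl fun S _ => ?_
  split_ifs with hS
  · have : (Finset.univ.filter fun a => S.card = i ∧ a ∉ S) = Sᶜ := by
      ext a; simp [hS]
    rw [this, Finset.card_compl, Nat.cast_sub (Finset.card_le_univ S), hS, Fintype.card_fin]
    ring
  · simp [hS]

lemma IsSampling.countProb_succ (h : IsSampling P X) [IsProbabilityMeasure P] (hn : 0 < n)
    (N i : ℕ) : countProb P X (N + 1) (i + 1)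
      = ((i + 1 : ℕ) : ℝ) / n * countProb P X N (i + 1) + (n - i) / n * countProb P X N i := by
  have e : {ω | (collected X (N + 1) ω).card = i + 1}
      = {ω | (collected X N ω).card = i + 1 ∧ X N ω ∈ collected X N ω}
        ∪ {ω | (collected X N ω).card = i ∧ X N ω ∉ collected X N ω} := by
    ext ω
    simp only [Set.mem_ofPred_eq, Set.mem_union, collected_succ]
    by_cases hω : X N ω ∈ collected X N ω
    · simp [hω]
    · simp [hω]
  rw [← h.measureReal_old hn, ← h.measureReal_new hn, countProb, e, measureReal_union]
  · rw [Set.disjoint_left]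
    rintro ω ⟨-, h1⟩ ⟨-, h2⟩
    exact h2 h1
  · have e2 : {ω | (collected X N ω).card = i ∧ X N ω ∉ collected X N ω}
        = {ω | (collected X N ω).card = i} ∩ {ω | (collected X (N + 1) ω).card
          = (collected X N ω).card + 1} := by
      ext ω
      simp only [Set.mem_ofPred_eq, Set.mem_inter_iff, collected_succ]
      by_cases hω : X N ω ∈ collected X N ω
      · simp [hω]
      · simp [hω]
    have e3 : {ω | (collected X N ω).card = i ∧ X N ω ∉ collected X N ω}
        = {ω | (collected X N ω).card = i} ∩ {ω | (collected X (N + 1) ω).card = i + 1} := by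
      rw [e2]
      ext ω
      simp only [Set.mem_ofPred_eq, Set.mem_inter_iff]
      constructor
      · rintro ⟨h1, h2⟩; exact ⟨h1, by rw [h2, h1]⟩
      · rintro ⟨h1, h2⟩; exact ⟨h1, by rw [h2, h1]⟩
    rw [e3]
    exact (h.measurableSet_collected N fun S => S.card = i).inter
      (h.measurableSet_collected (N + 1) fun S => S.card = i + 1)

lemma countProb_zero [IsProbabilityMeasure P] (X : ℕ → Ω → Fin n) (i : ℕ) :
    countProb P X 0 i = if i = 0 then 1 else 0 := by
  simp only [countProb, collected_zero, Finset.card_empty]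
  split_ifs with hi
  · simp [hi]
  · simp [Ne.symm hi]

lemma countProb_succ_zero (X : ℕ → Ω → Fin n) (N : ℕ) : countProb P X (N + 1) 0 = 0 := by
  have : {ω | (collected X (N + 1) ω).card = 0} = ∅ := by
    ext ω
    simp [collected_succ]
  rw [countProb, this, measureReal_empty]

lemma countProb_of_lt (X : ℕ → Ω → Fin n) {N i : ℕ} (hi : N < i) : countProb P X N i = 0 := by
  have : {ω | (collected X N ω).card = i} = ∅ := by
    ext ω
    have := card_collected_le X N ω
    simp only [Set.mem_ofPred_eq, Set.mem_empty_iff_false, iff_false]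
    omega
  rw [countProb, this, measureReal_empty]

/-- The law of the waiting time for the coupon number `i + 1`, minus `i + 1`. -/
def passageProb (P : Measure Ω) (X : ℕ → Ω → Fin n) (i j : ℕ) : ℝ :=
  (n - i) / n * countProb P X (j + i) i

lemma passageProb_zero [IsProbabilityMeasure P] (X : ℕ → Ω → Fin n) (hn : 0 < n) (j : ℕ) :
    passageProb P X 0 j = if j = 0 then 1 else 0 := by
  have hn' : (n : ℝ) ≠ 0 := by exact_mod_cast hn.ne'
  simp only [passageProb, add_zero, Nat.cast_zero, sub_zero]
  rw [div_self hn', one_mul]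
  cases j with
  | zero => simp [countProb_zero]
  | succ j => simp [countProb_succ_zero]

/-- This is the transition rule `countProb_succ` read along diagonals: an old coupon, of probability
`(i + 1) / n`, is a failure, and the prefactor in `passageProb` is the probability that the next
draw is new. -/
lemma IsSampling.geomStep (h : IsSampling P X) [IsProbabilityMeasure P] (hn : 0 < n) (i : ℕ) :
    GeomStep (((i + 1 : ℕ) : ℝ) / n) (passageProb P X i) (passageProb P X (i + 1)) := by
  have hn' : (n : ℝ) ≠ 0 := by positivity
  constructor
  · simp only [passageProb, zero_add]
    rw [h.countProb_succ hn, countProb_of_lt X (Nat.lt_succ_self i)]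
    field_simp
    ring
  · intro j
    simp only [passageProb]
    rw [← add_assoc (j + 1) i 1, h.countProb_succ hn, show j + (i + 1) = j + 1 + i by ring]
    field_simp

/-- The generating function factor. -/
lemma geom_factor_eq {n k : ℕ} (hk : 0 < k) (hkn : k ≤ n) (z : ℂ) :
    (1 - (((n - k : ℕ) : ℝ) / n : ℝ)) / (1 - (((n - k : ℕ) : ℝ) / n : ℝ) * z)
      = (1 - odds n k * (z - 1))⁻¹ := by
  have hk' : (k : ℂ) ≠ 0 := by exact_mod_cast hk.ne'
  have hn' : (n : ℂ) ≠ 0 := by exact_mod_cast (by omega : n ≠ 0)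
  rw [odds, Nat.cast_sub hkn]
  push_cast
  have e1 : (1 : ℂ) - (n - k) / n = k / n := by field_simp; ring
  have e2 : (1 : ℂ) - (n - k) / k * (z - 1) = (n / k) * (1 - (n - k) / n * z) := by
    field_simp; ring
  rw [e1, e2, mul_inv, inv_div, div_eq_mul_inv]

lemma aSum_pred {n m : ℕ} (hm : m + 1 ≤ n) (j : ℕ) :
    aSum n m j = aSum n (m + 1) j + odds n (m + 1) ^ j := by
  rw [aSum_eq, aSum_eq, ← Finset.insert_Icc_add_one_left_eq_Icc hm, Finset.sum_insert (by simp),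
    add_comm]

lemma geomGF_pred {n m : ℕ} (hm : m + 1 ≤ n) (w : ℂ) :
    geomGF n m w = (1 - odds n (m + 1) * w)⁻¹ * geomGF n (m + 1) w := by
  rw [geomGF, geomGF, ← Finset.insert_Icc_add_one_left_eq_Icc hm, Finset.prod_insert (by simp)]

/-- Induction on the number of coupons, with `m = n - i - 1` missing at the end. The first coupon
costs no extra draw, since `odds n n = 0`. All failure probabilities are at most `(n - 1) / n`, and
`(n - 1) / n * (1 + 1 / (2 n)) < 1`, so one exponential weight serves every step. -/
lemma IsSampling.lawData (h : IsSampling P X) [IsProbabilityMeasure P] (i : ℕ) (hi : i < n) :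
    LawData (1 + 1 / (2 * n)) (aSum n (n - i - 1) 1) (varSum n (n - i - 1))
      (fun z => geomGF n (n - i - 1) (z - 1)) (passageProb P X i) := by
  have hn : 0 < n := by omega
  have hn' : (0 : ℝ) < n := by exact_mod_cast hn
  induction i with
  | zero =>
    have ho : odds n n = 0 := by simp [odds]
    have hS : Finset.Icc (n - 0 - 1 + 1) n = {n} := by
      rw [show n - 0 - 1 + 1 = n by omega, Finset.Icc_self]
    have ha : ∀ j, 1 ≤ j → aSum n (n - 0 - 1) j = 0 := by
      intro j hj
      rw [aSum_eq, hS, Finset.sum_singleton, ho, zero_pow (by omega)]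
    rw [_root_.funext (passageProb_zero X hn), varSum, ha 1 le_rfl, ha 2 (by norm_num)]
    refine ⟨fun j => ?_, ?_, hasSum_ite_eq 0 1, ?_, ?_, fun z _ => ?_⟩
    · split_ifs <;> norm_num
    · refine summable_of_ne_finset_zero (s := {0}) fun j hj => ?_
      simp only [Finset.mem_singleton] at hj
      simp [hj]
    · have : (fun j : ℕ => (j : ℝ) * (if j = 0 then (1 : ℝ) else 0)) = fun _ => 0 := by
        ext j; split_ifs with hj <;> simp [hj]
      rw [this]; exact hasSum_zero
    · have : (fun j : ℕ => (j : ℝ) ^ 2 * (if j = 0 then (1 : ℝ) else 0)) = fun _ => 0 := by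
        ext j; split_ifs with hj <;> simp [hj]
      rw [this]; simp
    · have h1 : (fun j : ℕ => (((if j = 0 then (1 : ℝ) else 0 : ℝ)) : ℂ) * z ^ j)
          = fun j => if j = 0 then 1 else 0 := by
        ext j; split_ifs with hj <;> simp [hj]
      rw [h1, geomGF, hS, Finset.prod_singleton, ho]
      simpa using hasSum_ite_eq (0 : ℕ) (1 : ℂ)
  | succ i ih =>
    have hs := (ih (by omega)).step (by
        have : 0 < 1 / (2 * (n : ℝ)) := by positivity
        linarith) (by positivity) (by
        have h1 : ((i + 1 : ℕ) : ℝ) ≤ n - 1 := by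
          have : ((i + 1 : ℕ) : ℝ) + 1 ≤ n := by exact_mod_cast hi
          linarith
        calc ((i + 1 : ℕ) : ℝ) / n * (1 + 1 / (2 * n)) ≤ (n - 1) / n * (1 + 1 / (2 * n)) := by
              gcongr
          _ < 1 := by
              rw [div_mul_eq_mul_div, div_lt_one hn']
              have h2 : (n : ℝ) * (1 / (2 * n)) = 1 / 2 := by field_simp
              have h3 : 0 < 1 / (2 * (n : ℝ)) := by positivity
              nlinarith) (h.geomStep hn i)
    set m := n - (i + 1) - 1 with hm
    have hmi : n - i - 1 = m + 1 := by omega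
    have hk : n - (m + 1) = i + 1 := by omega
    have hr : ((i + 1 : ℕ) : ℝ) / n / (1 - ((i + 1 : ℕ) : ℝ) / n) = odds n (m + 1) := by
      have e : ((i + 1 : ℕ) : ℝ) = n - ((m + 1 : ℕ) : ℝ) := by
        rw [← hk, Nat.cast_sub (by omega)]
      have h0 : ((m + 1 : ℕ) : ℝ) ≠ 0 := by positivity
      rw [e, odds]
      have : 1 - ((n : ℝ) - ((m + 1 : ℕ) : ℝ)) / n = ((m + 1 : ℕ) : ℝ) / n := by
        field_simp; ring
      rw [this]
      field_simp
    rw [hmi, hr] at hs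
    have e1 : aSum n m 1 = aSum n (m + 1) 1 + odds n (m + 1) := by
      rw [aSum_pred (by omega), pow_one]
    have e2 : varSum n m = varSum n (m + 1) + (odds n (m + 1) + odds n (m + 1) ^ 2) := by
      rw [varSum, varSum, e1, aSum_pred (by omega) 2]; ring
    have e3 : (fun z => geomGF n m (z - 1)) = fun z : ℂ =>
        (1 - (((i + 1 : ℕ) : ℝ) / n : ℝ)) / (1 - (((i + 1 : ℕ) : ℝ) / n : ℝ) * z)
          * geomGF n (m + 1) (z - 1) := by
      ext z
      rw [geomGF_pred (by omega), ← geom_factor_eq (by omega) (by omega), hk]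
    rw [e1, e2, e3]
    exact hs

end Sampling

/-! ### The waiting time: law, mean and variance -/

lemma card_collected_succ_le {Ω : Type*} {n : ℕ} (X : ℕ → Ω → Fin n) (N : ℕ) (ω : Ω) :
    (collected X (N + 1) ω).card ≤ (collected X N ω).card + 1 := by
  rw [collected_succ]
  exact Finset.card_insert_le _ _

lemma monotone_card_collected {Ω : Type*} {n : ℕ} (X : ℕ → Ω → Fin n) (ω : Ω) :
    Monotone fun N => (collected X N ω).card := by
  refine monotone_nat_of_le_succ fun N => ?_
  rw [collected_succ]
  exact Finset.card_le_card (Finset.subset_insert _ _)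

/-- The cardinality is monotone and grows by at most one per draw, so the level is first reached
exactly when a new coupon arrives one step below it. -/
lemma waitingTime_eq_succ_iff {Ω : Type*} {n m i : ℕ} (hi : i + 1 + m = n) (X : ℕ → Ω → Fin n)
    (N : ℕ) (ω : Ω) : waitingTime X m ω = N + 1 ↔
      (collected X N ω).card = i ∧ X N ω ∉ collected X N ω := by
  have hset : waitingTime X m ω = sInf {M : ℕ | (collected X M ω).card + m = n} := rfl
  have hmono := monotone_card_collected X ω
  rw [hset]
  constructor
  · intro h
    have hmem : N + 1 ∈ {M : ℕ | (collected X M ω).card + m = n} := by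
      rw [← h]
      -- A positive value excludes the default `sInf ∅ = 0`.
      exact Nat.sInf_mem (Nat.nonempty_of_sInf_eq_succ h)
    have hnot : N ∉ {M : ℕ | (collected X M ω).card + m = n} :=
      Nat.notMem_of_lt_sInf (by omega)
    have h1 : (collected X (N + 1) ω).card + m = n := hmem
    have h2 : ¬ (collected X N ω).card + m = n := hnot
    have h3 := card_collected_succ_le X N ω
    have h4 : (collected X N ω).card ≤ (collected X (N + 1) ω).card := hmono (Nat.le_succ N)
    refine ⟨by omega, fun hin => ?_⟩
    rw [collected_succ, Finset.insert_eq_of_mem hin] at h1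
    exact h2 h1
  · rintro ⟨h1, h2⟩
    have hmem : N + 1 ∈ {M : ℕ | (collected X M ω).card + m = n} := by
      show (collected X (N + 1) ω).card + m = n
      rw [collected_succ, Finset.card_insert_of_notMem h2, h1, hi]
    refine le_antisymm (Nat.sInf_le hmem) (Nat.succ_le_of_lt (not_le.1 fun hle => ?_))
    have h3 : (collected X (sInf {M : ℕ | (collected X M ω).card + m = n}) ω).card + m = n :=
      Nat.sInf_mem (s := {M : ℕ | (collected X M ω).card + m = n}) ⟨_, hmem⟩
    have h4 := hmono hle
    simp only at h4
    omega

section Sampling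

variable {Ω : Type*} [MeasurableSpace Ω] {P : Measure Ω} {n : ℕ} {X : ℕ → Ω → Fin n}

lemma IsSampling.measurableSet_waitingTime_succ (h : IsSampling P X) {m i : ℕ} (hi : i + 1 + m = n)
    (N : ℕ) : MeasurableSet {ω | waitingTime X m ω = N + 1} := by
  have e : {ω | waitingTime X m ω = N + 1} = ⋃ a : Fin n,
      ({ω | (collected X N ω).card = i ∧ a ∉ collected X N ω} ∩ {ω | X N ω = a}) := by
    ext ω
    simp only [Set.mem_ofPred_eq, Set.mem_iUnion, Set.mem_inter_iff, waitingTime_eq_succ_iff hi]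
    constructor
    · intro h1; exact ⟨_, h1, rfl⟩
    · rintro ⟨_, h1, rfl⟩; exact h1
  rw [e]
  exact MeasurableSet.iUnion fun a =>
    (h.measurableSet_collected N fun S => S.card = i ∧ a ∉ S).inter (h.measurableSet_draw N a)

lemma IsSampling.measurable_waitingTime (h : IsSampling P X) {m : ℕ} (hm : m < n) :
    Measurable (waitingTime X m) := by
  have hi : n - m - 1 + 1 + m = n := by omega
  refine measurable_to_countable' fun N => ?_
  cases N with
  | zero =>
    -- The value `0`, which is also the default when the level is never reached, is handled as the
    -- complement of the positive values.
    have e : waitingTime X m ⁻¹' {0} = (⋃ N, {ω | waitingTime X m ω = N + 1})ᶜ := by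
      ext ω
      simp only [Set.mem_preimage, Set.mem_singleton_iff, Set.mem_compl_iff, Set.mem_iUnion,
        Set.mem_ofPred_eq, not_exists]
      constructor
      · intro h1 N; omega
      · intro h1
        by_contra h2
        exact h1 (waitingTime X m ω - 1) (by omega)
    rw [e]
    exact (MeasurableSet.iUnion fun N => h.measurableSet_waitingTime_succ hi N).compl
  | succ N => exact h.measurableSet_waitingTime_succ hi N

/-- The shifted waiting time as a natural number. -/
def excess (X : ℕ → Ω → Fin n) (m : ℕ) (ω : Ω) : ℕ := waitingTime X m ω - (n - m)

lemma IsSampling.measurable_excess (h : IsSampling P X) {m : ℕ} (hm : m < n) :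
    Measurable (excess X m) :=
  (measurable_from_top (f := fun N : ℕ => N - (n - m))).comp (h.measurable_waitingTime hm)

lemma IsSampling.measureReal_waitingTime (h : IsSampling P X) [IsProbabilityMeasure P] {m : ℕ}
    (hm : m < n) (j : ℕ) :
    P.real {ω | waitingTime X m ω = j + (n - m)} = passageProb P X (n - m - 1) j := by
  have hi : n - m - 1 + 1 + m = n := by omega
  have e : {ω | waitingTime X m ω = j + (n - m)} =
      {ω | (collected X (j + (n - m - 1)) ω).card = n - m - 1 ∧
        X (j + (n - m - 1)) ω ∉ collected X (j + (n - m - 1)) ω} := by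
    ext ω
    simp only [Set.mem_ofPred_eq]
    rw [← waitingTime_eq_succ_iff hi]
    omega
  rw [e, h.measureReal_new (by omega)]
  rfl

lemma IsSampling.lawData' (h : IsSampling P X) [IsProbabilityMeasure P] {m : ℕ} (hm : m < n) :
    LawData (1 + 1 / (2 * n)) (aSum n m 1) (varSum n m) (fun z => geomGF n m (z - 1))
      (passageProb P X (n - m - 1)) := by
  have := h.lawData (n - m - 1) (by omega)
  rwa [show n - (n - m - 1) - 1 = m by omega] at this

/-- The masses `passageProb` already sum to one, so the values below `n - m`, including the default
`0`, have probability zero and the truncated subtraction in `excess` is harmless. -/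
lemma IsSampling.ae_waitingTime (h : IsSampling P X) [IsProbabilityMeasure P] {m : ℕ}
    (hm : m < n) : ∀ᵐ ω ∂P, waitingTime X m ω = excess X m ω + (n - m) := by
  have hW := h.measurable_waitingTime hm
  have hms : ∀ j, MeasurableSet {ω | waitingTime X m ω = j + (n - m)} := fun j =>
    hW (measurableSet_singleton _)
  have hU : P (⋃ j : ℕ, {ω | waitingTime X m ω = j + (n - m)}) = 1 := by
    rw [measure_iUnion _ hms]
    · have e : ∀ j : ℕ, P {ω | waitingTime X m ω = j + (n - m)}
          = ENNReal.ofReal (passageProb P X (n - m - 1) j) := by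
        intro j
        rw [← h.measureReal_waitingTime hm, ofReal_measureReal]
      have hd := h.lawData' hm
      simp_rw [e]
      rw [← ENNReal.ofReal_tsum_of_nonneg hd.nonneg hd.hasSum_one.summable, hd.hasSum_one.tsum_eq,
        ENNReal.ofReal_one]
    · intro j j' hj
      rw [Function.onFun, Set.disjoint_left]
      intro ω h1 h2
      simp only [Set.mem_ofPred_eq] at h1 h2
      omega
  have hae : ∀ᵐ ω ∂P, ω ∈ ⋃ j : ℕ, {ω | waitingTime X m ω = j + (n - m)} :=
    (mem_ae_iff_prob_eq_one (MeasurableSet.iUnion hms)).2 hU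
  filter_upwards [hae] with ω hω
  obtain ⟨j, hj⟩ := Set.mem_iUnion.1 hω
  simp only [Set.mem_ofPred_eq] at hj
  rw [excess]
  omega

lemma IsSampling.measureReal_excess (h : IsSampling P X) [IsProbabilityMeasure P] {m : ℕ}
    (hm : m < n) (j : ℕ) : P.real {ω | excess X m ω = j} = passageProb P X (n - m - 1) j := by
  rw [← h.measureReal_waitingTime hm]
  refine measureReal_congr ?_
  filter_upwards [h.ae_waitingTime hm] with ω hω
  apply propext
  show excess X m ω = j ↔ waitingTime X m ω = j + (n - m)
  omega

end Sampling

lemma integrable_nat_of_summable {ν : Measure ℕ} [IsFiniteMeasure ν] {g : ℕ → ℝ}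
    (hs : Summable fun j => |g j| * ν.real {j}) : Integrable g ν := by
  refine ⟨(measurable_of_countable g).aestronglyMeasurable, ?_⟩
  rw [hasFiniteIntegral_iff_enorm, lintegral_countable']
  have e : ∀ j, ‖g j‖ₑ * ν {j} = ENNReal.ofReal (|g j| * ν.real {j}) := by
    intro j
    rw [ENNReal.ofReal_mul (abs_nonneg _), ofReal_measureReal, Real.enorm_eq_ofReal_abs]
  simp_rw [e]
  exact hs.tsum_ofReal_lt_top

lemma integrable_comp_nat {Ω : Type*} [MeasurableSpace Ω] {P : Measure Ω} [IsProbabilityMeasure P]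
    {Y : Ω → ℕ} (hY : Measurable Y) {g : ℕ → ℝ}
    (hs : Summable fun j => |g j| * P.real {ω | Y ω = j}) :
    Integrable (fun ω => g (Y ω)) P ∧ ∫ ω, g (Y ω) ∂P = ∑' j, g j * P.real {ω | Y ω = j} := by
  have hreal : ∀ j, (P.map Y).real {j} = P.real {ω | Y ω = j} := fun j =>
    map_measureReal_apply hY (measurableSet_singleton j)
  have : IsProbabilityMeasure (P.map Y) := Measure.isProbabilityMeasure_map hY.aemeasurable
  have hi : Integrable g (P.map Y) := integrable_nat_of_summable (by simpa only [hreal] using hs)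
  have hg : AEStronglyMeasurable g (P.map Y) := (measurable_of_countable g).aestronglyMeasurable
  refine ⟨(integrable_map_measure hg hY.aemeasurable).1 hi, ?_⟩
  rw [← integral_map hY.aemeasurable hg, integral_countable hi]
  refine tsum_congr fun j => ?_
  rw [hreal, smul_eq_mul, mul_comm]

section Sampling

variable {Ω : Type*} [MeasurableSpace Ω] {P : Measure Ω} {n : ℕ} {X : ℕ → Ω → Fin n}

lemma IsSampling.moments (h : IsSampling P X) [IsProbabilityMeasure P] {m : ℕ} (hm : m < n) :
    ∫ ω, (excess X m ω : ℝ) ∂P = aSum n m 1 ∧ Var[fun ω => (excess X m ω : ℝ); P] = varSum n m := by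
  have hY := h.measurable_excess hm
  have hd := h.lawData' hm
  have hre := h.measureReal_excess hm
  have h1 : Summable fun j : ℕ => |(j : ℝ)| * P.real {ω | excess X m ω = j} := by
    simpa only [hre, Nat.abs_cast] using hd.hasSum_mean.summable
  have h2 : Summable fun j : ℕ => |(j : ℝ) ^ 2| * P.real {ω | excess X m ω = j} := by
    simpa only [hre, abs_pow, Nat.abs_cast] using hd.hasSum_sq.summable
  obtain ⟨i1, e1⟩ := integrable_comp_nat hY (g := fun j => (j : ℝ)) h1
  obtain ⟨i2, e2⟩ := integrable_comp_nat hY (g := fun j => (j : ℝ) ^ 2) h2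
  simp only [hre] at e1 e2
  rw [hd.hasSum_mean.tsum_eq] at e1
  rw [hd.hasSum_sq.tsum_eq] at e2
  refine ⟨e1, ?_⟩
  have hmem : MemLp (fun ω => (excess X m ω : ℝ)) 2 P :=
    (memLp_two_iff_integrable_sq i1.aestronglyMeasurable).2 i2
  rw [variance_eq_sub hmem, e1]
  simp only [Pi.pow_apply]
  rw [e2]
  ring

lemma IsSampling.ae_shiftedTime (h : IsSampling P X) [IsProbabilityMeasure P] {m : ℕ}
    (hm : m < n) : ∀ᵐ ω ∂P, shiftedTime X m ω = (excess X m ω : ℤ) := by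
  filter_upwards [h.ae_waitingTime hm] with ω hω
  rw [shiftedTime, hω]
  push_cast [hm.le]
  ring

/-- The variance of the waiting time. -/
lemma IsSampling.timeVar_eq (h : IsSampling P X) [IsProbabilityMeasure P] {m : ℕ} (hm : m < n) :
    timeVar P X m = varSum n m := by
  rw [← (h.moments hm).2, timeVar]
  have e : (fun ω => (waitingTime X m ω : ℝ)) =ᵐ[P]
      fun ω => (excess X m ω : ℝ) + ((n - m : ℕ) : ℝ) := by
    filter_upwards [h.ae_waitingTime hm] with ω hω
    rw [hω]
    push_cast
    rfl
  rw [variance_congr e, variance_add_const]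
  exact ((measurable_from_top (f := fun j : ℕ => (j : ℝ))).comp
    (h.measurable_excess hm)).aestronglyMeasurable

/-- The mean is `a₁` and the variance is `a₁ + a₂`; an integer translation changes the variance of
neither side. -/
lemma IsSampling.shift_eq (h : IsSampling P X) [IsProbabilityMeasure P] {m : ℕ} (hm : m < n) :
    shift P X m = ⌊aSum n m 2⌋ := by
  have e : (fun ω => (shiftedTime X m ω : ℝ)) =ᵐ[P] fun ω => (excess X m ω : ℝ) := by
    filter_upwards [h.ae_shiftedTime hm] with ω hω
    rw [hω]
    push_cast
    rfl
  rw [shift, variance_congr e, integral_congr_ae e, (h.moments hm).1, (h.moments hm).2, varSum,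
    add_sub_cancel_left]

/-- The law of the shifted waiting time plus the integer shift, as a sequence. -/
def collectorLaw (P : Measure Ω) (X : ℕ → Ω → Fin n) (m : ℕ) (j : ℕ) : ℝ :=
  if j < ⌊aSum n m 2⌋.toNat then 0 else passageProb P X (n - m - 1) (j - ⌊aSum n m 2⌋.toNat)

lemma hasSum_of_hasSum_shift {M : Type*} [AddCommGroup M] [TopologicalSpace M]
    [IsTopologicalAddGroup M] {F : ℕ → M} {c : ℕ} {a : M}
    (h0 : ∀ j < c, F j = 0) (h : HasSum (fun j => F (j + c)) a) : HasSum F a := by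
  rw [← hasSum_nat_add_iff' c, Finset.sum_eq_zero fun j hj => h0 j (Finset.mem_range.1 hj),
    sub_zero]
  exact h

lemma collectorLaw_add (P : Measure Ω) (X : ℕ → Ω → Fin n) (m j : ℕ) :
    collectorLaw P X m (j + ⌊aSum n m 2⌋.toNat) = passageProb P X (n - m - 1) j := by
  simp [collectorLaw]

lemma collectorLaw_of_lt (P : Measure Ω) (X : ℕ → Ω → Fin n) {m j : ℕ}
    (hj : j < ⌊aSum n m 2⌋.toNat) : collectorLaw P X m j = 0 := by
  simp [collectorLaw, hj]

lemma IsSampling.isCollectorLaw (h : IsSampling P X) [IsProbabilityMeasure P] {m : ℕ}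
    (hm : m < n) : IsCollectorLaw n m (collectorLaw P X m) := by
  have hd := h.lawData' hm
  have hcast : ((⌊aSum n m 2⌋.toNat : ℕ) : ℝ) = (⌊aSum n m 2⌋ : ℝ) := by
    rw [← Int.cast_natCast, Int.toNat_of_nonneg (Int.floor_nonneg.2 (aSum_nonneg n m 2))]
  refine ⟨fun j => ?_, ?_, ?_, fun t => ?_⟩
  · unfold collectorLaw
    split_ifs
    · exact le_rfl
    · exact hd.nonneg _
  · refine hasSum_of_hasSum_shift (fun j hj => collectorLaw_of_lt P X hj) ?_
    simpa only [collectorLaw_add] using hd.hasSum_one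
  · refine hasSum_of_hasSum_shift (c := ⌊aSum n m 2⌋.toNat)
      (fun j hj => by rw [collectorLaw_of_lt P X hj, mul_zero]) ?_
    have := hd.hasSum_mean.add (hd.hasSum_one.mul_left (⌊aSum n m 2⌋ : ℝ))
    rw [mul_one] at this
    refine this.congr_fun fun j => ?_
    rw [collectorLaw_add]
    push_cast [hcast]
    ring
  · refine hasSum_of_hasSum_shift (c := ⌊aSum n m 2⌋.toNat)
      (fun j hj => by rw [collectorLaw_of_lt P X hj]; simp) ?_
    have hz : ‖Complex.exp (t * Complex.I)‖ = 1 := Complex.norm_exp_ofReal_mul_I t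
    have := (hd.hasSum_gf _ hz).mul_left (Complex.exp (t * Complex.I) ^ ⌊aSum n m 2⌋.toNat)
    refine this.congr_fun fun j => ?_
    rw [collectorLaw_add, pow_add]
    ring

lemma IsSampling.law_apply (h : IsSampling P X) [IsProbabilityMeasure P] {m : ℕ} (hm : m < n)
    (B : Set ℤ) : law P X m B =
      ∑' j : ℕ, B.indicator (fun _ => 1) (j : ℤ) * collectorLaw P X m j := by
  have hY := h.measurable_excess hm
  have hd := h.lawData' hm
  have hcnn : (0 : ℤ) ≤ ⌊aSum n m 2⌋ := Int.floor_nonneg.2 (aSum_nonneg n m 2)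
  set c := ⌊aSum n m 2⌋.toNat with hc
  have hcZ : (c : ℤ) = ⌊aSum n m 2⌋ := Int.toNat_of_nonneg hcnn
  have hae : (fun ω => shiftedTime X m ω + shift P X m) =ᵐ[P]
      fun ω => ((excess X m ω : ℤ) + c) := by
    filter_upwards [h.ae_shiftedTime hm] with ω hω
    rw [hω, h.shift_eq hm, hcZ]
  have hmeas : Measurable fun ω => ((excess X m ω : ℤ) + c) :=
    (measurable_from_top (f := fun j : ℕ => (j : ℤ) + c)).comp hY
  have hB : MeasurableSet B := MeasurableSet.of_discrete
  have e1 : law P X m B = P.real {ω | ((excess X m ω : ℤ) + c) ∈ B} := by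
    rw [law, Measure.toSignedMeasure_apply_measurable hB, Measure.map_congr hae,
      map_measureReal_apply hmeas hB]
    rfl
  have hind : ∀ k : ℤ, |B.indicator (fun _ => (1 : ℝ)) k| ≤ 1 := by
    intro k
    by_cases hk : k ∈ B <;> simp [hk]
  have hre := h.measureReal_excess hm
  have hs : Summable fun j : ℕ => |B.indicator (fun _ => (1 : ℝ)) ((j : ℤ) + c)| *
      P.real {ω | excess X m ω = j} := by
    simp only [hre]
    refine Summable.of_nonneg_of_le (fun j => mul_nonneg (abs_nonneg _) (hd.nonneg j)) (fun j => ?_)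
      hd.hasSum_one.summable
    exact mul_le_of_le_one_left (hd.nonneg j) (hind _)
  have e2 := (integrable_comp_nat hY (g := fun j : ℕ => B.indicator (fun _ => (1 : ℝ)) ((j : ℤ) + c))
    hs).2
  have e3 : ∫ ω, B.indicator (fun _ => (1 : ℝ)) ((excess X m ω : ℤ) + c) ∂P
      = P.real {ω | ((excess X m ω : ℤ) + c) ∈ B} :=
    integral_indicator_one (μ := P) (hmeas hB)
  rw [e1, ← e3, e2]
  have hs' : Summable fun j : ℕ => B.indicator (fun _ => (1 : ℝ)) ((j : ℤ) + c) *
      passageProb P X (n - m - 1) j := by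
    refine Summable.of_abs ?_
    simpa only [hre, abs_mul, abs_of_nonneg (hd.nonneg _)] using hs
  refine (HasSum.tsum_eq ?_).symm
  refine hasSum_of_hasSum_shift (c := c) (fun j hj => by
    rw [collectorLaw_of_lt P X hj, mul_zero]) ?_
  simp only [hre]
  refine hs'.hasSum.congr_fun fun j => ?_
  rw [hc, collectorLaw_add]
  push_cast
  rfl

end Sampling

/-! ### From signed measures on the integers to sequences -/

lemma pcMeasure_apply {lam : ℝ} {H : ℝ[X]} (hs : Summable fun j => |pcMass lam H j|) (B : Set ℤ) :
    pcMeasure lam H B = ∑' j : ℕ, B.indicator (fun _ => 1) (j : ℤ) * pcMass lam H j := by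
  have hinj : Function.Injective ((↑) : ℕ → ℤ) := Nat.cast_injective
  have hsZ : Summable fun k : ℤ => ‖if 0 ≤ k then pcMass lam H k.toNat else 0‖ := by
    rw [← hinj.summable_iff]
    · simpa [Function.comp_def] using hs
    · intro k hk
      have : ¬ 0 ≤ k := fun h0 => hk ⟨k.toNat, Int.toNat_of_nonneg h0⟩
      simp [this]
  have hi : Integrable (fun k : ℤ => if 0 ≤ k then pcMass lam H k.toNat else 0)
      (Measure.count : Measure ℤ) := integrable_count_iff.2 hsZ
  have hB : MeasurableSet B := MeasurableSet.of_discrete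
  rw [pcMeasure, withDensityᵥ_apply hi hB, ← integral_indicator hB,
    integral_countable (hi.indicator hB)]
  have e : ∀ k : ℤ, (Measure.count : Measure ℤ).real {k} •
      B.indicator (fun k : ℤ => if 0 ≤ k then pcMass lam H k.toNat else 0) k
      = B.indicator (fun k : ℤ => if 0 ≤ k then pcMass lam H k.toNat else 0) k := by
    intro k
    simp [Measure.real]
  simp_rw [e]
  rw [← hinj.tsum_eq]
  · refine tsum_congr fun j => ?_
    by_cases hj : (j : ℤ) ∈ B <;> simp [hj]
  · intro k hk
    have h1 : 0 ≤ k := by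
      by_contra hcon
      refine hk ?_
      by_cases hkB : k ∈ B <;> simp [hkB, hcon]
    exact ⟨k.toNat, Int.toNat_of_nonneg h1⟩

lemma abs_tsum_le_tsum_abs {f : ℕ → ℝ} (hf : Summable fun j => |f j|) : |∑' j, f j| ≤ ∑' j, |f j| := by
  simp only [← Real.norm_eq_abs] at hf ⊢
  exact norm_tsum_le_tsum_norm hf

lemma abs_tsum_mul_sub_le {q p r : ℕ → ℝ} (hq : Summable fun j => |q j|)
    (hp : Summable fun j => |p j|) (hr : ∀ j, |r j| ≤ 1) :
    |∑' j : ℕ, r j * q j - ∑' j : ℕ, r j * p j| ≤ ∑' j, |q j - p j| := by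
  have hle : ∀ (f : ℕ → ℝ) (j : ℕ), |r j * f j| ≤ |f j| := by
    intro f j
    rw [abs_mul]
    exact mul_le_of_le_one_left (abs_nonneg _) (hr _)
  have hsum : ∀ f : ℕ → ℝ, (Summable fun j => |f j|) → Summable fun j : ℕ => r j * f j :=
    fun f hf => Summable.of_norm_bounded hf (hle f)
  have hs : Summable fun j => |q j - p j| :=
    Summable.of_nonneg_of_le (fun _ => abs_nonneg _) (fun _ => abs_sub _ _) (hq.add hp)
  have hsabs : Summable fun j => |r j * (q j - p j)| :=
    Summable.of_nonneg_of_le (fun _ => abs_nonneg _) (hle fun j => q j - p j) hs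
  have e : ∑' j : ℕ, r j * q j - ∑' j : ℕ, r j * p j = ∑' j : ℕ, r j * (q j - p j) := by
    rw [← (hsum _ hq).tsum_sub (hsum _ hp)]
    exact tsum_congr fun j => by ring
  rw [e]
  exact (abs_tsum_le_tsum_abs hsabs).trans (hsabs.tsum_le_tsum (hle fun j => q j - p j) hs)

/-- The total variation distance is bounded by the `ℓ¹` distance. -/
lemma IsSampling.dTV_le {Ω : Type*} [MeasurableSpace Ω] {P : Measure Ω} [IsProbabilityMeasure P]
    {n : ℕ} {X : ℕ → Ω → Fin n} (h : IsSampling P X) {m : ℕ} (hm : m < n) {lam : ℝ} {H : ℝ[X]}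
    (hs : Summable fun j => |collectorLaw P X m j - pcMass lam H j|) :
    dTV (law P X m) (pcMeasure lam H) ≤ ∑' j, |collectorLaw P X m j - pcMass lam H j| := by
  have hq := h.isCollectorLaw hm
  have hq1 : Summable fun j => |collectorLaw P X m j| := by
    simpa only [abs_of_nonneg (hq.nonneg _)] using hq.hasSum_one.summable
  have hp : Summable fun j => |pcMass lam H j| := by
    refine Summable.of_nonneg_of_le (fun _ => abs_nonneg _) (fun j => ?_) (hq1.add hs)
    calc |pcMass lam H j| = |collectorLaw P X m j - (collectorLaw P X m j - pcMass lam H j)| := by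
          congr 1; ring
      _ ≤ _ := abs_sub _ _
  refine ciSup_le fun B => ?_
  rw [h.law_apply hm, pcMeasure_apply hp]
  exact abs_tsum_mul_sub_le hq1 hp fun j => by by_cases hj : (j : ℤ) ∈ B <;> simp [hj]

/-! ### Size of the power sums and verification of the regimes -/

/-- The small parameter is `n ^ (-1/6)` or `m ^ (-1/6)`. The sixth root makes square and cube roots
integral powers of `β`; the critical scale `n ^ (2/3)` of `n - m` becomes `β ^ (-4)`. -/
lemma exists_sixth_root {b : ℝ} (hb : 1 ≤ b) : ∃ β : ℝ, 0 < β ∧ β ≤ 1 ∧ β ^ 6 * b = 1 := by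
  have hb0 : 0 < b := by linarith
  refine ⟨b⁻¹ ^ ((6 : ℕ) : ℝ)⁻¹, by positivity, ?_, ?_⟩
  · exact Real.rpow_le_one (by positivity) (inv_le_one_of_one_le₀ hb) (by positivity)
  · rw [Real.rpow_inv_natCast_pow (by positivity) (by norm_num), inv_mul_cancel₀ hb0.ne']

lemma odds_le_of_le {n m k : ℕ} (hm : 0 < m) (hk : k ∈ Finset.Icc (m + 1) n) :
    odds n k ≤ n / m := by
  obtain ⟨h1, h2⟩ := Finset.mem_Icc.1 hk
  have hm' : (0 : ℝ) < m := by exact_mod_cast hm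
  have h1' : (m : ℝ) ≤ k := by exact_mod_cast (by omega : m ≤ k)
  exact div_le_div₀ (by positivity) (by linarith [Nat.cast_nonneg (α := ℝ) k]) hm' h1'

lemma varSum_le (n m : ℕ) : varSum n m ≤ (n : ℝ) ^ 3 := by
  have e : varSum n m = ∑ k ∈ Finset.Icc (m + 1) n, (odds n k + odds n k ^ 2) := by
    rw [varSum, aSum_eq, aSum_eq, Finset.sum_add_distrib]
    simp
  rw [e]
  have hterm : ∀ k ∈ Finset.Icc (m + 1) n, odds n k + odds n k ^ 2 ≤ (n : ℝ) ^ 2 := by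
    intro k hk
    obtain ⟨h1, h2⟩ := Finset.mem_Icc.1 hk
    have h0 := odds_nonneg hk
    have hk1 : (1 : ℝ) ≤ k := by exact_mod_cast (by omega : 1 ≤ k)
    have hkn : (k : ℝ) ≤ n := by exact_mod_cast h2
    have h3 : odds n k ≤ n - 1 := by
      rw [odds, div_le_iff₀ (by linarith)]
      nlinarith
    nlinarith
  refine (Finset.sum_le_card_nsmul _ _ _ hterm).trans ?_
  rw [Nat.card_Icc, nsmul_eq_mul]
  have : ((n + 1 - (m + 1) : ℕ) : ℝ) ≤ n := by exact_mod_cast (by omega)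
  calc _ ≤ (n : ℝ) * n ^ 2 := by gcongr
    _ = _ := by ring

lemma sq_one_add_varSum_mul_le {n m T : ℕ} (hn : 2 ≤ n) {β : ℝ} (hβ : 0 < β)
    (h : (n : ℝ) ^ 8 * β ^ T ≤ 1) : (1 + varSum n m) ^ 2 * β ^ T ≤ 1 := by
  refine le_trans (mul_le_mul_of_nonneg_right ?_ (by positivity)) h
  have h1 := varSum_le n m
  have h2 : (2 : ℝ) ≤ n := by exact_mod_cast hn
  have h3 : 1 + varSum n m ≤ (n : ℝ) ^ 4 := by
    have h4 : (1 : ℝ) ≤ (n : ℝ) ^ 3 := one_le_pow₀ (by linarith)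
    have h5 : (n : ℝ) ^ 4 = n ^ 3 * n := by ring
    rw [h5]
    nlinarith
  have h0 := varSum_nonneg n m
  calc (1 + varSum n m) ^ 2 ≤ ((n : ℝ) ^ 4) ^ 2 := by gcongr
    _ = _ := by ring

lemma odds_ge {n k : ℕ} (hk : 0 < k) (hkn : k ≤ n) : ((n : ℝ) - k) / n ≤ odds n k := by
  have h1 : (k : ℝ) ≤ n := by exact_mod_cast hkn
  have h2 : (0 : ℝ) < k := by exact_mod_cast hk
  exact div_le_div_of_nonneg_left (by linarith) h2 h1

/-- Replacing the denominator `k` by `n` turns the sums into `∑ i / n` and `∑ (i / n) ^ 2` over `i <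
d`, whose closed forms are the left-hand sides. -/
lemma aSum_lower (n d : ℕ) (hd : d ≤ n) :
    (d : ℝ) * (d - 1) / (2 * n) ≤ aSum n (n - d) 1 ∧
      ((d : ℝ) - 1) * d * (2 * d - 1) / (6 * n ^ 2) ≤ aSum n (n - d) 2 := by
  induction d with
  | zero => simp [aSum_nonneg]
  | succ d ih =>
    obtain ⟨h1, h2⟩ := ih (by omega)
    have hn : (0 : ℝ) < n := by exact_mod_cast (by omega : 0 < n)
    have e : n - d = n - (d + 1) + 1 := by omega
    rw [e] at h1 h2
    have ho := odds_ge (n := n) (k := n - (d + 1) + 1) (by omega) (by omega)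
    have ec : (n : ℝ) - ((n - (d + 1) + 1 : ℕ) : ℝ) = d := by
      rw [← e, Nat.cast_sub (by omega)]; ring
    rw [ec] at ho
    rw [aSum_pred (m := n - (d + 1)) (by omega), aSum_pred (m := n - (d + 1)) (by omega), pow_one]
    have ho2 : ((d : ℝ) / n) ^ 2 ≤ odds n (n - (d + 1) + 1) ^ 2 := by gcongr
    refine ⟨le_trans (le_of_eq ?_) (add_le_add h1 ho), le_trans (le_of_eq ?_) (add_le_add h2 ho2)⟩
    · push_cast; field_simp; ring
    · push_cast; field_simp; ring

lemma lower_bounds {n m : ℕ} (hmn : m + 2 ≤ n) :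
    ((n : ℝ) - m) ^ 2 / (4 * n) ≤ varSum n m ∧ ((n : ℝ) - m) ^ 3 / (12 * n ^ 2) ≤ aSum n m 2 := by
  have h := aSum_lower n (n - m) (by omega)
  rw [show n - (n - m) = m by omega, Nat.cast_sub (by omega)] at h
  have hn : (0 : ℝ) < n := by exact_mod_cast (by omega : 0 < n)
  have hd : (2 : ℝ) ≤ n - m := by
    have : ((m + 2 : ℕ) : ℝ) ≤ n := by exact_mod_cast hmn
    push_cast at this; linarith
  set d := (n : ℝ) - m
  constructor
  · refine le_trans ?_ (h.1.trans (by unfold varSum; linarith [aSum_nonneg n m 2]))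
    rw [div_le_div_iff₀ (by positivity) (by positivity)]
    have : d ^ 2 ≤ 2 * (d * (d - 1)) := by nlinarith
    nlinarith
  · refine le_trans ?_ h.2
    rw [div_le_div_iff₀ (by positivity) (by positivity)]
    have h3 : d ^ 3 ≤ 2 * ((d - 1) * d * (2 * d - 1)) := by
      have : d ^ 2 ≤ 2 * ((d - 1) * (2 * d - 1)) := by nlinarith
      nlinarith
    have : (0 : ℝ) ≤ 6 * n ^ 2 := by positivity
    nlinarith

lemma odds_le_half {n m k : ℕ} (hm : n ≤ 2 * m) (hk : k ∈ Finset.Icc (m + 1) n) :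
    odds n k ≤ 2 * ((n : ℝ) - m) / n ∧ odds n k ≤ 1 := by
  obtain ⟨h1, h2⟩ := Finset.mem_Icc.1 hk
  have hk0 : (0 : ℝ) < k := by exact_mod_cast (by omega : 0 < k)
  have hn0 : (0 : ℝ) < n := by exact_mod_cast (by omega : 0 < n)
  have h3 : (n : ℝ) ≤ 2 * k := by exact_mod_cast (by omega : n ≤ 2 * k)
  have h4 : (m : ℝ) ≤ k := by exact_mod_cast (by omega : m ≤ k)
  have h5 : (k : ℝ) ≤ n := by exact_mod_cast h2
  constructor
  · rw [odds, div_le_div_iff₀ hk0 hn0]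
    nlinarith
  · rw [odds, div_le_one hk0]
    linarith

lemma aSum_le_half {n m : ℕ} (hm : n ≤ 2 * m) (hmn : m < n) (r : ℕ) :
    aSum n m r ≤ ((n : ℝ) - m) * (2 * ((n : ℝ) - m) / n) ^ r := by
  rw [aSum_eq]
  refine (Finset.sum_le_card_nsmul _ _ ((2 * ((n : ℝ) - m) / n) ^ r) fun k hk => ?_).trans ?_
  · exact pow_le_pow_left₀ (odds_nonneg hk) (odds_le_half hm hk).1 r
  · rw [Nat.card_Icc, nsmul_eq_mul, show n + 1 - (m + 1) = n - m by omega, Nat.cast_sub hmn.le]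

/-- The common estimates for `m ≥ n / 2`, with `y = (n - m) n^{-2/3}`. -/
lemma half_estimates {n m : ℕ} (hm : n ≤ 2 * m) (hmn : m + 2 ≤ n) {β : ℝ} (hβ : 0 < β)
    (hβ1 : β ≤ 1) (hβn : β ^ 6 * n = 1) :
    0 < varSum n m ∧ 0 < ((n : ℝ) - m) * β ^ 4 ∧
      ((n : ℝ) - m) * β ^ 4 ≤ 2 * (β * √(varSum n m)) ∧
      aSum n m 2 ≤ 4 * (((n : ℝ) - m) * β ^ 4) ^ 3 ∧
      ∀ r, 3 ≤ r → aSum n m r ≤ (2 * (((n : ℝ) - m) * β ^ 4)) ^ r := by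
  have hn : (0 : ℝ) < n := by exact_mod_cast (by omega : 0 < n)
  have hd : (0 : ℝ) < n - m := by
    have : (m : ℝ) < n := by exact_mod_cast (by omega : m < n)
    linarith
  have hl := (lower_bounds hmn).1
  have ha := aSum_le_half hm (by omega : m < n)
  have hdn : (n : ℝ) - m ≤ n := by linarith [Nat.cast_nonneg (α := ℝ) m]
  have einv : (1 : ℝ) / n = β ^ 6 := by field_simp; linarith
  set d := (n : ℝ) - m
  have hv : 0 < varSum n m := lt_of_lt_of_le (by positivity) hl
  have e2 : 2 * d / n = 2 * d * β ^ 6 := by rw [← einv]; ring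
  refine ⟨hv, by positivity, ?_, ?_, fun r hr => ?_⟩
  · refine le_of_sq_le_sq ?_ (by positivity)
    rw [mul_pow 2, mul_pow β, Real.sq_sqrt hv.le]
    have h1 : d ^ 2 / (4 * n) = d ^ 2 * β ^ 6 / 4 := by rw [← einv]; ring
    rw [h1] at hl
    have h2 := mul_le_mul_of_nonneg_left hl (by positivity : (0 : ℝ) ≤ 4 * β ^ 2)
    calc (d * β ^ 4) ^ 2 = 4 * β ^ 2 * (d ^ 2 * β ^ 6 / 4) := by ring
      _ ≤ _ := h2
      _ = _ := by ring
  · refine (ha 2).trans (le_of_eq ?_)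
    rw [e2]; ring
  · refine (ha r).trans ?_
    rw [e2]
    -- The `n - m` terms of the sum cost a factor `d`, which the spare `β ^ (2 r) ≤ β ^ 6`
    -- compensates because `r ≥ 3`.
    calc d * (2 * d * β ^ 6) ^ r = (2 * (d * β ^ 4)) ^ r * (d * (β ^ 2) ^ r) := by
          rw [show 2 * d * β ^ 6 = 2 * (d * β ^ 4) * β ^ 2 by ring, mul_pow _ (β ^ 2)]; ring
      _ ≤ (2 * (d * β ^ 4)) ^ r * 1 := by
          refine mul_le_mul_of_nonneg_left ?_ (by positivity)
          calc d * (β ^ 2) ^ r ≤ n * β ^ 6 := by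
                rw [← pow_mul]
                exact mul_le_mul hdn (pow_le_pow_of_le_one hβ.le hβ1 (by omega)) (by positivity)
                  hn.le
            _ = 1 := by rw [mul_comm]; exact hβn
      _ = _ := mul_one _

lemma two_mul_pow_le {y s c : ℝ} (hy : 0 ≤ y) (hys : y ≤ c * s) {r : ℕ}
    (hr : 1 ≤ r) : 2 * y ^ r ≤ (2 * (c * s)) ^ r := by
  rw [mul_pow]
  have h2 : (2 : ℝ) ≤ 2 ^ r := by
    calc (2 : ℝ) = 2 ^ 1 := (pow_one 2).symm
      _ ≤ 2 ^ r := pow_le_pow_right₀ (by norm_num) hr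
  exact mul_le_mul h2 (pow_le_pow_left₀ hy hys r) (by positivity) (by positivity)

/-- The regime `m ≥ n / 2`, `a_{n,2} > 1`. -/
lemma regime_half_large {n m : ℕ} (hm : n ≤ 2 * m) (hmn : m + 2 ≤ n) (ha : 1 < aSum n m 2) {β : ℝ}
    (hβ : 0 < β) (hβ1 : β ≤ 1) (hβn : β ^ 6 * n = 1) : Regime 64 (1 / 64) β n m := by
  obtain ⟨hv, hy, hys, ha2, har⟩ := half_estimates hm hmn hβ hβ1 hβn
  set y := ((n : ℝ) - m) * β ^ 4
  set s := β * √(varSum n m) with hs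
  have hs0 : 0 ≤ s := by positivity
  have hs64 : 64 * β * √(varSum n m) = 64 * s := by rw [hs]; ring
  -- Since `1 < a₂ ≤ 4 y ^ 3`, the scale `y`, and with it `β σ`, is bounded below; then a fractional
  -- part bounded by `1` is harmless.
  have hy1 : 1 ≤ 2 * y := by
    by_contra hcon
    push Not at hcon
    have : (2 * y) ^ 3 < 1 := pow_lt_one₀ (by positivity) hcon (by norm_num)
    nlinarith
  have hfl : (⌊aSum n m 2⌋ : ℝ) ≤ aSum n m 2 := Int.floor_le _
  refine ⟨hβ, hβ1, hv, ?_, ?_, fun r hr => ?_, Or.inr ⟨1, le_rfl, fun k hk =>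
    (odds_le_half hm hk).2, ?_⟩⟩
  · rw [hs64]
    linarith [fract_le_one' n m]
  · rw [hs64]
    refine (fract_le_one' n m).trans (one_le_pow₀ ?_)
    linarith
  · rw [hs64]
    have h3 : (⌊aSum n m 2⌋ : ℝ) ≤ (2 * y) ^ r := by
      calc (⌊aSum n m 2⌋ : ℝ) ≤ 4 * y ^ 3 := hfl.trans ha2
        _ ≤ (2 * y) ^ 3 := by
          have : 0 ≤ y ^ 3 := by positivity
          nlinarith
        _ ≤ _ := pow_le_pow_right₀ hy1 hr
    have h4 := two_mul_pow_le (y := 2 * y) (s := s) (c := 4) (by positivity) (by linarith)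
      (by omega : 1 ≤ r)
    have h5 : (2 * (4 * s)) ^ r ≤ (64 * s) ^ r :=
      pow_le_pow_left₀ (by positivity) (by linarith) r
    linarith [har r hr]
  · have h1 : β ^ 2 * varSum n m = s ^ 2 := by rw [hs, mul_pow, Real.sq_sqrt hv.le]
    rw [h1]
    nlinarith

lemma floor_eq_zero_of_lt_one {n m : ℕ} (ha : aSum n m 2 < 1) : ⌊aSum n m 2⌋ = 0 :=
  Int.floor_eq_zero_iff.2 ⟨aSum_nonneg n m 2, ha⟩

/-- The size of `n - m` when `a_{n,2} < 1`. -/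
lemma small_of_aSum_lt_one {n m : ℕ} (hmn : m + 2 ≤ n) (ha : aSum n m 2 < 1)
    (hn : 12 * 32 ^ 3 ≤ n) : ((n : ℝ) - m) ^ 3 ≤ 12 * n ^ 2 ∧ (n : ℝ) - m ≤ n / 32 := by
  have h2 := (lower_bounds hmn).2
  have hn0 : (0 : ℝ) < n := by exact_mod_cast (by omega : 0 < n)
  have hn' : (12 * 32 ^ 3 : ℝ) ≤ n := by exact_mod_cast hn
  have h3 : ((n : ℝ) - m) ^ 3 ≤ 12 * n ^ 2 := by
    have := h2.trans ha.le
    rwa [div_le_one (by positivity)] at this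
  refine ⟨h3, ?_⟩
  by_contra hcon
  push Not at hcon
  have h4 : ((n : ℝ) / 32) ^ 3 < ((n : ℝ) - m) ^ 3 := by gcongr
  -- The threshold `12 * 32 ^ 3` for `n` comes from here; the bound `n / 32` makes all odds at most
  -- `1 / 16`.
  have h5 : (12 : ℝ) * n ^ 2 ≤ (n / 32) ^ 3 := by
    rw [div_pow, le_div_iff₀ (by positivity)]
    have : (0 : ℝ) ≤ n ^ 2 := by positivity
    nlinarith
  linarith

/-- The regime `a_{n,2} < 1`. -/
lemma regime_small {n m : ℕ} (hmn : m + 2 ≤ n) (ha : aSum n m 2 < 1) (hn : 12 * 32 ^ 3 ≤ n) {β : ℝ}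
    (hβ : 0 < β) (hβ1 : β ≤ 1) (hβn : β ^ 6 * n = 1) : Regime 64 (1 / 64) β n m := by
  obtain ⟨hd3, hd32⟩ := small_of_aSum_lt_one hmn ha hn
  have hn0 : (0 : ℝ) < n := by exact_mod_cast (by omega : 0 < n)
  have hm : n ≤ 2 * m := by
    have : (n : ℝ) ≤ 2 * m := by linarith
    exact_mod_cast this
  obtain ⟨hv, hy, hys, ha2, har⟩ := half_estimates hm hmn hβ hβ1 hβn
  have hc := floor_eq_zero_of_lt_one ha
  -- Now `y` is bounded above, so the bound `4 y ^ 3` for `a₂` is also linear and quadratic in `y`,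
  -- as the fractional part requires.
  have hy3 : (((n : ℝ) - m) * β ^ 4) ^ 3 ≤ 12 := by
    calc (((n : ℝ) - m) * β ^ 4) ^ 3 = ((n : ℝ) - m) ^ 3 * β ^ 12 := by ring
      _ ≤ 12 * n ^ 2 * β ^ 12 := by gcongr
      _ = 12 * (β ^ 6 * n) ^ 2 := by ring
      _ = 12 := by rw [hβn]; norm_num
  set y := ((n : ℝ) - m) * β ^ 4
  set s := β * √(varSum n m) with hs
  have hs0 : 0 ≤ s := by positivity
  have hs64 : 64 * β * √(varSum n m) = 64 * s := by rw [hs]; ring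
  have hy25 : y ≤ 5 / 2 := by
    by_contra hcon
    push Not at hcon
    have : (5 / 2 : ℝ) ^ 3 < y ^ 3 := by gcongr
    norm_num at this
    linarith
  have ha' : aSum n m 2 ≤ 25 * y := by
    have : y ^ 3 ≤ (5 / 2) ^ 2 * y := by
      rw [pow_succ]; gcongr
    linarith
  refine ⟨hβ, hβ1, hv, ?_, ?_, fun r hr => ?_, Or.inl ⟨hc, fun k hk => ?_⟩⟩
  · rw [hs64, hc, Int.cast_zero]
    linarith
  · rw [hs64, hc, Int.cast_zero, sub_zero]
    have h1 : y ^ 3 ≤ 5 / 2 * y ^ 2 := by nlinarith [sq_nonneg y]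
    have h2 : y ^ 2 ≤ (2 * s) ^ 2 := by gcongr
    nlinarith [sq_nonneg s]
  · rw [hs64, hc, Int.cast_zero, add_zero]
    exact (har r hr).trans (pow_le_pow_left₀ (by positivity) (by linarith) r)
  · refine (odds_le_half hm hk).1.trans ?_
    rw [div_le_iff₀ hn0]
    linarith

/-- All but two of the factors `1 / k` are bounded by `1 / m`, and the sum of `1 / k ^ 2` over `k >
m` is at most `1 / m`. -/
lemma aSum_le_of_pos {n m : ℕ} (hm : 0 < m) (hmn : m ≤ n) {r : ℕ} (hr : 2 ≤ r) :
    aSum n m r ≤ (n : ℝ) ^ r / m ^ (r - 1) := by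
  have hm' : (0 : ℝ) < m := by exact_mod_cast hm
  have hterm : ∀ k ∈ Finset.Icc (m + 1) n, odds n k ^ r ≤
      (n : ℝ) ^ r / m ^ (r - 2) * ((k : ℝ) ^ 2)⁻¹ := by
    intro k hk
    obtain ⟨h1, h2⟩ := Finset.mem_Icc.1 hk
    have hk0 : (0 : ℝ) < k := by exact_mod_cast (by omega : 0 < k)
    have hmk : (m : ℝ) ≤ k := by exact_mod_cast (by omega : m ≤ k)
    have h3 : odds n k ≤ n / k := by
      rw [odds]; gcongr; linarith
    calc odds n k ^ r ≤ ((n : ℝ) / k) ^ r := pow_le_pow_left₀ (odds_nonneg hk) h3 r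
      _ = (n : ℝ) ^ r / k ^ (r - 2) * ((k : ℝ) ^ 2)⁻¹ := by
          rw [div_pow, div_mul_eq_mul_div, ← div_eq_mul_inv, div_div, ← pow_add]
          congr 2; omega
      _ ≤ _ := by gcongr
  rw [aSum_eq]
  refine (Finset.sum_le_sum hterm).trans ?_
  rw [← Finset.mul_sum]
  have h4 : ∑ k ∈ Finset.Icc (m + 1) n, ((k : ℝ) ^ 2)⁻¹ ≤ (m : ℝ)⁻¹ := by
    have h5 := sum_Ioc_inv_sq_le_sub (α := ℝ) hm.ne' hmn
    have h6 : (0 : ℝ) ≤ (n : ℝ)⁻¹ := by positivity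
    have e : Finset.Icc (m + 1) n = Finset.Ioc m n := Finset.Icc_add_one_left_eq_Ioc m n
    rw [e]
    linarith
  calc _ ≤ (n : ℝ) ^ r / m ^ (r - 2) * (m : ℝ)⁻¹ := by gcongr
    _ = _ := by
      rw [← div_eq_mul_inv, div_div, ← pow_succ]
      congr 2; omega

/-- The terms with `m < k ≤ 3 m / 2` suffice: there are at least `m / 3` of them, each at least `n ^
2 / (9 m ^ 2)`. -/
lemma varSum_lower {n m : ℕ} (hm : 2 ≤ m) (hmn : 2 * m ≤ n) :
    (n : ℝ) ^ 2 / (27 * m) ≤ varSum n m := by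
  have hm0 : (0 : ℝ) < m := by exact_mod_cast (by omega : 0 < m)
  have hmn' : 2 * (m : ℝ) ≤ n := by exact_mod_cast hmn
  have e : varSum n m = ∑ k ∈ Finset.Icc (m + 1) n, (odds n k + odds n k ^ 2) := by
    rw [varSum, aSum_eq, aSum_eq, Finset.sum_add_distrib]
    simp
  have hsub : Finset.Icc (m + 1) (m + m / 2) ⊆ Finset.Icc (m + 1) n :=
    Finset.Icc_subset_Icc_right (by omega)
  have hterm : ∀ k ∈ Finset.Icc (m + 1) (m + m / 2),
      (n : ℝ) ^ 2 / (9 * m ^ 2) ≤ odds n k + odds n k ^ 2 := by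
    intro k hk
    obtain ⟨h1, h2⟩ := Finset.mem_Icc.1 hk
    have hk0 : (0 : ℝ) < k := by exact_mod_cast (by omega : 0 < k)
    have hk2 : 2 * (k : ℝ) ≤ 3 * m := by exact_mod_cast (by omega : 2 * k ≤ 3 * m)
    have e1 : odds n k + odds n k ^ 2 = n * ((n : ℝ) - k) / k ^ 2 := by
      rw [odds]; field_simp; ring
    rw [e1, div_le_div_iff₀ (by positivity) (by positivity)]
    have h3 : (n : ℝ) ≤ 4 * (n - k) := by linarith
    have h4 : 4 * (k : ℝ) ^ 2 ≤ 9 * m ^ 2 := by nlinarith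
    have h5 : 0 ≤ (n : ℝ) - k := by linarith
    calc (n : ℝ) ^ 2 * (k : ℝ) ^ 2 = n * n * (k : ℝ) ^ 2 := by ring
      _ ≤ n * (4 * (n - k)) * (k : ℝ) ^ 2 := by gcongr
      _ = n * (n - k) * (4 * (k : ℝ) ^ 2) := by ring
      _ ≤ _ := by gcongr
  rw [e]
  refine le_trans ?_ (Finset.sum_le_sum_of_subset_of_nonneg hsub fun k hk _ =>
    add_nonneg (odds_nonneg hk) (pow_nonneg (odds_nonneg hk) 2))
  refine le_trans ?_ (Finset.card_nsmul_le_sum _ _ _ hterm)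
  rw [Nat.card_Icc, nsmul_eq_mul, show m + m / 2 + 1 - (m + 1) = m / 2 by omega]
  have h6 : (m : ℝ) / 3 ≤ ((m / 2 : ℕ) : ℝ) := by
    have : (m : ℝ) ≤ 3 * ((m / 2 : ℕ) : ℝ) := by exact_mod_cast (by omega : m ≤ 3 * (m / 2))
    linarith
  calc (n : ℝ) ^ 2 / (27 * m) = (m : ℝ) / 3 * ((n : ℝ) ^ 2 / (9 * m ^ 2)) := by field_simp; ring
    _ ≤ _ := by gcongr

/-- The regime `m ≤ n / 2`. -/
lemma regime_wide {n m : ℕ} (hm : 2 ≤ m) (hmn : 2 * m ≤ n) {β : ℝ}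
    (hβ : 0 < β) (hβ1 : β ≤ 1) (hβm : β ^ 6 * m = 1) : Regime 64 (1 / 64) β n m := by
  have hl := varSum_lower hm hmn
  have hm0 : (0 : ℝ) < m := by exact_mod_cast (by omega : 0 < m)
  have hmn' : 2 * (m : ℝ) ≤ n := by exact_mod_cast hmn
  have hn0 : (0 : ℝ) < n := by linarith
  have hv : 0 < varSum n m := lt_of_lt_of_le (by positivity) hl
  have einv : (1 : ℝ) / m = β ^ 6 := by field_simp; linarith
  have hl' : (n : ℝ) ^ 2 * β ^ 6 / 27 ≤ varSum n m := by
    refine le_trans (le_of_eq ?_) hl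
    rw [← einv]; field_simp
  set y := (n : ℝ) * β ^ 4 with hy
  set s := β * √(varSum n m) with hs
  have hs2 : s ^ 2 = β ^ 2 * varSum n m := by rw [hs, mul_pow, Real.sq_sqrt hv.le]
  have hy2 : y ^ 2 / 27 ≤ s ^ 2 := by
    rw [hs2]
    calc y ^ 2 / 27 = β ^ 2 * ((n : ℝ) ^ 2 * β ^ 6 / 27) := by rw [hy]; ring
      _ ≤ _ := by gcongr
  have hs0 : 0 ≤ s := by positivity
  have hs64 : 64 * β * √(varSum n m) = 64 * s := by rw [hs]; ring
  have hys : y ≤ 6 * s := by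
    refine le_of_sq_le_sq ?_ (by positivity)
    nlinarith
  have hnβ : 1 ≤ (n : ℝ) * β ^ 6 := by
    have : (m : ℝ) * β ^ 6 ≤ n * β ^ 6 := by gcongr; linarith
    linarith
  have hy1 : 1 ≤ y := by
    refine hnβ.trans ?_
    rw [hy]
    exact mul_le_mul_of_nonneg_left (pow_le_pow_of_le_one hβ.le hβ1 (by norm_num)) hn0.le
  have har : ∀ r, 2 ≤ r → aSum n m r ≤ (n : ℝ) ^ r * β ^ (6 * (r - 1)) := by
    intro r hr
    refine (aSum_le_of_pos (by omega) (by omega) hr).trans (le_of_eq ?_)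
    rw [pow_mul, ← einv, div_pow, one_pow]
    ring
  refine ⟨hβ, hβ1, hv, ?_, ?_, fun r hr => ?_, Or.inr ⟨n / m, ?_, fun k hk =>
    odds_le_of_le (by omega) hk, ?_⟩⟩
  · rw [hs64]
    linarith [fract_le_one' n m]
  · rw [hs64]
    refine (fract_le_one' n m).trans (one_le_pow₀ ?_)
    linarith
  · rw [hs64]
    have h1 : aSum n m r ≤ y ^ r := by
      refine (har r (by omega)).trans ?_
      rw [hy, mul_pow, ← pow_mul]
      exact mul_le_mul_of_nonneg_left (pow_le_pow_of_le_one hβ.le hβ1 (by omega)) (by positivity)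
    have h2 : (⌊aSum n m 2⌋ : ℝ) ≤ y ^ r := by
      refine (Int.floor_le _).trans ((har 2 le_rfl).trans ?_)
      -- The extra factor is `n / m ≥ 1`; it turns the bound for `a₂` into `y ^ 3`.
      calc (n : ℝ) ^ 2 * β ^ (6 * (2 - 1)) ≤ (n : ℝ) ^ 2 * β ^ (6 * (2 - 1)) * (n * β ^ 6) :=
            le_mul_of_one_le_right (by positivity) hnβ
        _ = y ^ 3 := by rw [hy]; ring
        _ ≤ y ^ r := pow_le_pow_right₀ hy1 hr
    have h4 := two_mul_pow_le (y := y) (s := s) (c := 6) (by positivity) hys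
      (by omega : 1 ≤ r)
    have h5 : (2 * (6 * s)) ^ r ≤ (64 * s) ^ r :=
      pow_le_pow_left₀ (by positivity) (by linarith) r
    linarith
  · rw [le_div_iff₀ hm0]; linarith
  · rw [← hs2]
    refine le_trans ?_ hy2
    have e1 : ((n : ℝ) / m) ^ 2 = n ^ 2 * β ^ 12 := by
      rw [div_eq_mul_one_div, einv]; ring
    have e2 : y ^ 2 = n ^ 2 * β ^ 8 := by rw [hy]; ring
    rw [e1, e2]
    have h1 : β ^ 12 ≤ β ^ 8 := pow_le_pow_of_le_one hβ.le hβ1 (by norm_num)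
    have h2 : (n : ℝ) ^ 2 * β ^ 12 ≤ n ^ 2 * β ^ 8 := by gcongr
    have h3 : 0 ≤ (n : ℝ) ^ 2 * β ^ 8 := by positivity
    linarith

/-! ### The omitted terms in the three ranges -/

lemma sum_Icc_le_mul {f : ℕ → ℝ} {j N : ℕ} {M : ℝ} (hj : 1 ≤ j) (hM : 0 ≤ M)
    (h : ∀ r, j ≤ r → r ≤ N → f r ≤ M) : ∑ r ∈ Finset.Icc j N, f r ≤ N * M := by
  refine (Finset.sum_le_card_nsmul _ _ M fun r hr => h r (Finset.mem_Icc.1 hr).1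
    (Finset.mem_Icc.1 hr).2).trans ?_
  rw [Nat.card_Icc, nsmul_eq_mul]
  have : ((N + 1 - j : ℕ) : ℝ) ≤ N := by exact_mod_cast (by omega)
  gcongr

lemma pow_le_pow_mul_pow {ρ a B : ℝ} (hρ : 0 ≤ ρ) (hρa : ρ ≤ a) (haB : a ≤ B) (hB : 1 ≤ B)
    {j r N : ℕ} (hj : j ≤ r) (hr : r ≤ N) : ρ ^ r ≤ B ^ N * a ^ j := by
  have ha : 0 ≤ a := hρ.trans hρa
  calc ρ ^ r ≤ a ^ r := pow_le_pow_left₀ hρ hρa r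
    _ = a ^ (r - j) * a ^ j := by rw [← pow_add]; congr 1; omega
    _ ≤ B ^ N * a ^ j := by
      refine mul_le_mul_of_nonneg_right ?_ (by positivity)
      exact (pow_le_pow_left₀ ha haB _).trans (pow_le_pow_right₀ hB (by omega))

/-- The size of `1 / σ` for `m ≥ n / 2`. -/
lemma inv_sqrt_varSum_le_half {n m : ℕ} (hmn : m + 2 ≤ n) :
    1 / √(varSum n m) ≤ 2 * (√n / ((n : ℝ) - m)) := by
  have hn : (0 : ℝ) < n := by exact_mod_cast (by omega : 0 < n)
  have hd : (0 : ℝ) < n - m := by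
    have : (m : ℝ) < n := by exact_mod_cast (by omega : m < n)
    linarith
  have hl := (lower_bounds hmn).1
  have hv : 0 < varSum n m := lt_of_lt_of_le (by positivity) hl
  have h1 : ((n : ℝ) - m) / (2 * √n) ≤ √(varSum n m) := by
    refine Real.le_sqrt_of_sq_le (le_trans (le_of_eq ?_) hl)
    rw [div_pow, mul_pow, Real.sq_sqrt hn.le]
    norm_num
  calc 1 / √(varSum n m) ≤ 1 / (((n : ℝ) - m) / (2 * √n)) :=
        one_div_le_one_div_of_le (by positivity) h1
    _ = _ := by field_simp

/-- With `s = √n` and `d = n - m`, `1 / σ` is `O(ε)` for `ε = s / d`, and `a_r`, `⌊a₂⌋` are `O(A)`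
for `A = d ^ 3 / s ^ 4`. As `A ε ^ 3 = 1 / s ≤ ε`, the polynomial `h` has norm `O(ε)`. The omitted
terms are `O(A ε ^ (R + 1))`, which is the claimed bound; `a₂ > 1` gives `4 A ≥ 1`, so the power `ε
^ (R + 1)` of `h` fits below it too. -/
lemma half_large_error {R : ℕ} (hR : 3 ≤ R) (R' : ℕ) : ∃ K : ℝ, 0 < K ∧ ∀ n m : ℕ, n ≤ 2 * m →
    m + 2 ≤ n → 1 < aSum n m 2 →
    wnorm (1 / √(varSum n m)) (hPoly n m R) ^ (R + 1)
      + ∑ r ∈ Finset.Icc (R + 1) R', (aSum n m r + ⌊aSum n m 2⌋) * (1 / √(varSum n m)) ^ r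
      ≤ K * (√(n : ℝ) ^ (R - 3) / ((n : ℝ) - m) ^ (R - 2)) := by
  set N := max R R' with hN
  set B : ℝ := 2 ^ N + 4 with hB
  have hB0 : 0 < B := by positivity
  set G : ℝ := 10 + N * (B * (4 ^ N * 8)) with hG
  refine ⟨4 * G ^ (R + 1) + N * (B * (4 ^ N * 2 ^ (R + 1))), by positivity, fun n m hm hmn ha => ?_⟩
  have hn : (0 : ℝ) < n := by exact_mod_cast (by omega : 0 < n)
  have hd : (0 : ℝ) < n - m := by
    have : (m : ℝ) < n := by exact_mod_cast (by omega : m < n)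
    linarith
  have hdn : (n : ℝ) - m ≤ n := by linarith [Nat.cast_nonneg (α := ℝ) m]
  have hρ := inv_sqrt_varSum_le_half hmn
  have har := aSum_le_half hm (by omega : m < n)
  have hc0 := floor_aSum_nonneg n m 2
  set s := √(n : ℝ) with hs
  have hs2 : (n : ℝ) = s ^ 2 := (Real.sq_sqrt hn.le).symm
  have hs1 : 1 ≤ s := by
    rw [hs, Real.one_le_sqrt]; exact_mod_cast (by omega : 1 ≤ n)
  have hs0 : 0 < s := by linarith
  set d := (n : ℝ) - m
  set ρ := 1 / √(varSum n m)
  have hρ0 : 0 ≤ ρ := by positivity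
  set ε := s / d with hε
  have hε0 : 0 < ε := by positivity
  set A := d ^ 3 / s ^ 4 with hA
  have hA0 : 0 < A := by positivity
  have hcoef : ∀ r, 2 ≤ r → r ≤ N → aSum n m r ≤ 2 ^ r * A := by
    intro r hr _
    have h1 : (d / n) ^ r ≤ (d / n) ^ 2 :=
      pow_le_pow_of_le_one (by positivity) ((div_le_one hn).2 hdn) hr
    calc aSum n m r ≤ d * (2 * d / n) ^ r := har r
      _ = 2 ^ r * (d * (d / n) ^ r) := by rw [mul_div_assoc, mul_pow]; ring
      _ ≤ 2 ^ r * (d * (d / n) ^ 2) := by gcongr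
      _ = _ := by rw [hA, hs2]; field_simp
  have hfl : (⌊aSum n m 2⌋ : ℝ) ≤ 4 * A := by
    have := (Int.floor_le (aSum n m 2)).trans (hcoef 2 le_rfl (by omega))
    norm_num at this; exact this
  have hA4 : 1 ≤ 4 * A := by
    have := ha.le.trans (hcoef 2 le_rfl (by omega))
    norm_num at this; exact this
  have hb : ∀ r, 3 ≤ r → r ≤ N → aSum n m r + ⌊aSum n m 2⌋ ≤ B * A := by
    intro r hr hrN
    have h1 := hcoef r (by omega) hrN
    have h2 : (2 : ℝ) ^ r ≤ 2 ^ N := pow_le_pow_right₀ (by norm_num) hrN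
    have h3 : (2 : ℝ) ^ r * A ≤ 2 ^ N * A := by gcongr
    rw [hB, add_mul]
    linarith
  have hAε : A * ε ^ 3 = 1 / s := by
    rw [hA, hε]; field_simp
  have hε1 : 1 / s ≤ ε := by
    rw [hε, div_le_div_iff₀ hs0 hd]
    nlinarith
  have hε2 : ε ≤ 2 := by
    by_contra hcon
    push Not at hcon
    have h8 : (2 : ℝ) ^ 3 < ε ^ 3 := by gcongr
    have h1 : 1 / s ≤ 1 := by rw [div_le_one hs0]; exact hs1
    nlinarith
  have hterm : ∀ j r, 3 ≤ r → j ≤ r → r ≤ N →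
      (aSum n m r + ⌊aSum n m 2⌋) * ρ ^ r ≤ B * A * (4 ^ N * (2 * ε) ^ j) := by
    intro j r hr hj hrN
    exact mul_le_mul (hb r hr hrN)
      (pow_le_pow_mul_pow hρ0 hρ (by linarith) (by norm_num) hj hrN) (by positivity) (by positivity)
  have hw : wnorm ρ (hPoly n m R) ≤ G * ε := by
    refine (CouponCollector.wnorm_hPoly_le n m R hρ0).trans ?_
    have h0 := fract_nonneg' n m
    have h1 := fract_le_one' n m
    have t1 : (aSum n m 2 - ⌊aSum n m 2⌋) * ρ ≤ 1 * (2 * ε) := by gcongr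
    have t2 : (aSum n m 2 - ⌊aSum n m 2⌋) / 2 * ρ ^ 2 ≤ 1 / 2 * (2 * ε) ^ 2 := by gcongr
    have t3 : ∑ r ∈ Finset.Icc 3 R, (aSum n m r + ⌊aSum n m 2⌋) / 3 * ρ ^ r
        ≤ R * (B * A * (4 ^ N * (2 * ε) ^ 3)) := by
      refine sum_Icc_le_mul (by norm_num) (by positivity) fun r hr hrR => ?_
      refine le_trans ?_ (hterm 3 r hr hr (hrR.trans (le_max_left _ _)))
      refine mul_le_mul_of_nonneg_right ?_ (by positivity)
      have := aSum_nonneg n m r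
      linarith
    have t4 : R * (B * A * (4 ^ N * (2 * ε) ^ 3)) ≤ N * (B * (4 ^ N * 8)) * ε := by
      have hRN : (R : ℝ) ≤ N := by exact_mod_cast le_max_left R R'
      calc R * (B * A * (4 ^ N * (2 * ε) ^ 3)) = R * (B * (4 ^ N * 8)) * (A * ε ^ 3) := by ring
        _ ≤ N * (B * (4 ^ N * 8)) * ε := by
          rw [hAε]
          gcongr
    rw [hG, add_mul]
    nlinarith
  have hE1 : wnorm ρ (hPoly n m R) ^ (R + 1) ≤ 4 * G ^ (R + 1) * (A * ε ^ (R + 1)) := by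
    calc wnorm ρ (hPoly n m R) ^ (R + 1) ≤ (G * ε) ^ (R + 1) :=
          pow_le_pow_left₀ (wnorm_nonneg hρ0 _) hw _
      _ = G ^ (R + 1) * ε ^ (R + 1) * 1 := by rw [mul_pow, mul_one]
      _ ≤ G ^ (R + 1) * ε ^ (R + 1) * (4 * A) := by gcongr
      _ = _ := by ring
  have hE2 : ∑ r ∈ Finset.Icc (R + 1) R', (aSum n m r + ⌊aSum n m 2⌋) * ρ ^ r
      ≤ N * (B * (4 ^ N * 2 ^ (R + 1))) * (A * ε ^ (R + 1)) := by
    refine (sum_Icc_le_mul (M := B * A * (4 ^ N * (2 * ε) ^ (R + 1))) (by omega) (by positivity)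
      fun r hr hrR => hterm (R + 1) r (by omega) hr (hrR.trans (le_max_right _ _))).trans ?_
    have hRN : (R' : ℝ) ≤ N := by exact_mod_cast le_max_right R R'
    calc _ ≤ (N : ℝ) * (B * A * (4 ^ N * (2 * ε) ^ (R + 1))) := by gcongr
      _ = _ := by rw [mul_pow]; ring
  have hfin : A * ε ^ (R + 1) = s ^ (R - 3) / d ^ (R - 2) := by
    rw [hA, hε, div_pow, div_mul_div_comm, div_eq_div_iff (by positivity) (by positivity)]
    have e1 : s ^ (R + 1) = s ^ (R - 3) * s ^ 4 := by rw [← pow_add]; congr 1; omega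
    have e2 : d ^ (R + 1) = d ^ (R - 2) * d ^ 3 := by rw [← pow_add]; congr 1; omega
    rw [e1, e2]; ring
  rw [← hfin, add_mul]
  exact add_le_add hE1 hE2

/-- Here `⌊a₂⌋ = 0`, and `a_r σ ^ (-r)` is `O(d / s ^ r)` with `s = √n`, `d = n - m`. The linear
term `a₂ w` is exceptional: it contributes `d ^ 2 / s ^ 3`, which can be as large as `s ^ (-1/3)`,
and it dictates the length `3 R - 2` of the exponential sum. -/
lemma small_error {R : ℕ} (hR : 3 ≤ R) (R' : ℕ) : ∃ K : ℝ, 0 < K ∧ ∀ n m : ℕ,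
    m + 2 ≤ n → 12 * 32 ^ 3 ≤ n → aSum n m 2 < 1 →
    wnorm (1 / √(varSum n m)) (hPoly n m R) ^ (3 * R - 2 + 1)
      + ∑ r ∈ Finset.Icc (R + 1) R', (aSum n m r + ⌊aSum n m 2⌋) * (1 / √(varSum n m)) ^ r
      ≤ K * (((n : ℝ) - m) / √(n : ℝ) ^ (R + 1)) := by
  set N := max R R' with hN
  set G : ℝ := 16 + N * 4 ^ N with hG
  refine ⟨G ^ (3 * R - 2 + 1) * (12 ^ (2 * R - 1) + 12 ^ (R - 1)) + N * 4 ^ N, by positivity,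
    fun n m hmn hn12 ha => ?_⟩
  obtain ⟨hd3, hd32⟩ := small_of_aSum_lt_one hmn ha hn12
  have hn : (0 : ℝ) < n := by exact_mod_cast (by omega : 0 < n)
  have hm : n ≤ 2 * m := by
    have : (n : ℝ) ≤ 2 * m := by linarith
    exact_mod_cast this
  have hd : (0 : ℝ) < n - m := by
    have : (m : ℝ) < n := by exact_mod_cast (by omega : m < n)
    linarith
  have hdn : (n : ℝ) - m ≤ n := by linarith [Nat.cast_nonneg (α := ℝ) m]
  have hρ := inv_sqrt_varSum_le_half hmn
  have har := aSum_le_half hm (by omega : m < n)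
  have hc := floor_eq_zero_of_lt_one ha
  set s := √(n : ℝ) with hs
  have hs2 : (n : ℝ) = s ^ 2 := (Real.sq_sqrt hn.le).symm
  have hs1 : 1 ≤ s := by
    rw [hs, Real.one_le_sqrt]; exact_mod_cast (by omega : 1 ≤ n)
  have hs0 : 0 < s := by linarith
  set d := (n : ℝ) - m
  rw [hs2] at hd3 hdn
  set ρ := 1 / √(varSum n m)
  have hρ0 : 0 ≤ ρ := by positivity
  have hterm : ∀ r, aSum n m r * ρ ^ r ≤ 4 ^ r * (d / s ^ r) := by
    intro r
    have h1 : aSum n m r ≤ d * (2 * d / s ^ 2) ^ r := by rw [← hs2]; exact har r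
    calc aSum n m r * ρ ^ r ≤ d * (2 * d / s ^ 2) ^ r * (2 * (s / d)) ^ r := by gcongr
      _ = d * (4 / s) ^ r := by
          rw [mul_assoc, ← mul_pow]
          congr 2
          field_simp
          ring
      _ = _ := by rw [div_pow]; ring
  have hterm' : ∀ j r, j ≤ r → r ≤ N → aSum n m r * ρ ^ r ≤ 4 ^ N * (d / s ^ j) := by
    intro j r hj hr
    refine (hterm r).trans ?_
    gcongr
    norm_num
  set M := max (d ^ 2 / s ^ 3) (d / s ^ 2) with hM
  have hM0 : 0 ≤ M := le_max_of_le_right (by positivity)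
  have hM1 : d ^ 2 / s ^ 3 ≤ M := le_max_left _ _
  have hM2 : d / s ^ 2 ≤ M := le_max_right _ _
  have hw : wnorm ρ (hPoly n m R) ≤ G * M := by
    refine (CouponCollector.wnorm_hPoly_le n m R hρ0).trans ?_
    simp only [hc, Int.cast_zero, sub_zero, add_zero]
    have h2 : aSum n m 2 ≤ d * (2 * d / s ^ 2) ^ 2 := by rw [← hs2]; exact har 2
    have t1 : aSum n m 2 * ρ ≤ 8 * M := by
      calc aSum n m 2 * ρ ≤ d * (2 * d / s ^ 2) ^ 2 * (2 * (s / d)) := by gcongr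
        _ = 8 * (d ^ 2 / s ^ 3) := by field_simp; norm_num
        _ ≤ _ := by gcongr
    have t2 : aSum n m 2 / 2 * ρ ^ 2 ≤ 8 * M := by
      calc aSum n m 2 / 2 * ρ ^ 2 = aSum n m 2 * ρ ^ 2 / 2 := by ring
        _ ≤ 4 ^ 2 * (d / s ^ 2) / 2 := div_le_div_of_nonneg_right (hterm 2) (by norm_num)
        _ = 8 * (d / s ^ 2) := by ring
        _ ≤ _ := by gcongr
    have t3 : ∑ r ∈ Finset.Icc 3 R, aSum n m r / 3 * ρ ^ r ≤ R * (4 ^ N * (d / s ^ 2)) := by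
      refine sum_Icc_le_mul (by norm_num) (by positivity) fun r hr hrR => ?_
      refine le_trans ?_ (hterm' 2 r (by omega) (hrR.trans (le_max_left _ _)))
      refine mul_le_mul_of_nonneg_right ?_ (by positivity)
      have := aSum_nonneg n m r
      linarith
    have t4 : R * (4 ^ N * (d / s ^ 2)) ≤ N * 4 ^ N * M := by
      have hRN : (R : ℝ) ≤ N := by exact_mod_cast le_max_left R R'
      rw [← mul_assoc]
      gcongr
    rw [hG, add_mul]
    linarith
  -- From `d ^ 3 ≤ 12 s ^ 4`: the power `d ^ (6 R - 2)` is `d` times `2 R - 1` cubes, and the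
  -- exponent of `s` left is exactly `R + 1`. At the extreme size `d ≈ s ^ (4/3)` no smaller
  -- exponent would do.
  have hp1 : (d ^ 2 / s ^ 3) ^ (3 * R - 2 + 1) ≤ 12 ^ (2 * R - 1) * (d / s ^ (R + 1)) := by
    rw [div_pow, ← pow_mul, ← pow_mul, ← mul_div_assoc,
      div_le_div_iff₀ (by positivity) (by positivity)]
    have e1 : d ^ (2 * (3 * R - 2 + 1)) = d * (d ^ 3) ^ (2 * R - 1) := by
      rw [← pow_mul, ← pow_succ']; congr 1; omega
    have e2 : s ^ (3 * (3 * R - 2 + 1)) = ((s ^ 2) ^ 2) ^ (2 * R - 1) * s ^ (R + 1) := by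
      rw [← pow_mul, ← pow_mul, ← pow_add]; congr 1; omega
    rw [e1, e2]
    calc d * (d ^ 3) ^ (2 * R - 1) * s ^ (R + 1)
        ≤ d * (12 * (s ^ 2) ^ 2) ^ (2 * R - 1) * s ^ (R + 1) := by gcongr
      _ = _ := by rw [mul_pow]; ring
  -- Again by `d ^ 3 ≤ 12 s ^ 4`, with room to spare; one further factor `d` is bounded by `s ^ 2`.
  have hp2 : (d / s ^ 2) ^ (3 * R - 2 + 1) ≤ 12 ^ (R - 1) * (d / s ^ (R + 1)) := by
    rw [div_pow, ← pow_mul, ← mul_div_assoc, div_le_div_iff₀ (by positivity) (by positivity)]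
    have e1 : d ^ (3 * R - 2 + 1) = d * d * (d ^ 3) ^ (R - 1) := by
      rw [← pow_mul, ← sq, ← pow_add]; congr 1; omega
    have e2 : s ^ (2 * (3 * R - 2 + 1)) = ((s ^ 2) ^ 2) ^ (R - 1) * s ^ 2 * s ^ (2 * R) := by
      rw [← pow_mul, ← pow_mul, ← pow_add, ← pow_add]; congr 1; omega
    rw [e1, e2]
    calc d * d * (d ^ 3) ^ (R - 1) * s ^ (R + 1)
        ≤ d * s ^ 2 * (12 * (s ^ 2) ^ 2) ^ (R - 1) * s ^ (2 * R) := by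
          gcongr
          omega
      _ = _ := by rw [mul_pow]; ring
  have hE1 : wnorm ρ (hPoly n m R) ^ (3 * R - 2 + 1)
      ≤ G ^ (3 * R - 2 + 1) * (12 ^ (2 * R - 1) + 12 ^ (R - 1)) * (d / s ^ (R + 1)) := by
    have hG0 : 0 ≤ G := by positivity
    calc wnorm ρ (hPoly n m R) ^ (3 * R - 2 + 1) ≤ (G * M) ^ (3 * R - 2 + 1) :=
          pow_le_pow_left₀ (wnorm_nonneg hρ0 _) hw _
      _ = G ^ (3 * R - 2 + 1) * M ^ (3 * R - 2 + 1) := mul_pow _ _ _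
      _ ≤ G ^ (3 * R - 2 + 1) * ((12 ^ (2 * R - 1) + 12 ^ (R - 1)) * (d / s ^ (R + 1))) := by
          refine mul_le_mul_of_nonneg_left ?_ (by positivity)
          have n1 : 0 ≤ 12 ^ (2 * R - 1) * (d / s ^ (R + 1)) := by positivity
          have n2 : 0 ≤ 12 ^ (R - 1) * (d / s ^ (R + 1)) := by positivity
          rw [add_mul]
          rcases max_choice (d ^ 2 / s ^ 3) (d / s ^ 2) with h | h
          · rw [hM, h]; linarith
          · rw [hM, h]; linarith
      _ = _ := by ring
  have hE2 : ∑ r ∈ Finset.Icc (R + 1) R', (aSum n m r + ⌊aSum n m 2⌋) * ρ ^ r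
      ≤ N * 4 ^ N * (d / s ^ (R + 1)) := by
    simp only [hc, Int.cast_zero, add_zero]
    refine (sum_Icc_le_mul (M := 4 ^ N * (d / s ^ (R + 1))) (by omega) (by positivity)
      fun r hr hrR => hterm' (R + 1) r hr (hrR.trans (le_max_right _ _))).trans ?_
    have hRN : (R' : ℝ) ≤ N := by exact_mod_cast le_max_right R R'
    rw [← mul_assoc]
    gcongr
  rw [add_mul]
  exact add_le_add hE1 hE2

/-- The size of `1 / σ` for `m ≤ n / 2`. -/
lemma sqrt_varSum_ge {n m : ℕ} (hm : 2 ≤ m) (hmn : 2 * m ≤ n) :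
    (n : ℝ) / (6 * √m) ≤ √(varSum n m) := by
  have hm0 : (0 : ℝ) < m := by exact_mod_cast (by omega : 0 < m)
  refine Real.le_sqrt_of_sq_le (le_trans ?_ (varSum_lower hm hmn))
  rw [div_pow, mul_pow, Real.sq_sqrt hm0.le]
  gcongr
  norm_num

/-- With `t = √m`, `1 / σ` is `O(t / n)`, so `a_r σ ^ (-r)` and `⌊a₂⌋ σ ^ (-r)` are `O(t ^ (-(r -
2)))`. Hence `h` has norm `O(1 / t)`, and the first omitted term has size `t ^ (-(R - 1)) = t * t ^
(-R)`. The separate bound for `h` serves the case where `n` is huge compared with `m`. -/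
lemma wide_error {R : ℕ} (hR : 3 ≤ R) (R' : ℕ) : ∃ K : ℝ, 0 < K ∧ ∀ n m : ℕ, 2 ≤ m → 2 * m ≤ n →
    wnorm (1 / √(varSum n m)) (hPoly n m R) ≤ K ∧
    wnorm (1 / √(varSum n m)) (hPoly n m R) ^ (R + 1)
      + ∑ r ∈ Finset.Icc (R + 1) R', (aSum n m r + ⌊aSum n m 2⌋) * (1 / √(varSum n m)) ^ r
      ≤ K * (√(m : ℝ) * (1 / √(m : ℝ)) ^ R) := by
  set N := max R R' with hN
  set G : ℝ := 24 + N * (2 * 6 ^ N) with hG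
  have hG0 : 0 < G := by positivity
  refine ⟨G + G ^ (R + 1) + N * (2 * 6 ^ N), by positivity, fun n m hm hmn => ?_⟩
  have hm0 : (0 : ℝ) < m := by exact_mod_cast (by omega : 0 < m)
  have hmn' : 2 * (m : ℝ) ≤ n := by exact_mod_cast hmn
  have hσ := sqrt_varSum_ge hm hmn
  have ha := fun r => aSum_le_of_pos (n := n) (m := m) (r := r) (by omega) (by omega)
  have hfl : (⌊aSum n m 2⌋ : ℝ) ≤ aSum n m 2 := Int.floor_le _
  have hc0 := floor_aSum_nonneg n m 2
  have hn0 : (0 : ℝ) < n := by linarith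
  set t := √(m : ℝ) with ht
  have ht2 : (m : ℝ) = t ^ 2 := (Real.sq_sqrt hm0.le).symm
  have ht1 : 1 ≤ t := by
    rw [ht, Real.one_le_sqrt]; exact_mod_cast (by omega : 1 ≤ m)
  have ht0 : 0 < t := by linarith
  set ρ := 1 / √(varSum n m) with hρdef
  have hρ0 : 0 ≤ ρ := by positivity
  have hρ : ρ ≤ 6 * t / n := by
    calc ρ ≤ 1 / ((n : ℝ) / (6 * t)) := one_div_le_one_div_of_le (by positivity) hσ
      _ = _ := by field_simp
  have htn : t / n ≤ 1 / t := by
    rw [div_le_div_iff₀ hn0 ht0]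
    nlinarith
  have hterm : ∀ r, 2 ≤ r → (aSum n m r + ⌊aSum n m 2⌋) * ρ ^ r ≤ 2 * 6 ^ r * (1 / t) ^ (r - 2) := by
    intro r hr
    have h1 : aSum n m r * ρ ^ r ≤ 6 ^ r * (1 / t) ^ (r - 2) := by
      calc aSum n m r * ρ ^ r ≤ (n : ℝ) ^ r / (t ^ 2) ^ (r - 1) * (6 * t / n) ^ r := by
            rw [← ht2]
            exact mul_le_mul (ha r hr) (pow_le_pow_left₀ hρ0 hρ r) (by positivity) (by positivity)
        _ = 6 ^ r * (t ^ r / (t ^ 2) ^ (r - 1)) := by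
            rw [div_pow, mul_pow]; field_simp
        _ = _ := by
            congr 1
            rw [one_div, inv_pow, ← one_div, ← pow_mul, div_eq_div_iff (by positivity) (by positivity),
              one_mul, ← pow_add]
            congr 1; omega
    have h2 : (⌊aSum n m 2⌋ : ℝ) * ρ ^ r ≤ 6 ^ r * (1 / t) ^ (r - 2) := by
      calc (⌊aSum n m 2⌋ : ℝ) * ρ ^ r ≤ (n : ℝ) ^ 2 / t ^ 2 * (6 * t / n) ^ r := by
            have h3 := hfl.trans (ha 2 le_rfl)
            norm_num at h3
            rw [← ht2]
            exact mul_le_mul h3 (pow_le_pow_left₀ hρ0 hρ r) (by positivity) (by positivity)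
        _ = 6 ^ r * (t / n) ^ (r - 2) := by
            have e : (6 * t / n) ^ r = 6 ^ r * ((t / n) ^ (r - 2) * (t / n) ^ 2) := by
              rw [← pow_add, show r - 2 + 2 = r by omega, ← mul_pow, mul_div_assoc]
            rw [e]; field_simp
        _ ≤ _ := by gcongr
    linarith
  have hterm' : ∀ j r, 2 ≤ r → j ≤ r - 2 → r ≤ N →
      (aSum n m r + ⌊aSum n m 2⌋) * ρ ^ r ≤ 2 * 6 ^ N * (1 / t) ^ j := by
    intro j r hr hj hrN
    refine (hterm r hr).trans ?_
    have h1 : (1 / t) ^ (r - 2) ≤ (1 / t) ^ j :=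
      pow_le_pow_of_le_one (by positivity) ((div_le_one ht0).2 ht1) hj
    have h2 : (6 : ℝ) ^ r ≤ 6 ^ N := pow_le_pow_right₀ (by norm_num) hrN
    gcongr
  have h1t : 1 / t ≤ 1 := (div_le_one ht0).2 ht1
  have hρ6 : ρ ≤ 6 * (1 / t) := by
    refine hρ.trans ?_
    rw [mul_div_assoc]; gcongr
  have hw : wnorm ρ (hPoly n m R) ≤ G * (1 / t) := by
    refine (CouponCollector.wnorm_hPoly_le n m R hρ0).trans ?_
    have h0 := fract_nonneg' n m
    have h1 := fract_le_one' n m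
    have t1 : (aSum n m 2 - ⌊aSum n m 2⌋) * ρ ≤ 1 * (6 * (1 / t)) := by gcongr
    have t2 : (aSum n m 2 - ⌊aSum n m 2⌋) / 2 * ρ ^ 2 ≤ 1 / 2 * (6 * (1 / t)) ^ 2 := by gcongr
    have t3 : ∑ r ∈ Finset.Icc 3 R, (aSum n m r + ⌊aSum n m 2⌋) / 3 * ρ ^ r
        ≤ R * (2 * 6 ^ N * (1 / t) ^ 1) := by
      refine sum_Icc_le_mul (by norm_num) (by positivity) fun r hr hrR => ?_
      refine le_trans ?_ (hterm' 1 r (by omega) (by omega) (hrR.trans (le_max_left _ _)))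
      refine mul_le_mul_of_nonneg_right ?_ (by positivity)
      have := aSum_nonneg n m r
      linarith
    have t4 : R * (2 * 6 ^ N * (1 / t) ^ 1) ≤ N * (2 * 6 ^ N) * (1 / t) := by
      have hRN : (R : ℝ) ≤ N := by exact_mod_cast le_max_left R R'
      rw [pow_one, ← mul_assoc]
      gcongr
    have t5 : (6 * (1 / t)) ^ 2 ≤ 36 * (1 / t) := by
      have : 0 ≤ 1 / t := by positivity
      nlinarith
    rw [hG, add_mul]
    linarith
  have hpos : 0 ≤ G ^ (R + 1) + N * (2 * 6 ^ N) := by positivity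
  refine ⟨?_, ?_⟩
  · have := hw.trans (mul_le_mul_of_nonneg_left h1t hG0.le)
    linarith
  have hfin : (1 / t) ^ R ≤ t * (1 / t) ^ R := le_mul_of_one_le_left (by positivity) ht1
  have hE1 : wnorm ρ (hPoly n m R) ^ (R + 1) ≤ (G + G ^ (R + 1)) * (t * (1 / t) ^ R) := by
    calc wnorm ρ (hPoly n m R) ^ (R + 1) ≤ (G * (1 / t)) ^ (R + 1) :=
          pow_le_pow_left₀ (wnorm_nonneg hρ0 _) hw _
      _ = G ^ (R + 1) * (1 / t) ^ (R + 1) := mul_pow _ _ _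
      _ ≤ (G + G ^ (R + 1)) * (t * (1 / t) ^ R) := by
          refine mul_le_mul (by linarith) (le_trans ?_ hfin) (by positivity) (by positivity)
          exact pow_le_pow_of_le_one (by positivity) h1t (by omega)
  have hE2 : ∑ r ∈ Finset.Icc (R + 1) R', (aSum n m r + ⌊aSum n m 2⌋) * ρ ^ r
      ≤ N * (2 * 6 ^ N) * (t * (1 / t) ^ R) := by
    have e : t * (1 / t) ^ R = (1 / t) ^ (R - 1) := by
      obtain ⟨k, rfl⟩ : ∃ k, R = k + 1 := ⟨R - 1, by omega⟩
      rw [pow_succ, Nat.add_sub_cancel]; field_simp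
    rw [e]
    refine (sum_Icc_le_mul (M := 2 * 6 ^ N * (1 / t) ^ (R - 1)) (by omega) (by positivity)
      fun r hr hrR => hterm' (R - 1) r (by omega) (by omega) (hrR.trans (le_max_right _ _))).trans ?_
    have hRN : (R' : ℝ) ≤ N := by exact_mod_cast le_max_right R R'
    rw [← mul_assoc]
    gcongr
  rw [add_mul]
  exact add_le_add hE1 hE2

/-! ### The bounds for each range -/

/-- Source of the exponent `T = 48 k` below: `(1 + σ²) ^ 2 ≤ n ^ 8`, and `n ≤ b ^ k = β ^ (-6 k)`.
-/
lemma pow_eight_mul_le {n b β : ℝ} (hn : 0 ≤ n) (hβ : 0 < β) (hb : β ^ 6 * b = 1) {k : ℕ}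
    (h : n ≤ b ^ k) : n ^ 8 * β ^ (48 * k) ≤ 1 := by
  calc n ^ 8 * β ^ (48 * k) ≤ (b ^ k) ^ 8 * β ^ (48 * k) := by gcongr
    _ = (β ^ 6 * b) ^ (8 * k) := by rw [mul_pow, ← pow_mul, ← pow_mul]; ring_nf
    _ = 1 := by rw [hb, one_pow]

lemma half_large_bound {R : ℕ} (hR : 3 ≤ R) : ∃ K : ℝ, 0 < K ∧ ∀ n m : ℕ, n ≤ 2 * m →
    m + 2 ≤ n → 1 < aSum n m 2 → ∀ q, IsCollectorLaw n m q →
    (Summable fun j => |q j - pcMass (varSum n m) (HPoly n m R R) j|) ∧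
    ∑' j, |q j - pcMass (varSum n m) (HPoly n m R R) j|
      ≤ K * (√(n : ℝ) ^ (R - 3) / ((n : ℝ) - m) ^ (R - 2)) := by
  obtain ⟨R', K, hK, hmain⟩ := Regime.tsum_abs_sub_pcMass_le (C₀ := 64) (κ := 1 / 64)
    (by norm_num) (by norm_num) hR R 48 (6 * R)
  obtain ⟨K', hK', herr⟩ := half_large_error hR R'
  refine ⟨K * (1 + K'), by positivity, fun n m hm hmn ha q hq => ?_⟩
  have hn1 : (1 : ℝ) ≤ n := by exact_mod_cast (by omega : 1 ≤ n)
  obtain ⟨β, hβ, hβ1, hβn⟩ := exists_sixth_root hn1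
  have hT := pow_eight_mul_le (by linarith) hβ hβn (k := 1) (pow_one (n : ℝ)).ge
  obtain ⟨h1, h2⟩ := hmain β n m (regime_half_large hm hmn ha hβ hβ1 hβn)
    (sq_one_add_varSum_mul_le (by omega) hβ hT) q hq
  refine ⟨h1, h2.trans ?_⟩
  rw [mul_assoc, add_assoc]
  refine mul_le_mul_of_nonneg_left ?_ hK.le
  rw [add_mul, one_mul]
  refine add_le_add ?_ (herr n m hm hmn ha)
  have hd : (0 : ℝ) < n - m := by
    have : (m : ℝ) < n := by exact_mod_cast (by omega : m < n)
    linarith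
  have hdn : (n : ℝ) - m ≤ n := by linarith [Nat.cast_nonneg (α := ℝ) m]
  have hs2 : (n : ℝ) = √(n : ℝ) ^ 2 := (Real.sq_sqrt (by linarith)).symm
  have hs1 : 1 ≤ √(n : ℝ) := Real.one_le_sqrt.2 hn1
  -- The choice `S = 6 * R` makes the Fourier error `n ^ (-R)`, below the claimed bound.
  have e : β ^ (6 * R) = 1 / (n : ℝ) ^ R := by
    rw [eq_div_iff (by positivity), pow_mul, ← mul_pow, hβn, one_pow]
  rw [e, div_le_div_iff₀ (by positivity) (by positivity), one_mul]
  calc ((n : ℝ) - m) ^ (R - 2) ≤ (n : ℝ) ^ (R - 2) := pow_le_pow_left₀ hd.le hdn _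
    _ ≤ (n : ℝ) ^ R := pow_le_pow_right₀ hn1 (by omega)
    _ ≤ _ := le_mul_of_one_le_left (by positivity) (one_le_pow₀ hs1)

lemma small_bound {R : ℕ} (hR : 3 ≤ R) : ∃ K : ℝ, 0 < K ∧ ∀ n m : ℕ, m + 2 ≤ n →
    12 * 32 ^ 3 ≤ n → aSum n m 2 < 1 → ∀ q, IsCollectorLaw n m q →
    (Summable fun j => |q j - pcMass (varSum n m) (HPoly n m R (3 * R - 2)) j|) ∧
    ∑' j, |q j - pcMass (varSum n m) (HPoly n m R (3 * R - 2)) j|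
      ≤ K * (((n : ℝ) - m) / √(n : ℝ) ^ (R + 1)) := by
  obtain ⟨R', K, hK, hmain⟩ := Regime.tsum_abs_sub_pcMass_le (C₀ := 64) (κ := 1 / 64)
    (by norm_num) (by norm_num) hR (3 * R - 2) 48 (6 * R)
  obtain ⟨K', hK', herr⟩ := small_error hR R'
  refine ⟨K * (1 + K'), by positivity, fun n m hmn hn ha q hq => ?_⟩
  have hn1 : (1 : ℝ) ≤ n := by exact_mod_cast (by omega : 1 ≤ n)
  obtain ⟨β, hβ, hβ1, hβn⟩ := exists_sixth_root hn1
  have hT := pow_eight_mul_le (by linarith) hβ hβn (k := 1) (pow_one (n : ℝ)).ge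
  obtain ⟨h1, h2⟩ := hmain β n m (regime_small hmn ha hn hβ hβ1 hβn)
    (sq_one_add_varSum_mul_le (by omega) hβ hT) q hq
  refine ⟨h1, h2.trans ?_⟩
  rw [mul_assoc, add_assoc]
  refine mul_le_mul_of_nonneg_left ?_ hK.le
  rw [add_mul, one_mul]
  refine add_le_add ?_ (herr n m hmn hn ha)
  have hd : (1 : ℝ) ≤ n - m := by
    have : ((m + 1 : ℕ) : ℝ) ≤ n := by exact_mod_cast (by omega : m + 1 ≤ n)
    push_cast at this
    linarith
  have hs2 : (n : ℝ) = √(n : ℝ) ^ 2 := (Real.sq_sqrt (by linarith)).symm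
  have hs1 : 1 ≤ √(n : ℝ) := Real.one_le_sqrt.2 hn1
  have e : β ^ (6 * R) = 1 / √(n : ℝ) ^ (2 * R) := by
    rw [eq_div_iff (by positivity), pow_mul, pow_mul, ← hs2, ← mul_pow, hβn, one_pow]
  rw [e]
  exact div_le_div₀ (by linarith) hd (by positivity) (pow_le_pow_right₀ hs1 (by omega))

lemma wnorm_HPoly_le_pow {n m R L : ℕ} {ρ K : ℝ} (hρ : 0 ≤ ρ) (hK : 1 ≤ K)
    (h : wnorm ρ (hPoly n m R) ≤ K) : wnorm ρ (HPoly n m R L) ≤ (L + 1) * K ^ L := by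
  refine (wnorm_HPoly_le n m R L hρ).trans ?_
  have := Finset.sum_le_card_nsmul (Finset.range (L + 1)) (fun l => wnorm ρ (hPoly n m R) ^ l)
    (K ^ L) fun l hl => (pow_le_pow_left₀ (wnorm_nonneg hρ _) h l).trans
      (pow_le_pow_right₀ hK (Nat.lt_succ_iff.1 (Finset.mem_range.1 hl)))
  simpa using this

/-- The small parameter is a power of `m`, so the expansion applies only while `n` is at most a
fixed power of `m`. Beyond `m ^ (R + 1)` the factor `σ` makes the right-hand side at least a
constant, and it is enough that both measures have bounded total variation. -/
lemma wide_bound {R : ℕ} (hR : 3 ≤ R) : ∃ K : ℝ, 0 < K ∧ ∀ n m : ℕ, 36 ≤ m → 2 * m ≤ n →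
    ∀ q, IsCollectorLaw n m q →
    (Summable fun j => |q j - pcMass (varSum n m) (HPoly n m R R) j|) ∧
    ∑' j, |q j - pcMass (varSum n m) (HPoly n m R R) j|
      ≤ K * (√(varSum n m) * (1 / √(m : ℝ)) ^ R) := by
  obtain ⟨R', K, hK, hmain⟩ := Regime.tsum_abs_sub_pcMass_le (C₀ := 64) (κ := 1 / 64)
    (by norm_num) (by norm_num) hR R (48 * (R + 1)) (6 * R)
  obtain ⟨K', hK', herr⟩ := wide_error hR R'
  set M : ℝ := 1 + √((R * R).factorial : ℝ) * ((R + 1) * (max 1 K') ^ R) with hM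
  have hM0 : 0 < M := by positivity
  refine ⟨3 * (K * (1 + K')) + 6 * M, by positivity, fun n m hm hmn q hq => ?_⟩
  obtain ⟨hw, herr⟩ := herr n m (by omega) hmn
  have hσ := sqrt_varSum_ge (n := n) (m := m) (by omega) hmn
  have hm1 : (1 : ℝ) ≤ m := by exact_mod_cast (by omega : 1 ≤ m)
  have hmn' : 2 * (m : ℝ) ≤ n := by exact_mod_cast hmn
  have ht2 : (m : ℝ) = √(m : ℝ) ^ 2 := (Real.sq_sqrt (by linarith)).symm
  have ht1 : 1 ≤ √(m : ℝ) := Real.one_le_sqrt.2 hm1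
  have hn0 : (0 : ℝ) < n := by linarith
  have hv : 0 < varSum n m := lt_of_lt_of_le (by positivity) (varSum_lower (by omega) hmn)
  set t := √(m : ℝ) with ht
  have ht0 : 0 < t := by linarith
  by_cases hcase : (n : ℝ) ≤ (m : ℝ) ^ (R + 1)
  · obtain ⟨β, hβ, hβ1, hβm⟩ := exists_sixth_root hm1
    have hT := pow_eight_mul_le (by linarith) hβ hβm hcase
    obtain ⟨h1, h2⟩ := hmain β n m (regime_wide (by omega) hmn hβ hβ1 hβm)
      (sq_one_add_varSum_mul_le (by omega) hβ hT) q hq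
    refine ⟨h1, h2.trans ?_⟩
    have e : β ^ (6 * R) ≤ t * (1 / t) ^ R := by
      have e1 : β ^ (6 * R) = (1 / t) ^ (2 * R) := by
        rw [one_div, inv_pow, ← one_div, eq_div_iff (by positivity), pow_mul, pow_mul, ← ht2,
          ← mul_pow, hβm, one_pow]
      rw [e1]
      refine (pow_le_pow_of_le_one (by positivity) ((div_le_one ht0).2 ht1)
        (by omega : R ≤ 2 * R)).trans ?_
      exact le_mul_of_one_le_left (by positivity) ht1
    have hσt : t ≤ 3 * √(varSum n m) := by
      have : t / 3 ≤ n / (6 * t) := by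
        rw [div_le_div_iff₀ (by norm_num) (by positivity)]
        nlinarith
      linarith
    calc _ ≤ K * (β ^ (6 * R) + K' * (t * (1 / t) ^ R)) := by
          rw [add_assoc]
          gcongr
      _ ≤ K * ((1 + K') * (t * (1 / t) ^ R)) := by
          rw [add_mul, one_mul]
          gcongr
      _ ≤ K * ((1 + K') * (3 * √(varSum n m) * (1 / t) ^ R)) := by gcongr
      _ = 3 * (K * (1 + K')) * (√(varSum n m) * (1 / t) ^ R) := by ring
      _ ≤ _ := by
          gcongr
          linarith
  · have hp := tsum_abs_pcMass_le hv (natDegree_HPoly_le n m hR R)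
    have hq1 := hq.hasSum_one
    have habs : ∀ j, |q j| = q j := fun j => abs_of_nonneg (hq.nonneg j)
    have hdom : ∀ j, |q j - pcMass (varSum n m) (HPoly n m R R) j|
        ≤ q j + |pcMass (varSum n m) (HPoly n m R R) j| := fun j =>
      (abs_sub _ _).trans_eq (by rw [habs])
    have hs := Summable.of_nonneg_of_le (fun _ => abs_nonneg _) hdom (hq1.summable.add hp.1)
    refine ⟨hs, ?_⟩
    have hle : ∑' j, |q j - pcMass (varSum n m) (HPoly n m R R) j| ≤ M := by
      refine (hs.tsum_le_tsum hdom (hq1.summable.add hp.1)).trans ?_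
      rw [hq1.summable.tsum_add hp.1, hq1.tsum_eq, hM]
      refine add_le_add le_rfl (hp.2.trans ?_)
      refine mul_le_mul_of_nonneg_left ?_ (by positivity)
      exact wnorm_HPoly_le_pow (by positivity) (le_max_left _ _) (hw.trans (le_max_right _ _))
    have hone : 1 ≤ 6 * (√(varSum n m) * (1 / t) ^ R) := by
      have h1 : t ^ (R + 1) ≤ n := by
        refine le_trans ?_ (not_le.1 hcase).le
        rw [ht2, ← pow_mul]
        exact pow_le_pow_right₀ ht1 (by omega)
      calc (1 : ℝ) ≤ n / t ^ (R + 1) := (one_le_div (by positivity)).2 h1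
        _ = 6 * (n / (6 * t) * (1 / t) ^ R) := by
            rw [one_div, inv_pow, pow_succ]
            field_simp
        _ ≤ _ := by gcongr
    calc _ ≤ M * 1 := by rw [mul_one]; exact hle
      _ ≤ M * (6 * (√(varSum n m) * (1 / t) ^ R)) := by gcongr
      _ = 6 * M * (√(varSum n m) * (1 / t) ^ R) := by ring
      _ ≤ _ := by
        gcongr
        have : 0 < 3 * (K * (1 + K')) := by positivity
        linarith

/-- Here `σ ≥ n / (6 √m) ≥ √m / 3 ≥ 2`, which is why `m ≥ 36` is required; the logarithm is then
bounded below and inserting it costs only a factor `2`. -/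
lemma half_le_log_sqrt_varSum {n m : ℕ} (hm : 36 ≤ m) (hmn : 2 * m ≤ n) :
    1 / 2 ≤ Real.log √(varSum n m) := by
  have hσ := sqrt_varSum_ge (n := n) (m := m) (by omega) hmn
  have hm0 : (36 : ℝ) ≤ m := by exact_mod_cast hm
  have hmn' : 2 * (m : ℝ) ≤ n := by exact_mod_cast hmn
  have ht2 : (m : ℝ) = √(m : ℝ) ^ 2 := (Real.sq_sqrt (by linarith)).symm
  have ht : 6 ≤ √(m : ℝ) := Real.le_sqrt_of_sq_le (by linarith)
  have h2 : 2 ≤ √(varSum n m) := by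
    refine le_trans ?_ hσ
    rw [le_div_iff₀ (by positivity)]
    nlinarith
  have := Real.log_le_log (by norm_num) h2
  linarith [Real.log_two_gt_d9]

/-! ### The degenerate case of a single coupon, and the conclusion -/

lemma aSum_self_pred {m j : ℕ} (hj : 1 ≤ j) : aSum (m + 1) m j = 0 := by
  have hj' : j ≠ 0 := by omega
  simp [aSum, hj']

lemma HPoly_self_pred (m R L : ℕ) : HPoly (m + 1) m R L = 1 := by
  have h : hPoly (m + 1) m R = 0 := by
    rw [hPoly, aSum_self_pred (by norm_num), Finset.sum_eq_zero]
    · simp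
    · intro r hr
      rw [aSum_self_pred (by have := (Finset.mem_Icc.1 hr).1; omega)]
      simp
  rw [HPoly, h, Finset.sum_eq_single 0]
  · simp
  · intro l _ hl
    simp [hl]
  · simp

lemma varSum_self_pred (m : ℕ) : varSum (m + 1) m = 0 := by
  rw [varSum, aSum_self_pred le_rfl, aSum_self_pred (by norm_num), add_zero]

lemma pcMass_zero_one (j : ℕ) : pcMass 0 1 j = if j = 0 then 1 else 0 := by
  by_cases hj : j = 0
  · subst hj; simp [pcMass, charlier]
  · simp [pcMass, hj]

lemma collectorLaw_self_pred {Ω : Type*} [MeasurableSpace Ω] {P : Measure Ω}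
    [IsProbabilityMeasure P] {m : ℕ} (X : ℕ → Ω → Fin (m + 1)) (j : ℕ) :
    collectorLaw P X m j = if j = 0 then 1 else 0 := by
  have hc : ⌊aSum (m + 1) m 2⌋.toNat = 0 := by rw [aSum_self_pred (by norm_num)]; simp
  have := collectorLaw_add P X m j
  rwa [hc, add_zero, show m + 1 - m - 1 = 0 by omega, passageProb_zero X m.succ_pos] at this

end
end CouponCollector

open CouponCollector in
theorem corollary7p3 (R : ℕ) (hR : 3 ≤ R) :
    (∃ (mR nR : ℕ) (K : ℝ), 0 < K ∧
      ∀ (n m : ℕ), nR ≤ n → mR ≤ m → m < n → 1 < aSum n m 2 →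
        ∀ (Ω : Type*) [MeasurableSpace Ω] (P : Measure Ω) [IsProbabilityMeasure P]
          (X : ℕ → Ω → Fin n), IsSampling P X →
          ((m : ℝ) ≤ (n : ℝ) / 2 - 1 →
            dTV (law P X m) (pcMeasure (timeVar P X m) (HPoly n m R R)) ≤
              K * (√(timeVar P X m) * Real.log √(timeVar P X m) * (1 / √(m : ℝ)) ^ R)) ∧
          ((n : ℝ) / 2 ≤ (m : ℝ) →
            dTV (law P X m) (pcMeasure (timeVar P X m) (HPoly n m R R)) ≤
              K * (√(n : ℝ) ^ (R - 3) / ((n : ℝ) - (m : ℝ)) ^ (R - 2)))) ∧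
    (∃ (nR : ℕ) (K : ℝ), 0 < K ∧
      ∀ (n m : ℕ), nR ≤ n → m < n → aSum n m 2 < 1 →
        ∀ (Ω : Type*) [MeasurableSpace Ω] (P : Measure Ω) [IsProbabilityMeasure P]
          (X : ℕ → Ω → Fin n), IsSampling P X →
          dTV (law P X m) (pcMeasure (timeVar P X m) (HPoly n m R (3 * R - 2))) ≤
            K * (((n : ℝ) - (m : ℝ)) / √(n : ℝ) ^ (R + 1))) := by
  obtain ⟨K₁, hK₁, h₁⟩ := half_large_bound hR
  obtain ⟨K₂, hK₂, h₂⟩ := wide_bound hR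
  obtain ⟨K₃, hK₃, h₃⟩ := small_bound hR
  -- The factor `2` on `K₂` pays for the logarithm, which is at least `1 / 2` once `m ≥ 36`.
  refine ⟨⟨36, 2, K₁ + 2 * K₂, by positivity, ?_⟩, ⟨12 * 32 ^ 3, K₃, hK₃, ?_⟩⟩
  · intro n m hn hm hmn ha Ω _ P _ X h
    rw [h.timeVar_eq hmn]
    have hq := h.isCollectorLaw hmn
    refine ⟨fun hwide => ?_, fun hhalf => ?_⟩
    · have hmn' : 2 * m ≤ n := by
        have : 2 * (m : ℝ) ≤ n := by linarith
        exact_mod_cast this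
      obtain ⟨hs, hle⟩ := h₂ n m hm hmn' _ hq
      refine (h.dTV_le hmn hs).trans (hle.trans ?_)
      have hlog := half_le_log_sqrt_varSum hm hmn'
      calc K₂ * (√(varSum n m) * (1 / √(m : ℝ)) ^ R)
          = 2 * K₂ * (√(varSum n m) * (1 / 2) * (1 / √(m : ℝ)) ^ R) := by ring
        _ ≤ 2 * K₂ * (√(varSum n m) * Real.log √(varSum n m) * (1 / √(m : ℝ)) ^ R) := by gcongr
        _ ≤ _ := by
          gcongr
          linarith
    · have hmn' : n ≤ 2 * m := by
        have : (n : ℝ) ≤ 2 * m := by linarith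
        exact_mod_cast this
      have hm2 : m + 2 ≤ n := by
        -- The case `n = m + 1` is excluded because there `a₂ = 0`.
        by_contra hcon
        obtain rfl : n = m + 1 := by omega
        rw [aSum_self_pred (by norm_num)] at ha
        linarith
      obtain ⟨hs, hle⟩ := h₁ n m hmn' hm2 ha _ hq
      refine (h.dTV_le hmn hs).trans (hle.trans ?_)
      have : (m : ℝ) ≤ n := by exact_mod_cast hmn.le
      have hd : 0 ≤ (n : ℝ) - m := by linarith
      gcongr
      linarith
  · intro n m hn hmn ha Ω _ P _ X h
    rw [h.timeVar_eq hmn]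
    by_cases hm2 : m + 2 ≤ n
    · obtain ⟨hs, hle⟩ := h₃ n m hm2 hn ha _ (h.isCollectorLaw hmn)
      exact (h.dTV_le hmn hs).trans hle
    -- One coupon is needed, so `σ² = 0` and both measures are the unit mass at `0`.
    · obtain rfl : n = m + 1 := by omega
      have e : ∀ j, |collectorLaw P X m j - pcMass (varSum (m + 1) m)
          (HPoly (m + 1) m R (3 * R - 2)) j| = 0 := by
        intro j
        rw [varSum_self_pred, HPoly_self_pred, pcMass_zero_one, collectorLaw_self_pred X, sub_self,
          abs_zero]
      refine (h.dTV_le hmn (by simp only [e]; exact summable_zero)).trans ?_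
      simp only [e, tsum_zero]
      push_cast
      have : (0 : ℝ) ≤ (m : ℝ) + 1 - m := by linarith
      positivity
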